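/- Let $M$ be a connected orientable smooth manifold of dimension $n=2d+1$, let $\mathcal D\subset TM$ be a smooth distribution of rank $k=2d$ with $\mathcal D+[\mathcal D,\mathcal D]=TM$, and let $g$ be a smooth scalar product on $\mathcal D$. Let $\eta$ be a smooth one-form on $M$ with $\ker\eta=\mathcal D$, and define $J:\mathcal D\to\mathcal D$ by $g(X,JY)=d\eta(X,Y)$. Assume that $\ker J=0$ (the structure is contact) and that $\eta$ is normalized by $\|J\|^2=\operatorname{tr}(JJ^*)=1$. The Reeb vector field $Z$ is the unique vector field with $\eta(Z)=1$ and $d\eta(Z,\cdot)=0$. A volume is a smooth nowhere vanishing $n$-form $\omega$; its macroscopic Laplacian is $\Delta_\omega=\operatorname{div}_\omega\circ\operatorname{grad}$ on $C^\infty(M)$, where $\mathcal L_X\omega=\operatorname{div}_\omega(X)\,\omega$ and $\operatorname{grad}\phi\in\mathcal D$ is the horizontal gradient, $g(\operatorname{grad}\phi,v)=d\phi(v)$ for $v\in\mathcal D$. Popp's volume $\mathcal P$ is the volume (unique up to sign, that is, up to the choice of an orientation) with $|\mathcal P_q(X_1,\dots,X_k,x)|=1$ whenever $X_1,\dots,X_k$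 is an orthonormal basis of $\mathcal D_q$ and $x\in T_qM$ projects to a unit vector of $T_qM/\mathcal D_q$, where $T_qM/\mathcal D_q$ carries the quotient norm induced from $\mathcal D_q\otimes\mathcal D_q$ by the surjection $v\otimes w\mapsto[V,W]_q \bmod \mathcal D_q$ ($V,W$ being horizontal extensions of $v,w$). A complement is a smooth sub-bundle $\mathcal V$ with $TM=\mathcal D\oplus\mathcal V$. For $\lambda\in T_q^*M$ let $H(\lambda)=\frac12\sum_{i=1}^k\langle\lambda,X_i\rangle^2$, with $X_1,\dots,X_k$ an orthonormal basis of $\mathcal D_q$, and let $\exp_q(t,\lambda)$ be the projection to $M$ at time $t$ of the integral curve of the Hamiltonian vector field of $H$ that starts at $\lambda$. The cylinder $\{\lambda\in T_q^*M: 2H(\lambda)=1\}$ is identified, through $(a,b)\mapsto a+b$, with $\mathbb S_q\times\mathcal D_q^\perp$, where $\mathbb S_q$ is the unit sphere of $(\mathcal V_q^\perp,2H)$ and $\perp$ denotes annihilators. A family of measures $\mu_q=\mu_{\mathbb S_q}\times\nu_q$ on the cylinders is adapted to $\mathcal V$ if $\mu_{\mathbb S_q}$ is the uniform probability measure, $\nu_q$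 is a probability measure on $\mathcal D_q^\perp$ for which all linear functions are square integrable, and $q\mapsto\int f^2\,d\mu_q$ is continuous for every continuous fibrewise linear $f:T^*M\to\mathbb R$. The microscopic Laplacian of $\mathcal V$ is $$(L^{\mathcal V}\phi)(q)=\lim_{t\to0^+}\frac{2k}{t^2}\int\bigl(\phi(\exp_q(t,\lambda))-\phi(q)\bigr)\,d\mu_q(\lambda),\qquad \phi\in C^\infty(M),\ q\in M,$$ for any adapted family; adapted families exist, the limit exists, and it does not depend on the adapted family. Then Popp's volume $\mathcal P$ exists, and: 1. there is exactly one complement $\mathcal V$ with $L^{\mathcal V}=\Delta_{\mathcal P}$, namely $\mathcal V=\operatorname{span}\{Z\}$; 2. for $\mathcal V=\operatorname{span}\{Z\}$ and any volume $\omega$, one has $L^{\mathcal V}=\Delta_\omega$ if and only if $\omega=c\,\mathcal P$ for a constant $c\neq0$. -/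

import Mathlib

open Set Filter Topology MeasureTheory
open scoped Manifold ContDiff

noncomputable section

namespace SubRiem

/-! ### Tangent and cotangent spaces

`M` is a smooth manifold without boundary of dimension `k + 1`, modelled on Euclidean space. -/

/-- The model space of a manifold of dimension `k + 1`. -/
abbrev Model (k : ℕ) : Type := EuclideanSpace ℝ (Fin (k + 1))

section Basics

variable {k : ℕ} {M : Type*} [TopologicalSpace M] [ChartedSpace (Model k) M]
    [IsManifold 𝓘(ℝ, Model k) ∞ M]

/-- The tangent space `T_q M`. -/
abbrev Tan (k : ℕ) {M : Type*} [TopologicalSpace M] [ChartedSpace (Model k) M] (q : M) : Type :=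
  TangentSpace 𝓘(ℝ, Model k) q

/-- The cotangent space `T_q^* M`. -/
abbrev Cotan (k : ℕ) {M : Type*} [TopologicalSpace M] [ChartedSpace (Model k) M] (q : M) : Type :=
  TangentSpace 𝓘(ℝ, Model k) q →L[ℝ] ℝ

instance instT2Tan (q : M) : T2Space (Tan k q) := inferInstanceAs (T2Space (Model k))

instance instFiniteDimensionalTan (q : M) : FiniteDimensional ℝ (Tan k q) :=
  inferInstanceAs (FiniteDimensional ℝ (Model k))

/-- Cotangent spaces carry their Borel σ-algebra. -/
instance instMeasurableSpaceCotan (q : M) : MeasurableSpace (Cotan k q) := borel _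

instance instBorelSpaceCotan (q : M) : BorelSpace (Cotan k q) := ⟨rfl⟩

/-- The total space `T^* M`. -/
abbrev CotangentSpace (k : ℕ) (M : Type*) [TopologicalSpace M] [ChartedSpace (Model k) M] : Type _ :=
  Σ q : M, Cotan k q

/-- (Not necessarily smooth) vector fields. -/
abbrev VField (k : ℕ) (M : Type*) [TopologicalSpace M] [ChartedSpace (Model k) M] : Type _ :=
  (q : M) → Tan k q

/-- `X` is a smooth vector field on the set `U`. -/
def SmoothVFieldOn (X : VField k M) (U : Set M) : Prop :=
  ContMDiffOn 𝓘(ℝ, Model k) (𝓘(ℝ, Model k)).tangent ∞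
    (fun q => (⟨q, X q⟩ : TangentBundle 𝓘(ℝ, Model k) M)) U

/-- A one-form is smooth if its values on smooth local vector fields are smooth functions. -/
def SmoothOneForm (η : (q : M) → Cotan k q) : Prop :=
  ∀ U : Set M, IsOpen U → ∀ X : VField k M, SmoothVFieldOn X U →
    ContMDiffOn 𝓘(ℝ, Model k) 𝓘(ℝ, ℝ) ∞ (fun q => η q (X q)) U

/-- The exterior derivative of a one-form at `q`, with the normalization
`dη(X, Y) = X(η(Y)) - Y(η(X)) - η([X, Y])`. It is computed in the preferred chart at `q`, whose
differential at `q` is the identity of `T_q M = ℝ^(k+1)`. -/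
def dOneForm (η : (q : M) → Cotan k q) (q : M) : Tan k q →L[ℝ] Tan k q →L[ℝ] ℝ :=
  let A : Model k →L[ℝ] Model k →L[ℝ] ℝ :=
    fderiv ℝ (fun x : Model k =>
        ((η ((extChartAt 𝓘(ℝ, Model k) q).symm x)).comp
          (mfderiv 𝓘(ℝ, Model k) 𝓘(ℝ, Model k) (extChartAt 𝓘(ℝ, Model k) q).symm x) :
            Model k →L[ℝ] ℝ))
      (extChartAt 𝓘(ℝ, Model k) q q)
  A - A.flip

/-- Differential forms of top degree `n = k + 1`. -/
abbrev TopForm (k : ℕ) (M : Type*) [TopologicalSpace M] [ChartedSpace (Model k) M] : Type _ :=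
  (q : M) → (Tan k q) [⋀^Fin (k + 1)]→ₗ[ℝ] ℝ

/-- A volume form: a smooth nowhere vanishing form of top degree. -/
structure IsVolumeForm (vol : TopForm k M) : Prop where
  smooth : ∀ U : Set M, IsOpen U → ∀ Y : Fin (k + 1) → VField k M, (∀ i, SmoothVFieldOn (Y i) U) →
    ContMDiffOn 𝓘(ℝ, Model k) 𝓘(ℝ, ℝ) ∞ (fun q => vol q (fun i => Y i q)) U
  ne_zero : ∀ q, vol q ≠ 0

/-- The Lie derivative `(𝓛_X vol)_q (v_0, …, v_k)`, in the preferred chart at `q` (whose differential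
at `q` is the identity): for constant fields `v_i` one has `[X, v_i] = - DX(v_i)`, so that
`(𝓛_X vol)(v) = X(vol(v)) - ∑ vol(…, [X, v_i], …) = X(vol(v)) + ∑ vol(…, DX(v_i), …)`. -/
def lieDerivForm (X : VField k M) (vol : TopForm k M) (q : M) (v : Fin (k + 1) → Tan k q) : ℝ :=
  let c := extChartAt 𝓘(ℝ, Model k) q
  let X' : Model k → Model k := fun x =>
    mfderiv 𝓘(ℝ, Model k) 𝓘(ℝ, Model k) c (c.symm x) (X (c.symm x))
  let vol' : Model k → (Fin (k + 1) → Model k) → ℝ := fun x w =>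
    vol (c.symm x) (fun i => mfderiv 𝓘(ℝ, Model k) 𝓘(ℝ, Model k) c.symm x (w i))
  fderiv ℝ (fun x => vol' x v) (c q) (X' (c q)) +
    ∑ i, vol' (c q) (Function.update v i (fderiv ℝ X' (c q) (v i)))

/-- The divergence: the function with `𝓛_X vol = div_vol(X) vol`. As `𝓛_X vol` and `vol` are forms of top
degree, it is the quotient of their values on one basis of `T_q M`. -/
def divergence (vol : TopForm k M) (X : VField k M) (q : M) : ℝ :=
  let e : Fin (k + 1) → Tan k q := fun i => (EuclideanSpace.basisFun (Fin (k + 1)) ℝ i : Model k)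
  lieDerivForm X vol q e / vol q e

/-- `Z` is the Reeb vector field of the one-form `η`. -/
def IsReebField (η : (q : M) → Cotan k q) (Z : VField k M) : Prop :=
  ∀ q, (∀ w : Tan k q, dOneForm η q (Z q) w = 0) ∧ η q (Z q) = 1

/-- `X` is an orthonormal basis of the subspace `D` of `T_q M` for the bilinear form `g` on `D`. -/
def IsONB {q : M} {D : Submodule ℝ (Tan k q)} (g : LinearMap.BilinForm ℝ D) (X : Fin k → D) :
    Prop :=
  (∀ i j, g (X i) (X j) = if i = j then 1 else 0) ∧ Submodule.span ℝ (range X) = ⊤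

/-- `X` is smooth near `q`, with values in the family of subspaces `D`. -/
def IsSectionNear (D : (q : M) → Submodule ℝ (Tan k q)) (q : M) (X : VField k M) : Prop :=
  ∃ U : Set M, IsOpen U ∧ q ∈ U ∧ SmoothVFieldOn X U ∧ ∀ p ∈ U, X p ∈ D p

end Basics

/-- A sub-Riemannian structure of corank one and step two: a distribution `D` of rank `k` on a
manifold of dimension `k + 1`, with a scalar product on `D`, both smooth (that is, locally given by a
smooth orthonormal frame), such that `D + [D, D] = TM`. -/
structure CorankOneStructure (k : ℕ) (M : Type*) [TopologicalSpace M] [ChartedSpace (Model k) M]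
    [IsManifold 𝓘(ℝ, Model k) ∞ M] where
  /-- the distribution -/
  D : (q : M) → Submodule ℝ (Tan k q)
  /-- the scalar product on the distribution -/
  g : (q : M) → LinearMap.BilinForm ℝ (D q)
  symm : ∀ q v w, g q v w = g q w v
  pos : ∀ q v, v ≠ 0 → 0 < g q v v
  frame : ∀ q : M, ∃ U : Set M, IsOpen U ∧ q ∈ U ∧ ∃ X : Fin k → VField k M,
    (∀ i, SmoothVFieldOn (X i) U) ∧
      ∀ p ∈ U, ∃ h : ∀ i, X i p ∈ D p, IsONB (g p) (fun i => ⟨X i p, h i⟩)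
  step_two : ∀ q : M, D q ⊔ Submodule.span ℝ
    {w | ∃ V W : VField k M, IsSectionNear D q V ∧ IsSectionNear D q W ∧
      w = VectorField.mlieBracket 𝓘(ℝ, Model k) V W q} = ⊤

namespace CorankOneStructure

variable {k : ℕ} {M : Type*} [TopologicalSpace M] [ChartedSpace (Model k) M]
    [IsManifold 𝓘(ℝ, Model k) ∞ M]
  (S : CorankOneStructure k M)

theorem nondegenerate (q : M) : (S.g q).Nondegenerate := by
  constructor
  · intro v hv
    by_contra h
    exact (S.pos q v h).ne' (hv v)
  · intro v hv
    by_contra h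
    exact (S.pos q v h).ne' (hv v)

theorem exists_onb (q : M) : ∃ X : Fin k → S.D q, IsONB (S.g q) X := by
  obtain ⟨U, -, hq, X, -, hX⟩ := S.frame q
  obtain ⟨h, hh⟩ := hX q hq
  exact ⟨_, hh⟩

/-- Some orthonormal basis of `D_q`. -/
def onb (q : M) : Fin k → S.D q := (S.exists_onb q).choose

/-- The horizontal vector dual to a covector: the element `λ^♯` of `D_q` with
`g(λ^♯, v) = ⟨λ, v⟩` for all `v` in `D_q`. -/
def sharp (q : M) (l : Cotan k q) : S.D q :=
  ((S.g q).toDual (S.nondegenerate q)).symm (l.toLinearMap.comp (S.D q).subtype)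

/-- The horizontal gradient. -/
def grad (f : M → ℝ) : VField k M := fun q => (S.sharp q (mvfderiv 𝓘(ℝ, Model k) f q) : Tan k q)

/-- The smooth functions on `M`. -/
abbrev SmoothFun (k : ℕ) (M : Type*) [TopologicalSpace M] [ChartedSpace (Model k) M] : Type _ :=
  ContMDiffMap 𝓘(ℝ, Model k) 𝓘(ℝ, ℝ) M ℝ ∞

/-- The macroscopic Laplacian `Δ_vol = div_vol ∘ grad`. -/
def macroLaplacian (vol : TopForm k M) (f : SmoothFun k M) : M → ℝ :=
  divergence vol (S.grad f)

/-! ### Contact structures -/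

/-- The endomorphism `J` of `D_q` with `g(X, J Y) = dη(X, Y) = - dη(Y, X)`. -/
def J (η : (q : M) → Cotan k q) (q : M) (Y : S.D q) : S.D q :=
  S.sharp q (-(dOneForm η q Y))

/-- `η` is a normalized global contact form of the structure: `D = ker η`, the endomorphism `J` is
injective, and `‖J‖² = tr(J J^*) = ∑ g(X_i, J X_j)² = 1`. -/
structure IsNormalizedContactForm (η : (q : M) → Cotan k q) : Prop where
  smooth : SmoothOneForm η
  ker : ∀ (q : M) (v : Tan k q), v ∈ S.D q ↔ η q v = 0
  contact : ∀ (q : M) (Y : S.D q), S.J η q Y = 0 → Y = 0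
  norm_eq_one : ∀ (q : M) (X : Fin k → S.D q), IsONB (S.g q) X →
    ∑ i, ∑ j, (S.g q (X i) (S.J η q (X j))) ^ 2 = 1

/-! ### Popp's volume -/

/-- The square of the norm of the class of `x` in `T_q M / D_q = D²_q / D_q`: the least square norm
of an element `e = ∑ v_s ⊗ w_s` of `D_q ⊗ D_q` that is mapped to the class of `x` by
`v ⊗ w ↦ [V, W]_q mod D_q`, where `V`, `W` are horizontal extensions of `v`, `w`. Here
`‖∑ v_s ⊗ w_s‖² = ∑ g(v_s, v_t) g(w_s, w_t)`. -/
def quotNormSq (q : M) (x : Tan k q) : ℝ :=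
  sInf {r : ℝ | ∃ (m : ℕ) (v w : Fin m → S.D q) (V W : Fin m → VField k M),
    (∀ s, IsSectionNear S.D q (V s) ∧ V s q = v s) ∧
    (∀ s, IsSectionNear S.D q (W s) ∧ W s q = w s) ∧
    x - ∑ s, VectorField.mlieBracket 𝓘(ℝ, Model k) (V s) (W s) q ∈ S.D q ∧
    r = ∑ s, ∑ t, S.g q (v s) (v t) * S.g q (w s) (w t)}

/-- `P` is Popp's volume (for one of the orientations of `M`): a volume form with value `±1` on each
basis `X_1, …, X_k, x` of `T_q M` for which `X_1, …, X_k` is an orthonormal basis of `D_q` and the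
class of `x` is a unit vector of `D²_q / D_q`, so that the basis induces an orthonormal basis of
`D_q ⊕ D²_q / D_q`. -/
structure IsPoppVolume (P : TopForm k M) : Prop where
  isVolumeForm : IsVolumeForm P
  abs_eq_one : ∀ (q : M) (X : Fin k → S.D q) (x : Tan k q), IsONB (S.g q) X →
    S.quotNormSq q x = 1 →
      |P q (Fin.snoc (α := fun _ => Tan k q) (fun i => (X i : Tan k q)) x)| = 1

/-! ### Normal geodesics -/

/-- The Hamiltonian `H(λ) = ½ ∑ ⟨λ, X_i⟩²`, for `X_i` an orthonormal basis of `D_q`; the sum is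
`⟨λ, λ^♯⟩`. -/
def hamiltonian (l : CotangentSpace k M) : ℝ := 1 / 2 * l.2 (S.sharp l.1 l.2 : Tan k l.1)

/-- The Hamiltonian in the canonical coordinates `(x, ξ)` of `T^* M` that are induced by the
preferred chart at `p`. -/
def chartHamiltonian (p : M) (x : Model k) (ξ : Model k →L[ℝ] ℝ) : ℝ :=
  S.hamiltonian ⟨(extChartAt 𝓘(ℝ, Model k) p).symm x,
    (ξ.comp (mfderiv 𝓘(ℝ, Model k) 𝓘(ℝ, Model k) (extChartAt 𝓘(ℝ, Model k) p)
      ((extChartAt 𝓘(ℝ, Model k) p).symm x)) :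
        Cotan k ((extChartAt 𝓘(ℝ, Model k) p).symm x))⟩

/-- The position coordinate of a covector. -/
def posCoord (p : M) (l : CotangentSpace k M) : Model k := extChartAt 𝓘(ℝ, Model k) p l.1

/-- The momentum coordinate of a covector. -/
def momCoord (p : M) (l : CotangentSpace k M) : Model k →L[ℝ] ℝ :=
  ContinuousLinearMap.comp (l.2 : Model k →L[ℝ] ℝ)
    (mfderiv 𝓘(ℝ, Model k) 𝓘(ℝ, Model k) (extChartAt 𝓘(ℝ, Model k) p).symm (posCoord p l) :
      Model k →L[ℝ] Model k)

/-- `c : [0, T] → T^* M` is an integral curve of the Hamiltonian vector field: it satisfies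
Hamilton's equations `ẋ = ∂H/∂ξ`, `ξ̇ = - ∂H/∂x` in canonical coordinates. -/
def IsNormalExtremal (T : ℝ) (c : ℝ → CotangentSpace k M) : Prop :=
  ContinuousOn (fun s => (c s).1) (Icc 0 T) ∧
  ∀ p : M, ∀ t ∈ Icc 0 T, (c t).1 ∈ (extChartAt 𝓘(ℝ, Model k) p).source →
    ∃ (x' : Model k) (ξ' : Model k →L[ℝ] ℝ),
      HasDerivWithinAt (fun s => posCoord p (c s)) x' (Icc 0 T) t ∧
      HasDerivWithinAt (fun s => momCoord p (c s)) ξ' (Icc 0 T) t ∧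
      (∀ α : Model k →L[ℝ] ℝ,
        fderiv ℝ (fun ξ => S.chartHamiltonian p (posCoord p (c t)) ξ) (momCoord p (c t)) α = α x') ∧
      (∀ v : Model k,
        fderiv ℝ (fun x => S.chartHamiltonian p x (momCoord p (c t))) (posCoord p (c t)) v = - ξ' v)

open Classical in
/-- The exponential map `exp_q(t, λ)`: the endpoint of the normal geodesic on `[0, t]` with initial
covector `λ` (and `q` where this geodesic does not exist up to time `t`). -/
def expMap (q : M) (t : ℝ) (l : Cotan k q) : M :=
  if h : ∃ c : ℝ → CotangentSpace k M, S.IsNormalExtremal t c ∧ c 0 = ⟨q, l⟩ then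
    (h.choose t).1
  else q

/-! ### Complements, adapted measures, and the microscopic Laplacian -/

/-- A complement of the distribution: a smooth sub-bundle `V` with `TM = D ⊕ V`. -/
@[ext]
structure Complement where
  /-- the fibres -/
  V : (q : M) → Submodule ℝ (Tan k q)
  isCompl : ∀ q, IsCompl (S.D q) (V q)
  smooth : ∀ q : M, ∃ U : Set M, IsOpen U ∧ q ∈ U ∧ ∃ X₀ : VField k M,
    SmoothVFieldOn X₀ U ∧ ∀ p ∈ U, V p = Submodule.span ℝ {X₀ p}

end CorankOneStructure

/-- The uniform probability measure on the unit sphere of `ℝ^k`, as a measure on `ℝ^k`. -/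
def unifSphere (k : ℕ) : Measure (EuclideanSpace ℝ (Fin k)) :=
  let σ := (volume : Measure (EuclideanSpace ℝ (Fin k))).toSphere
  ((σ univ)⁻¹ • σ).map Subtype.val

namespace CorankOneStructure

variable {k : ℕ} {M : Type*} [TopologicalSpace M] [ChartedSpace (Model k) M]
    [IsManifold 𝓘(ℝ, Model k) ∞ M]
  {S : CorankOneStructure k M} (V : S.Complement)

/-- The isometry of `D_q` onto the horizontal covectors (the annihilator of `V_q`, with the scalar
product `2H`): the covector that is `g(v, ·)` on `D_q` and `0` on `V_q`. -/
def Complement.lift (q : M) (v : S.D q) : Cotan k q :=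
  LinearMap.toContinuousLinearMap
    ((S.g q v).comp (Submodule.projectionOnto (S.D q) (V.V q) (V.isCompl q)))

/-- The uniform probability measure on the sphere of horizontal covectors `λ` with `2H(λ) = 1`:
the image of the uniform measure of the unit sphere of `ℝ^k` under a linear isometry. -/
def Complement.sphereMeasure (q : M) : Measure (Cotan k q) :=
  (unifSphere k).map (fun c => V.lift q (∑ i, c i • S.onb q i))

/-- The measure `μ_q` on the cylinder `{λ | 2H(λ) = 1}`, which is the product of the sphere of
horizontal covectors with the space of vertical covectors through `(a, b) ↦ a + b`: the product of
the uniform measure with the measure `ν` on the vertical covectors. -/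
def Complement.cylMeasure (q : M) (ν : Measure (Cotan k q)) : Measure (Cotan k q) :=
  ((V.sphereMeasure q).prod ν).map (fun a => a.1 + a.2)

/-- `ν_q` are `2`-decreasing probability measures on the vertical covectors (those that annihilate
`D_q`) such that the measures `μ_q` on the cylinders satisfy: for every continuous fibrewise linear
function on `T^* M`, that is, `λ ↦ ⟨λ, X⟩` for a continuous vector field `X`, the integral of its
square with respect to `μ_q` is a continuous function of `q`. -/
structure Complement.IsAdapted (ν : (q : M) → Measure (Cotan k q)) : Prop where
  prob : ∀ q, IsProbabilityMeasure (ν q)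
  vertical : ∀ q, ∀ᵐ l ∂(ν q), ∀ v ∈ S.D q, l v = 0
  two_decreasing : ∀ (q : M) (w : Tan k q), MemLp (fun l : Cotan k q => l w) 2 (ν q)
  continuous : ∀ X : VField k M,
    Continuous (fun q => (⟨q, X q⟩ : TangentBundle 𝓘(ℝ, Model k) M)) →
      Continuous (fun q => ∫ l, (l (X q)) ^ 2 ∂(V.cylMeasure q (ν q)))

/-- `L` is the microscopic Laplacian `L^V`: there are adapted measures, and for each choice of them
`(L φ)(q) = lim_{t → 0+} (2k / t²) ∫ (φ(exp_q(t, λ)) - φ(q)) dμ_q(λ)`. -/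
def Complement.IsMicroLaplacian (L : SmoothFun k M → M → ℝ) : Prop :=
  (∃ ν, V.IsAdapted ν) ∧
  ∀ ν, V.IsAdapted ν → ∀ (φ : SmoothFun k M) (q : M),
    Tendsto (fun t : ℝ => 2 * (k : ℝ) / t ^ 2 *
        ∫ l, (φ (S.expMap q t l) - φ q) ∂(V.cylMeasure q (ν q)))
      (𝓝[>] 0) (𝓝 (L φ q))

end CorankOneStructure

end SubRiem

end

/-! Fix a complement `V` and, near a point q, an orthonormal frame X_1, …, X_k of `D` together with
the section X_0 of `V` with η(X_0) = 1. Both Laplacians are ∑ X_i²φ plus a first-order horizontal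
term, and the theorem is a comparison of these first-order terms.

Microscopic side. Along a normal geodesic with covector λ the derivative of φ is ∑ λ(X_i) X_iφ, and
one more derivative produces the terms λ(X_j) λ([X_j, X_i]) X_iφ and λ(X_i) λ(X_j) X_jX_iφ.
Averaging over the cylinder kills the linear Taylor term, because the sphere has mean zero, and
turns λ(X_j) λ(w) into 1/k times the X_j-component of w in the frame; the vertical measure drops out
(`integral_cyl_onb_mul`). So the coefficient of X_iφ in L^V is the sum over j of the X_j-components
of [X_j, X_i] (`tendsto_micro`). The cylinder is not compact, but 2H = 1 bounds the speed of all its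
geodesics at once and makes the second derivative grow only linearly in λ, so that dominated
convergence applies (`IsHamFlow.tendsto_integral`).

Macroscopic side. div_τ(X_i) is the logarithmic derivative of τ(X_1, …, X_k, X_0) along X_i minus
the trace of the bracket with X_i in this frame. The horizontal part of the trace gives the
coefficient found above, and its X_0-part is η([X_i, X_0]) = dη(X_0, X_i). Therefore Δ_τφ − L^Vφ = ∑
(X_i log|τ(X_1, …, X_0)| − dη(X_0, X_i)) X_iφ (`IsAdaptedFrame.macroLaplacian_sub_microValue`).

The horizontal differential of φ at a point is arbitrary, so the Laplacians agree exactly when every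
coefficient vanishes. The normalization of J makes the quotient norm equal to |η| (`quotNormSq_eq`),
so Popp's volume is ±1 on the frame and its logarithmic derivative is zero. What remains is dη(X_0,
·) = 0 on `D`, which says X_0 = Z. If instead `V` is spanned by Z, the terms dη(X_0, X_i) vanish,
and equality says that τ/P has zero horizontal derivative. Brackets of horizontal fields then
annihilate it too, and since M is connected it is constant (`exists_eq_const_of_horizontal`). -/

noncomputable section

namespace SubRiem

set_option linter.unusedSectionVars false

/-! ### Hamiltonian flows in a normed space -/

section HamiltonianFlow

variable {E : Type*} [NormedAddCommGroup E] [NormedSpace ℝ E] {ι : Type*} [Fintype ι]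

/-- The Hamiltonian vector field of `½ ∑ ξ(X_i(x))²` on `E × E^*`. -/
def hamField (X : ι → E → E) (y : E × (E →L[ℝ] ℝ)) : E × (E →L[ℝ] ℝ) :=
  (∑ i, y.2 (X i y.1) • X i y.1, -∑ i, y.2 (X i y.1) • y.2.comp (fderiv ℝ (X i) y.1))

/-- `γ` is an integral curve of `hamField X` on `[0, T]`. -/
def IsHamCurve (X : ι → E → E) (T : ℝ) (γ : ℝ → E × (E →L[ℝ] ℝ)) : Prop :=
  ∀ t ∈ Icc 0 T, HasDerivWithinAt γ (hamField X (γ t)) (Icc 0 T) t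

theorem contDiff_hamField {X : ι → E → E} (hX : ∀ i, ContDiff ℝ ∞ (X i)) :
    ContDiff ℝ 1 (hamField X) := by
  have h1 : ∀ i, ContDiff ℝ 1 (fun y : E × (E →L[ℝ] ℝ) => X i y.1) := fun i =>
    ((hX i).of_le (by norm_cast)).comp contDiff_fst
  have h2 : ∀ i, ContDiff ℝ 1 (fun y : E × (E →L[ℝ] ℝ) => fderiv ℝ (X i) y.1) := fun i =>
    ((hX i).fderiv_right (m := 1) (by norm_cast)).comp contDiff_fst
  have h3 : ∀ i, ContDiff ℝ 1 (fun y : E × (E →L[ℝ] ℝ) => y.2 (X i y.1)) := fun i =>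
    contDiff_snd.clm_apply (h1 i)
  exact (ContDiff.sum fun i _ => (h3 i).smul (h1 i)).prodMk
    (ContDiff.sum fun i _ => (h3 i).smul (contDiff_snd.clm_comp (h2 i))).neg

theorem hasDerivWithinAt_fst {F G : Type*} [NormedAddCommGroup F] [NormedSpace ℝ F]
    [NormedAddCommGroup G] [NormedSpace ℝ G] {γ : ℝ → F × G} {v : F × G} {s : Set ℝ} {t : ℝ}
    (h : HasDerivWithinAt γ v s t) : HasDerivWithinAt (fun u => (γ u).1) v.1 s t := by
  simpa using h.hasFDerivWithinAt.fst.hasDerivWithinAt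

theorem hasDerivWithinAt_snd {F G : Type*} [NormedAddCommGroup F] [NormedSpace ℝ F]
    [NormedAddCommGroup G] [NormedSpace ℝ G] {γ : ℝ → F × G} {v : F × G} {s : Set ℝ} {t : ℝ}
    (h : HasDerivWithinAt γ v s t) : HasDerivWithinAt (fun u => (γ u).2) v.2 s t := by
  simpa using h.hasFDerivWithinAt.snd.hasDerivWithinAt

/-- Hamilton's equations in Poisson-bracket form. The factor `c` lets the lemma serve the field cut
off in the momentum, which along a curve is a scalar multiple of `hamField X`. -/
theorem hasDerivWithinAt_pairing {X : ι → E → E} {γ : ℝ → E × (E →L[ℝ] ℝ)} {c t : ℝ} {s : Set ℝ}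
    (hγ : HasDerivWithinAt γ (c • hamField X (γ t)) s t) {Y : E → E}
    (hY : DifferentiableAt ℝ Y (γ t).1) :
    HasDerivWithinAt (fun u => (γ u).2 (Y (γ u).1))
      (c * ∑ j, (γ t).2 (X j (γ t).1) *
        (γ t).2 (VectorField.lieBracket ℝ (X j) Y (γ t).1)) s t := by
  have h1 := hasDerivWithinAt_fst hγ
  have h2 := hasDerivWithinAt_snd hγ
  have h3 := hY.hasFDerivAt.comp_hasDerivWithinAt t h1
  have h4 := h2.clm_apply h3
  convert! h4 using 1
  simp only [hamField, Prod.smul_fst, Prod.smul_snd, VectorField.lieBracket, map_sub, map_smul,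
    map_sum, smul_eq_mul, smul_neg, neg_apply, smul_apply,
    sum_apply, ContinuousLinearMap.comp_apply, Function.comp_apply, mul_sub,
    Finset.sum_sub_distrib]
  ring

theorem hasDerivWithinAt_comp_fst {X : ι → E → E} {γ : ℝ → E × (E →L[ℝ] ℝ)} {t : ℝ} {s : Set ℝ}
    (hγ : HasDerivWithinAt γ (hamField X (γ t)) s t) {a : E → ℝ}
    (ha : DifferentiableAt ℝ a (γ t).1) :
    HasDerivWithinAt (fun u => a (γ u).1)
      (∑ j, (γ t).2 (X j (γ t).1) * fderiv ℝ a (γ t).1 (X j (γ t).1)) s t := by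
  have h3 := ha.hasFDerivAt.comp_hasDerivWithinAt t (hasDerivWithinAt_fst hγ)
  convert! h3 using 1
  simp [hamField, map_sum]

/-- Conservation of the Hamiltonian. A scalar factor on the field does not affect it, so it survives
the momentum cutoff. -/
theorem sum_sq_pairing_eq {X : ι → E → E} (hX : ∀ i, ContDiff ℝ ∞ (X i)) {T : ℝ}
    {γ : ℝ → E × (E →L[ℝ] ℝ)} {c : ℝ → ℝ}
    (hγ : ∀ t ∈ Icc 0 T, HasDerivWithinAt γ (c t • hamField X (γ t)) (Icc 0 T) t) :
    ∀ t ∈ Icc 0 T, ∑ i, ((γ t).2 (X i (γ t).1)) ^ 2 = ∑ i, ((γ 0).2 (X i (γ 0).1)) ^ 2 := by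
  have key : ∀ t ∈ Icc 0 T, HasDerivWithinAt (fun u => ∑ i, ((γ u).2 (X i (γ u).1)) ^ 2) 0
      (Icc 0 T) t := by
    intro t ht
    have h1 := fun i => (hasDerivWithinAt_pairing (hγ t ht)
      ((hX i).differentiable (by simp) (γ t).1)).pow 2
    have h2 := HasDerivWithinAt.fun_sum (u := Finset.univ) fun i _ => h1 i
    convert! h2 using 1
    set x := (γ t).1
    set ξ := (γ t).2
    -- The bracket is antisymmetric, so exchanging i and j turns the sum into its negative.
    have h3 : ∑ i, ∑ j, ξ (X i x) * (ξ (X j x) * ξ (VectorField.lieBracket ℝ (X j) (X i) x)) = 0 := by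
      have h4 : ∑ i, ∑ j, ξ (X i x) * (ξ (X j x) * ξ (VectorField.lieBracket ℝ (X j) (X i) x)) =
          - ∑ i, ∑ j, ξ (X i x) * (ξ (X j x) * ξ (VectorField.lieBracket ℝ (X j) (X i) x)) := by
        conv_lhs => rw [Finset.sum_comm]
        rw [← Finset.sum_neg_distrib]
        refine Finset.sum_congr rfl fun i _ => ?_
        rw [← Finset.sum_neg_distrib]
        refine Finset.sum_congr rfl fun j _ => ?_
        rw [VectorField.lieBracket_swap]
        simp
        ring
      linarith
    have h5 : ∀ i, (2 : ℕ) * ξ (X i x) ^ (2 - 1) * (c t * ∑ j, ξ (X j x) *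
        ξ (VectorField.lieBracket ℝ (X j) (X i) x)) =
        2 * c t * ∑ j, ξ (X i x) * (ξ (X j x) * ξ (VectorField.lieBracket ℝ (X j) (X i) x)) := by
      intro i
      rw [← Finset.mul_sum]
      norm_num
      ring
    rw [Finset.sum_congr rfl fun i _ => h5 i, ← Finset.mul_sum, h3, mul_zero]
  intro t ht
  refine constant_of_has_deriv_right_zero (fun u hu => (key u hu).continuousWithinAt) ?_ t ht
  intro u hu
  exact (key u (Ico_subset_Icc_self hu)).mono_of_mem_nhdsWithin (Icc_mem_nhdsGE_of_mem hu)

end HamiltonianFlow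

/-! ### A priori bounds, existence and stability of Hamiltonian curves. -/

section HamiltonianFlow

variable {E : Type*} [NormedAddCommGroup E] [NormedSpace ℝ E] {ι : Type*} [Fintype ι]

theorem exists_bound_fields {F : Type*} [NormedAddCommGroup F] [NormedSpace ℝ F] {X : ι → E → F}
    (hX : ∀ i, ContDiff ℝ ∞ (X i)) (hc : ∀ i, HasCompactSupport (X i)) :
    ∃ B : ℝ, 0 ≤ B ∧ ∀ i x, ‖X i x‖ ≤ B ∧ ‖fderiv ℝ (X i) x‖ ≤ B := by
  choose C hC using fun i => (hc i).exists_bound_of_continuous (hX i).continuous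
  choose C' hC' using fun i => ((hc i).fderiv (𝕜 := ℝ)).exists_bound_of_continuous
    ((hX i).continuous_fderiv (by simp))
  refine ⟨∑ i, (|C i| + |C' i|), by positivity, fun i x => ?_⟩
  have h := Finset.single_le_sum (f := fun i => |C i| + |C' i|) (fun i _ => by positivity)
    (Finset.mem_univ i)
  have h1 := (hC i x).trans (le_abs_self _)
  have h2 := (hC' i x).trans (le_abs_self _)
  have h3 := abs_nonneg (C i)
  have h4 := abs_nonneg (C' i)
  exact ⟨by linarith, by linarith⟩

theorem abs_le_one_of_sum_sq_le_one {h : ι → ℝ} (hh : ∑ i, h i ^ 2 ≤ 1) (i : ι) : |h i| ≤ 1 := by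
  rw [← sq_le_one_iff_abs_le_one]
  exact (Finset.single_le_sum (f := fun i => h i ^ 2) (fun i _ => sq_nonneg _)
    (Finset.mem_univ i)).trans hh

theorem norm_hamField_fst_le {X : ι → E → E} {B : ℝ} (hB : ∀ i x, ‖X i x‖ ≤ B)
    {y : E × (E →L[ℝ] ℝ)} (hy : ∑ i, (y.2 (X i y.1)) ^ 2 ≤ 1) :
    ‖(hamField X y).1‖ ≤ Fintype.card ι * B := by
  refine (norm_sum_le _ _).trans ?_
  rw [← nsmul_eq_mul, ← Finset.card_univ]
  refine Finset.sum_le_card_nsmul _ _ _ fun i _ => ?_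
  rw [norm_smul, Real.norm_eq_abs]
  calc _ ≤ 1 * B := mul_le_mul (abs_le_one_of_sum_sq_le_one hy i) (hB i _) (norm_nonneg _) zero_le_one
    _ = B := one_mul B

theorem norm_hamField_snd_le {X : ι → E → E} {B : ℝ} (hB : ∀ i x, ‖fderiv ℝ (X i) x‖ ≤ B)
    {y : E × (E →L[ℝ] ℝ)} (hy : ∑ i, (y.2 (X i y.1)) ^ 2 ≤ 1) :
    ‖(hamField X y).2‖ ≤ Fintype.card ι * B * ‖y.2‖ := by
  simp only [hamField, norm_neg]
  refine (norm_sum_le _ _).trans ?_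
  rw [mul_assoc, ← nsmul_eq_mul, ← Finset.card_univ]
  refine Finset.sum_le_card_nsmul _ _ _ fun i _ => ?_
  rw [norm_smul, Real.norm_eq_abs]
  calc _ ≤ 1 * (‖y.2‖ * B) := by
        refine mul_le_mul (abs_le_one_of_sum_sq_le_one hy i) ?_ (norm_nonneg _) zero_le_one
        exact (ContinuousLinearMap.opNorm_comp_le _ _).trans
          (mul_le_mul_of_nonneg_left (hB i _) (norm_nonneg _))
    _ = B * ‖y.2‖ := by ring

/-- Conservation keeps every ξ(X_i) in [-1, 1]. The position therefore moves at bounded speed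
however large the momentum is, and the momentum satisfies a linear differential inequality, to which
Gronwall's lemma applies. -/
theorem hamCurve_bounds {X : ι → E → E} (hX : ∀ i, ContDiff ℝ ∞ (X i)) {B : ℝ}
    (hB : ∀ i x, ‖X i x‖ ≤ B ∧ ‖fderiv ℝ (X i) x‖ ≤ B) {T : ℝ}
    {γ : ℝ → E × (E →L[ℝ] ℝ)} {c : ℝ → ℝ} (hc : ∀ t, c t ∈ Icc (0 : ℝ) 1)
    (hγ : ∀ t ∈ Icc 0 T, HasDerivWithinAt γ (c t • hamField X (γ t)) (Icc 0 T) t)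
    (h0 : ∑ i, ((γ 0).2 (X i (γ 0).1)) ^ 2 ≤ 1) :
    ∀ t ∈ Icc 0 T, ‖(γ t).1 - (γ 0).1‖ ≤ Fintype.card ι * B * t ∧
      ‖(γ t).2‖ ≤ ‖(γ 0).2‖ * Real.exp (Fintype.card ι * B * t) := by
  have h1 : ∀ t ∈ Icc 0 T, ∑ i, ((γ t).2 (X i (γ t).1)) ^ 2 ≤ 1 := fun t ht =>
    (sum_sq_pairing_eq hX hγ t ht).trans_le h0
  have hcn : ∀ t, ‖c t‖ ≤ 1 := fun t => by
    rw [Real.norm_eq_abs, abs_of_nonneg (hc t).1]; exact (hc t).2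
  have hγ' : ∀ t ∈ Ico 0 T, HasDerivWithinAt γ (c t • hamField X (γ t)) (Ici t) t := fun t ht =>
    (hγ t (Ico_subset_Icc_self ht)).mono_of_mem_nhdsWithin (Icc_mem_nhdsGE_of_mem ht)
  have hcont : ContinuousOn γ (Icc 0 T) := fun t ht => (hγ t ht).continuousWithinAt
  intro t ht
  constructor
  · have h2 := norm_image_sub_le_of_norm_deriv_right_le_segment (a := 0) (b := T)
      (f := fun u => (γ u).1) (C := Fintype.card ι * B)
      (continuous_fst.comp_continuousOn hcont) (fun u hu => hasDerivWithinAt_fst (hγ' u hu))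
      (fun u hu => by
        rw [Prod.smul_fst, norm_smul]
        calc _ ≤ 1 * (Fintype.card ι * B) := mul_le_mul (hcn u)
              (norm_hamField_fst_le (fun i x => (hB i x).1) (h1 u (Ico_subset_Icc_self hu)))
              (norm_nonneg _) zero_le_one
          _ = _ := one_mul _) t ht
    simpa using h2
  · have h2 := norm_le_gronwallBound_of_norm_deriv_right_le (a := 0) (b := T)
      (f := fun u => (γ u).2) (δ := ‖(γ 0).2‖) (K := Fintype.card ι * B) (ε := 0)
      (continuous_snd.comp_continuousOn hcont) (fun u hu => hasDerivWithinAt_snd (hγ' u hu)) le_rfl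
      (fun u hu => by
        rw [Prod.smul_snd, norm_smul, add_zero]
        calc _ ≤ 1 * (Fintype.card ι * B * ‖(γ u).2‖) := mul_le_mul (hcn u)
              (norm_hamField_snd_le (fun i x => (hB i x).2) (h1 u (Ico_subset_Icc_self hu)))
              (norm_nonneg _) zero_le_one
          _ = _ := one_mul _) t ht
    rwa [gronwallBound_ε0, sub_zero] at h2

theorem IsHamCurve.bounds {X : ι → E → E} (hX : ∀ i, ContDiff ℝ ∞ (X i)) {B : ℝ}
    (hB : ∀ i x, ‖X i x‖ ≤ B ∧ ‖fderiv ℝ (X i) x‖ ≤ B) {T : ℝ}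
    {γ : ℝ → E × (E →L[ℝ] ℝ)} (hγ : IsHamCurve X T γ)
    (h0 : ∑ i, ((γ 0).2 (X i (γ 0).1)) ^ 2 ≤ 1) :
    ∀ t ∈ Icc 0 T, ‖(γ t).1 - (γ 0).1‖ ≤ Fintype.card ι * B * t ∧
      ‖(γ t).2‖ ≤ ‖(γ 0).2‖ * Real.exp (Fintype.card ι * B * t) :=
  hamCurve_bounds hX hB (c := fun _ => 1) (by simp) (fun t ht => by simpa using hγ t ht) h0

theorem IsHamCurve.sum_sq_eq {X : ι → E → E} (hX : ∀ i, ContDiff ℝ ∞ (X i)) {T : ℝ}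
    {γ : ℝ → E × (E →L[ℝ] ℝ)} (hγ : IsHamCurve X T γ) :
    ∀ t ∈ Icc 0 T, ∑ i, ((γ t).2 (X i (γ t).1)) ^ 2 = ∑ i, ((γ 0).2 (X i (γ 0).1)) ^ 2 :=
  sum_sq_pairing_eq hX (c := fun _ => 1) (fun t ht => by simpa using hγ t ht)

/-- Picard–Lindelöf on the ball of radius `L * T`, which a curve of speed at most `L` cannot leave
before time `T`; the Lipschitz constant is global, so the time interval need not shrink. -/
theorem exists_integralCurve_of_bounded_lipschitz {G : Type*} [NormedAddCommGroup G]
    [NormedSpace ℝ G] [CompleteSpace G] {F : G → G} {K : NNReal} (hK : LipschitzWith K F) {L : ℝ}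
    (hL : ∀ y, ‖F y‖ ≤ L) {T : ℝ} (hT : 0 ≤ T) (y₀ : G) :
    ∃ γ : ℝ → G, γ 0 = y₀ ∧ ∀ t ∈ Icc 0 T, HasDerivWithinAt γ (F (γ t)) (Icc 0 T) t := by
  have h : IsPicardLindelof (fun _ => F) (tmin := 0) (tmax := T) ⟨0, le_rfl, hT⟩ y₀
      (L.toNNReal * T.toNNReal) 0 L.toNNReal K :=
    { lipschitzOnWith := fun t _ => hK.lipschitzOnWith
      continuousOn := fun x _ => continuousOn_const
      norm_le := fun t _ x _ => (hL x).trans (Real.le_coe_toNNReal L)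
      mul_max_le := by simp [hT] }
  exact h.exists_eq_forall_mem_Icc_hasDerivWithinAt₀

variable [FiniteDimensional ℝ E]

/-- `hamField X` with the momentum cut off outside a ball. -/
theorem exists_cutoff_hamField {X : ι → E → E} (hX : ∀ i, ContDiff ℝ ∞ (X i))
    (hc : ∀ i, HasCompactSupport (X i)) (R : ℝ) :
    ∃ χ : (E →L[ℝ] ℝ) → ℝ, (∀ ξ, χ ξ ∈ Icc (0 : ℝ) 1) ∧ (∀ ξ, ‖ξ‖ ≤ R → χ ξ = 1) ∧
      ∃ (K : NNReal) (L : ℝ), LipschitzWith K (fun y => χ y.2 • hamField X y) ∧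
        ∀ y, ‖χ y.2 • hamField X y‖ ≤ L := by
  let χ : ContDiffBump (0 : E →L[ℝ] ℝ) :=
    ⟨|R| + 1, |R| + 2, by positivity, by linarith⟩
  have hcd : ContDiff ℝ 1 (fun y : E × (E →L[ℝ] ℝ) => χ y.2 • hamField X y) :=
    (χ.contDiff.comp contDiff_snd).smul (contDiff_hamField hX)
  have hcs : HasCompactSupport (fun y : E × (E →L[ℝ] ℝ) => χ y.2 • hamField X y) := by
    have hK : IsCompact ((⋃ i, tsupport (X i)) ×ˢ tsupport χ) :=
      (isCompact_iUnion fun i => hc i).prod χ.hasCompactSupport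
    refine HasCompactSupport.intro hK fun y hy => ?_
    rw [mem_prod, not_and_or] at hy
    rcases hy with hy | hy
    -- Both components of `hamField X` carry the factor ξ(X_i), so the derivatives of the fields
    -- play no role here.
    · have h : ∀ i, X i y.1 = 0 := fun i => image_eq_zero_of_notMem_tsupport fun h =>
        hy (mem_iUnion.2 ⟨i, h⟩)
      have : hamField X y = 0 := by
        simp only [hamField, h]
        simp
      rw [this, smul_zero]
    · rw [image_eq_zero_of_notMem_tsupport hy, zero_smul]
  obtain ⟨K, hK⟩ := hcd.lipschitzWith_of_hasCompactSupport hcs one_ne_zero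
  obtain ⟨L, hL⟩ := hcs.exists_bound_of_continuous hcd.continuous
  refine ⟨χ, fun ξ => ⟨χ.nonneg, χ.le_one⟩, fun ξ hξ => χ.one_of_mem_closedBall ?_, K, L, hK, hL⟩
  simp only [Metric.mem_closedBall, dist_zero_right]
  exact hξ.trans ((le_abs_self R).trans (by change |R| ≤ |R| + 1; linarith))

/-- The cutoff field has a solution on the whole interval. The a priori bound on the momentum, which
holds for that field too, keeps the solution where the cutoff equals 1. -/
theorem exists_isHamCurve {X : ι → E → E} (hX : ∀ i, ContDiff ℝ ∞ (X i))
    (hc : ∀ i, HasCompactSupport (X i)) {T : ℝ} (hT : 0 ≤ T) {y₀ : E × (E →L[ℝ] ℝ)}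
    (h0 : ∑ i, (y₀.2 (X i y₀.1)) ^ 2 ≤ 1) :
    ∃ γ, γ 0 = y₀ ∧ IsHamCurve X T γ := by
  obtain ⟨B, hB0, hB⟩ := exists_bound_fields hX hc
  obtain ⟨χ, hχ, hχ1, K, L, hK, hL⟩ := exists_cutoff_hamField hX hc
    (‖y₀.2‖ * Real.exp (Fintype.card ι * B * T))
  obtain ⟨γ, hγ0, hγ⟩ := exists_integralCurve_of_bounded_lipschitz hK hL hT y₀
  have hb := hamCurve_bounds hX hB (c := fun t => χ (γ t).2) (fun t => hχ _) hγ (by rwa [hγ0])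
  refine ⟨γ, hγ0, fun t ht => ?_⟩
  have h1 : χ (γ t).2 = 1 := by
    refine hχ1 _ ((hb t ht).2.trans ?_)
    rw [hγ0]
    have := ht.2
    gcongr
  simpa [h1] using hγ t ht

/-- While their momenta stay bounded by `R`, both curves solve the equation of one globally
Lipschitz cutoff field, and Gronwall's lemma compares them. -/
theorem IsHamCurve.dist_le {X : ι → E → E} (hX : ∀ i, ContDiff ℝ ∞ (X i))
    (hc : ∀ i, HasCompactSupport (X i)) (R : ℝ) :
    ∃ K : ℝ, ∀ (T : ℝ) (γ γ' : ℝ → E × (E →L[ℝ] ℝ)), IsHamCurve X T γ → IsHamCurve X T γ' →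
      (∀ t ∈ Icc 0 T, ‖(γ t).2‖ ≤ R) → (∀ t ∈ Icc 0 T, ‖(γ' t).2‖ ≤ R) →
      ∀ t ∈ Icc 0 T, dist (γ t) (γ' t) ≤ dist (γ 0) (γ' 0) * Real.exp (K * t) := by
  obtain ⟨χ, hχ, hχ1, K, L, hK, hL⟩ := exists_cutoff_hamField hX hc R
  refine ⟨K, fun T γ γ' hγ hγ' hR hR' t ht => ?_⟩
  have key : ∀ γ : ℝ → E × (E →L[ℝ] ℝ), IsHamCurve X T γ → (∀ t ∈ Icc 0 T, ‖(γ t).2‖ ≤ R) →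
      ∀ t ∈ Ico 0 T, HasDerivWithinAt γ (χ (γ t).2 • hamField X (γ t)) (Ici t) t := by
    intro γ hγ hR t ht
    rw [hχ1 _ (hR t (Ico_subset_Icc_self ht)), one_smul]
    exact (hγ t (Ico_subset_Icc_self ht)).mono_of_mem_nhdsWithin (Icc_mem_nhdsGE_of_mem ht)
  have := dist_le_of_trajectories_ODE (v := fun _ y => χ y.2 • hamField X y) (fun _ => hK)
    (fun t ht => (hγ t ht).continuousWithinAt) (key γ hγ hR)
    (fun t ht => (hγ' t ht).continuousWithinAt) (key γ' hγ' hR') le_rfl t ht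
  simpa using this

end HamiltonianFlow

/-! ### Second-order expansion along Hamiltonian curves, and changes of coordinates. -/

section HamiltonianFlow

variable {E : Type*} [NormedAddCommGroup E] [NormedSpace ℝ E] {ι : Type*} [Fintype ι]

/-- The second derivative of a function `f` along an integral curve of `hamField X`, in terms of
the derivatives `a i = X_i f`. -/
def hamSecond (X : ι → E → E) (a : ι → E → ℝ) (y : E × (E →L[ℝ] ℝ)) : ℝ :=
  ∑ i, ((∑ j, y.2 (X j y.1) * y.2 (VectorField.lieBracket ℝ (X j) (X i) y.1)) * a i y.1 +
    y.2 (X i y.1) * ∑ j, y.2 (X j y.1) * fderiv ℝ (a i) y.1 (X j y.1))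

theorem hasDerivWithinAt_hamSecond {X : ι → E → E} {a : ι → E → ℝ} {γ : ℝ → E × (E →L[ℝ] ℝ)}
    {t : ℝ} {s : Set ℝ} (hγ : HasDerivWithinAt γ (hamField X (γ t)) s t)
    (hX : ∀ i, Differentiable ℝ (X i)) (ha : ∀ i, Differentiable ℝ (a i)) :
    HasDerivWithinAt (fun u => ∑ i, (γ u).2 (X i (γ u).1) * a i (γ u).1)
      (hamSecond X a (γ t)) s t := by
  refine HasDerivWithinAt.fun_sum fun i _ => ?_
  have h1 := hasDerivWithinAt_pairing (c := 1) (by simpa using hγ) (hX i (γ t).1)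
  rw [one_mul] at h1
  exact h1.mul (hasDerivWithinAt_comp_fst hγ (ha i (γ t).1))

/-- Each term contains at most one momentum factor that is not some ξ(X_i), so the growth in ξ is
only linear. This makes the bound integrable over the noncompact cylinder. -/
theorem abs_hamSecond_le {X : ι → E → E} {a : ι → E → ℝ} {B A : ℝ} (hA0 : 0 ≤ A)
    (hB : ∀ i x, ‖X i x‖ ≤ B ∧ ‖fderiv ℝ (X i) x‖ ≤ B)
    (hA : ∀ i x, ‖a i x‖ ≤ A ∧ ‖fderiv ℝ (a i) x‖ ≤ A)
    {y : E × (E →L[ℝ] ℝ)} (hy : ∑ i, (y.2 (X i y.1)) ^ 2 ≤ 1) :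
    |hamSecond X a y| ≤
      Fintype.card ι * (Fintype.card ι * (‖y.2‖ * (2 * B ^ 2)) * A + Fintype.card ι * (A * B)) := by
  have hh := abs_le_one_of_sum_sq_le_one hy
  refine (Finset.abs_sum_le_sum_abs _ _).trans ?_
  conv_rhs => rw [← nsmul_eq_mul, ← Finset.card_univ]
  refine Finset.sum_le_card_nsmul _ _ _ fun i _ => (abs_add_le _ _).trans (add_le_add ?_ ?_)
  · rw [abs_mul]
    refine mul_le_mul ?_ (hA i _).1 (abs_nonneg _) (by positivity)
    refine (Finset.abs_sum_le_sum_abs _ _).trans ?_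
    conv_rhs => rw [← nsmul_eq_mul]
    refine Finset.sum_le_card_nsmul _ _ _ fun j _ => ?_
    rw [abs_mul]
    have h1 : ‖VectorField.lieBracket ℝ (X j) (X i) y.1‖ ≤ 2 * B ^ 2 := by
      refine (norm_sub_le _ _).trans ?_
      have h2 := fun i j => (ContinuousLinearMap.le_opNorm (fderiv ℝ (X i) y.1) (X j y.1)).trans
        (mul_le_mul (hB i y.1).2 (hB j y.1).1 (norm_nonneg _)
          ((norm_nonneg _).trans (hB i y.1).2))
      linarith [h2 i j, h2 j i]
    calc _ ≤ 1 * (‖y.2‖ * (2 * B ^ 2)) := mul_le_mul (hh j)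
          ((y.2.le_opNorm _).trans (mul_le_mul_of_nonneg_left h1 (norm_nonneg _)))
          (abs_nonneg _) zero_le_one
      _ = _ := one_mul _
  · rw [abs_mul]
    have hAB : 0 ≤ A * B := mul_nonneg hA0 ((norm_nonneg _).trans (hB i y.1).1)
    have h3 : |∑ j, y.2 (X j y.1) * fderiv ℝ (a i) y.1 (X j y.1)| ≤ Fintype.card ι * (A * B) := by
      refine (Finset.abs_sum_le_sum_abs _ _).trans ?_
      conv_rhs => rw [← nsmul_eq_mul, ← Finset.card_univ]
      refine Finset.sum_le_card_nsmul _ _ _ fun j _ => ?_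
      rw [abs_mul]
      calc _ ≤ 1 * (A * B) := mul_le_mul (hh j)
            ((ContinuousLinearMap.le_opNorm _ _).trans
              (mul_le_mul (hA i _).2 (hB j _).1 (norm_nonneg _) hA0)) (abs_nonneg _) zero_le_one
        _ = _ := one_mul _
    calc _ ≤ 1 * (Fintype.card ι * (A * B)) := mul_le_mul (hh i) h3 (abs_nonneg _) zero_le_one
      _ = _ := one_mul _

/-- Two applications of the mean value inequality; the sharp constant C / 2 is not needed for
domination. -/
theorem abs_sub_taylor_le {φ u u' : ℝ → ℝ} {T C : ℝ}
    (hφ : ∀ t ∈ Icc 0 T, HasDerivWithinAt φ (u t) (Icc 0 T) t)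
    (hu : ∀ t ∈ Icc 0 T, HasDerivWithinAt u (u' t) (Icc 0 T) t) (hC : ∀ t ∈ Icc 0 T, |u' t| ≤ C)
    {t : ℝ} (ht : t ∈ Icc 0 T) : |φ t - φ 0 - t * u 0| ≤ C * t ^ 2 := by
  have h1 : ∀ s ∈ Icc 0 T, |u s - u 0| ≤ C * s := by
    intro s hs
    have := norm_image_sub_le_of_norm_deriv_le_segment' (a := 0) (b := T) hu
      (fun x hx => hC x (Ico_subset_Icc_self hx)) s hs
    simpa using this
  have h0 : 0 ≤ C := (abs_nonneg _).trans (hC t ht)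
  have h2 := norm_image_sub_le_of_norm_deriv_le_segment' (a := 0) (b := t) (C := C * t)
    (f := fun s => φ s - s * u 0) (f' := fun s => u s - u 0) (fun s hs => by
      have hs' : s ∈ Icc 0 T := ⟨hs.1, hs.2.trans ht.2⟩
      have := ((hφ s hs').mono (Icc_subset_Icc_right ht.2)).sub
        (((hasDerivWithinAt_id s (Icc 0 t)).mul_const (u 0)))
      simpa using! this)
    (fun s hs => (h1 s ⟨hs.1, hs.2.le.trans ht.2⟩).trans
      (mul_le_mul_of_nonneg_left hs.2.le h0)) t ⟨ht.1, le_rfl⟩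
  simp only [zero_mul, sub_zero, Real.norm_eq_abs] at h2
  rw [show φ t - φ 0 - t * u 0 = φ t - t * u 0 - φ 0 by ring]
  exact h2.trans (by rw [mul_assoc, pow_two])

/-- One use of l'Hôpital's rule reduces the claim to the difference quotient of `u` at 0. -/
theorem tendsto_taylor_two {φ u : ℝ → ℝ} {T G : ℝ} (hT : 0 < T)
    (hφ : ∀ t ∈ Icc 0 T, HasDerivWithinAt φ (u t) (Icc 0 T) t)
    (hu : HasDerivWithinAt u G (Icc 0 T) 0) :
    Tendsto (fun t => (φ t - φ 0 - t * u 0) / t ^ 2) (𝓝[>] 0) (𝓝 (G / 2)) := by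
  have hd : ∀ x ∈ Ioo 0 T, HasDerivAt φ (u x) x := fun x hx =>
    (hφ x (Ioo_subset_Icc_self hx)).hasDerivAt (Icc_mem_nhds hx.1 hx.2)
  have hφ0 : Tendsto φ (𝓝[>] 0) (𝓝 (φ 0)) :=
    ((hφ 0 ⟨le_rfl, hT.le⟩).continuousWithinAt.mono_of_mem_nhdsWithin
      (mem_of_superset (Ioo_mem_nhdsGT hT) Ioo_subset_Icc_self))
  have hid : Tendsto (fun t : ℝ => t) (𝓝[>] 0) (𝓝 0) := tendsto_nhdsWithin_of_tendsto_nhds tendsto_id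
  refine HasDerivAt.lhopital_zero_right_on_Ioo (f' := fun t => u t - u 0) (g' := fun t => 2 * t) hT
    (fun x hx => ?_) (fun x hx => ?_) (fun x hx => mul_ne_zero two_ne_zero hx.1.ne') ?_ ?_ ?_
  · simpa using! ((hd x hx).sub_const (φ 0)).sub ((hasDerivAt_id x).mul_const (u 0))
  · simpa using hasDerivAt_pow 2 x
  · have := (hφ0.sub_const (φ 0)).sub (hid.mul_const (u 0))
    simpa using this
  · simpa using hid.pow 2
  · have h1 := hasDerivWithinAt_iff_tendsto_slope.1 hu
    have h2 : Tendsto (slope u 0) (𝓝[>] 0) (𝓝 G) := by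
      refine h1.mono_left ?_
      rw [← nhdsWithin_Ioo_eq_nhdsGT hT]
      exact nhdsWithin_mono _ fun x hx => ⟨Ioo_subset_Icc_self hx, hx.1.ne'⟩
    refine (h2.div_const 2).congr' ?_
    filter_upwards [self_mem_nhdsWithin] with x hx
    rw [slope_def_field, sub_zero]
    have : x ≠ 0 := (mem_Ioi.1 hx).ne'
    field_simp

/-- Hamilton's equations are invariant under a change of coordinates `x = ψ(y)`. -/
theorem hasDerivWithinAt_hamField_change {X Y : ι → E → E} {γ : ℝ → E × (E →L[ℝ] ℝ)} {t : ℝ}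
    {s : Set ℝ} (hs : UniqueDiffWithinAt ℝ s t)
    (hγ : HasDerivWithinAt γ (hamField X (γ t)) s t) {ψ : E → E} {y : ℝ → E} {y' : E}
    (hy : HasDerivWithinAt y y' s t) (hψ : ContDiffAt ℝ 2 ψ (y t))
    (hψy : ∀ᶠ u in 𝓝[s] t, ψ (y u) = (γ u).1) (hψt : ψ (y t) = (γ t).1)
    (hinj : Function.Injective (fderiv ℝ ψ (y t)))
    (hX : ∀ i, DifferentiableAt ℝ (X i) (γ t).1) (hY : ∀ i, DifferentiableAt ℝ (Y i) (y t))
    (hXY : ∀ i, ∀ᶠ z in 𝓝 (y t), fderiv ℝ ψ z (Y i z) = X i (ψ z)) :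
    HasDerivWithinAt (fun u => (y u, (γ u).2.comp (fderiv ℝ ψ (y u))))
      (hamField Y (y t, (γ t).2.comp (fderiv ℝ ψ (y t)))) s t := by
  have hψ1 : DifferentiableAt ℝ ψ (y t) := hψ.differentiableAt (by norm_num)
  have hψ2 : DifferentiableAt ℝ (fderiv ℝ ψ) (y t) :=
    (hψ.fderiv_right (m := 1) (by norm_num)).differentiableAt (by norm_num)
  have hXY0 : ∀ i, fderiv ℝ ψ (y t) (Y i (y t)) = X i (γ t).1 := fun i => by
    rw [(hXY i).self_of_nhds, hψt]
  have hx := hasDerivWithinAt_fst hγ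
  have hx2 := (hψ1.hasFDerivAt.comp_hasDerivWithinAt t hy).congr_of_eventuallyEq
    (f₁ := fun u => (γ u).1) (by filter_upwards [hψy] with u hu; exact hu.symm) hψt.symm
  -- The velocity of y is determined by its image under dψ, which is injective.
  have hy1 : y' = ∑ i, (γ t).2 (X i (γ t).1) • Y i (y t) := by
    apply hinj
    rw [← hs.eq_deriv _ hx hx2, map_sum]
    simp only [map_smul, hXY0, hamField]
  have hsymm : ∀ v w, fderiv ℝ (fderiv ℝ ψ) (y t) v w = fderiv ℝ (fderiv ℝ ψ) (y t) w v :=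
    hψ.isSymmSndFDerivAt (by simp)
  -- This is the derivative of the identity dψ(Y_i) = X_i ∘ ψ in the direction v.
  have hD : ∀ i v, fderiv ℝ (fderiv ℝ ψ) (y t) v (Y i (y t)) =
      fderiv ℝ (X i) (γ t).1 (fderiv ℝ ψ (y t) v) - fderiv ℝ ψ (y t) (fderiv ℝ (Y i) (y t) v) := by
    intro i v
    have h1 := (hψ2.hasFDerivAt.clm_apply (hY i).hasFDerivAt)
    have h2 : HasFDerivAt (fun z => X i (ψ z)) ((fderiv ℝ (X i) (γ t).1).comp (fderiv ℝ ψ (y t)))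
        (y t) := by
      have h3 := hX i
      rw [← hψt] at h3 ⊢
      exact h3.hasFDerivAt.comp (y t) hψ1.hasFDerivAt
    have h4 := (h2.congr_of_eventuallyEq (hXY i)).unique h1
    have h5 := congrArg (fun L => L v) h4
    simp only [ContinuousLinearMap.comp_apply, add_apply,
      ContinuousLinearMap.flip_apply] at h5
    rw [h5]
    abel
  have hη := (hasDerivWithinAt_snd hγ).clm_comp (hψ2.hasFDerivAt.comp_hasDerivWithinAt t hy)
  have hfin := hy.prodMk hη
  convert! hfin using 1
  refine Prod.ext ?_ ?_
  · simp [hamField, hXY0, hy1]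
  · ext v
    simp only [hamField, ContinuousLinearMap.comp_apply, hXY0, Function.comp_apply,
      neg_apply, sum_apply, smul_apply, add_apply, smul_eq_mul]
    -- Symmetry of the second derivative puts y' in the slot where `hD` applies; the derivatives of
    -- the X_i then cancel.
    rw [hsymm y' v, hy1]
    simp only [map_sum, map_smul, hD, smul_eq_mul, map_sub, mul_sub, Finset.sum_sub_distrib]
    ring

/-- Local existence of globally defined representatives. -/
theorem exists_contDiff_hasCompactSupport_eventuallyEq {F : Type*} [NormedAddCommGroup F]
    [NormedSpace ℝ F] [FiniteDimensional ℝ E] {f : E → F} {U : Set E} (hU : IsOpen U)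
    (hf : ContDiffOn ℝ ∞ f U) {x : E} (hx : x ∈ U) :
    ∃ g : E → F, ContDiff ℝ ∞ g ∧ HasCompactSupport g ∧ g =ᶠ[𝓝 x] f := by
  obtain ⟨r, hr, hrU⟩ := Metric.nhds_basis_closedBall.mem_iff.1 (hU.mem_nhds hx)
  let χ : ContDiffBump x := ⟨r / 2, r, by positivity, by linarith⟩
  refine ⟨fun y => χ y • f y, ?_, ?_, ?_⟩
  · rw [contDiff_iff_contDiffAt]
    intro y
    by_cases hy : y ∈ Metric.closedBall x r
    · exact χ.contDiff.contDiffAt.smul (hf.contDiffAt (hU.mem_nhds (hrU hy)))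
    · have : (fun y => χ y • f y) =ᶠ[𝓝 y] fun _ => 0 := by
        filter_upwards [Metric.isClosed_closedBall.isOpen_compl.mem_nhds hy] with z hz
        rw [χ.zero_of_le_dist (by
          have : r < dist z x := by simpa using hz
          exact this.le), zero_smul]
      exact contDiffAt_const.congr_of_eventuallyEq this
  · exact χ.hasCompactSupport.smul_right
  · filter_upwards [χ.eventuallyEq_one] with y hy
    rw [hy, Pi.one_apply, one_smul]

end HamiltonianFlow

/-! ### Moments of the uniform measure of the sphere -/

section Sphere

open scoped Pointwise

variable {k : ℕ}

theorem map_toSphere_apply {s : Set (EuclideanSpace ℝ (Fin k))} (hs : MeasurableSet s) :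
    ((volume : Measure (EuclideanSpace ℝ (Fin k))).toSphere.map Subtype.val) s =
      k * volume (Ioo (0 : ℝ) 1 • (s ∩ Metric.sphere 0 1)) := by
  rw [Measure.map_apply measurable_subtype_coe hs,
    Measure.toSphere_apply' _ (measurable_subtype_coe hs), Subtype.image_preimage_coe, inter_comm]
  simp

/-- The surface measure of a set is k times the volume of the cone over it; a linear isometry
commutes with forming cones and preserves volume. -/
theorem map_unifSphere (e : EuclideanSpace ℝ (Fin k) ≃ₗᵢ[ℝ] EuclideanSpace ℝ (Fin k)) :
    (unifSphere k).map e = unifSphere k := by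
  have he : Measurable e := e.continuous.measurable
  have h : ((volume : Measure (EuclideanSpace ℝ (Fin k))).toSphere.map Subtype.val).map e =
      (volume : Measure (EuclideanSpace ℝ (Fin k))).toSphere.map Subtype.val := by
    ext s hs
    rw [Measure.map_apply he hs, map_toSphere_apply (he hs), map_toSphere_apply hs]
    have h1 : Ioo (0 : ℝ) 1 • (e ⁻¹' s ∩ Metric.sphere 0 1) =
        e.toMeasurableEquiv ⁻¹' (Ioo (0 : ℝ) 1 • (s ∩ Metric.sphere 0 1)) := by
      ext x
      simp only [Set.mem_smul, mem_preimage, mem_inter_iff, mem_sphere_zero_iff_norm]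
      constructor
      · rintro ⟨r, hr, y, ⟨hy, hy1⟩, rfl⟩
        exact ⟨r, hr, e y, ⟨hy, by rw [e.norm_map, hy1]⟩, by simp⟩
      · rintro ⟨r, hr, y, ⟨hy, hy1⟩, h⟩
        refine ⟨r, hr, e.symm y, ⟨by simpa using hy, by rw [e.symm.norm_map, hy1]⟩, ?_⟩
        apply e.injective
        simpa using h
    have h2 : MeasurePreserving e.toMeasurableEquiv volume volume := e.measurePreserving
    rw [h1, h2.measure_preimage_equiv]
  simp only [unifSphere, Measure.map_smul, h]

theorem integral_unifSphere_comp (e : EuclideanSpace ℝ (Fin k) ≃ₗᵢ[ℝ] EuclideanSpace ℝ (Fin k))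
    (f : EuclideanSpace ℝ (Fin k) → ℝ) :
    ∫ c, f (e c) ∂(unifSphere k) = ∫ c, f c ∂(unifSphere k) := by
  conv_rhs => rw [← map_unifSphere e]
  exact (e.toHomeomorph.measurableEmbedding.integral_map f).symm

theorem ae_unifSphere : ∀ᵐ c ∂(unifSphere k), ‖c‖ = 1 := by
  rw [unifSphere, ae_map_iff measurable_subtype_coe.aemeasurable
    (measurableSet_eq_fun measurable_norm measurable_const)]
  exact ae_of_all _ fun x => by simp

instance [NeZero k] : IsProbabilityMeasure (unifSphere k) := by
  have : Nontrivial (EuclideanSpace ℝ (Fin k)) :=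
    Module.nontrivial_of_finrank_pos (R := ℝ) (by simpa using Nat.pos_of_ne_zero (NeZero.ne k))
  have h : (volume : Measure (EuclideanSpace ℝ (Fin k))).toSphere ≠ 0 := Measure.toSphere_ne_zero _
  refine ⟨?_⟩
  rw [unifSphere, Measure.map_apply measurable_subtype_coe MeasurableSet.univ]
  simp only [preimage_univ, Measure.smul_apply, smul_eq_mul]
  exact ENNReal.inv_mul_cancel (Measure.measure_univ_ne_zero.2 h) (measure_ne_top _ _)

theorem ae_abs_coord_le (i : Fin k) : ∀ᵐ c ∂(unifSphere k), ‖c i‖ ≤ 1 := by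
  filter_upwards [ae_unifSphere] with c hc
  exact (PiLp.norm_apply_le c i).trans hc.le

theorem continuous_coord (i : Fin k) : Continuous fun c : EuclideanSpace ℝ (Fin k) => c i := by
  fun_prop

theorem integrable_coord [NeZero k] (i : Fin k) : Integrable (fun c => c i) (unifSphere k) :=
  Integrable.of_bound (continuous_coord i).aestronglyMeasurable 1 (ae_abs_coord_le i)

theorem integrable_coord_mul [NeZero k] (i j : Fin k) :
    Integrable (fun c => c i * c j) (unifSphere k) := by
  refine Integrable.of_bound ((continuous_coord i).mul (continuous_coord j)).aestronglyMeasurable 1 ?_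
  filter_upwards [ae_abs_coord_le i, ae_abs_coord_le j] with c h1 h2
  rw [norm_mul]
  exact mul_le_one₀ h1 (norm_nonneg _) h2

theorem integral_coord (i : Fin k) : ∫ c, c i ∂(unifSphere k) = 0 := by
  have h := integral_unifSphere_comp (k := k) (LinearIsometryEquiv.neg ℝ) (fun c => c i)
  simp only [LinearIsometryEquiv.coe_neg, PiLp.neg_apply, integral_neg] at h
  linarith

/-- Transposing coordinates shows that all the diagonal moments agree, and they add up to the
integral of ‖c‖² = 1. Changing the sign of one coordinate makes a mixed moment its own negative. -/
theorem integral_coord_mul [NeZero k] (i j : Fin k) :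
    ∫ c, c i * c j ∂(unifSphere k) = if i = j then 1 / (k : ℝ) else 0 := by
  split_ifs with hij
  · subst hij
    have hswap : ∀ j, ∫ c, c j * c j ∂(unifSphere k) = ∫ c, c i * c i ∂(unifSphere k) := by
      intro j
      have h := integral_unifSphere_comp (k := k)
        (LinearIsometryEquiv.piLpCongrLeft 2 ℝ ℝ (Equiv.swap i j)) (fun c => c i * c i)
      simpa [LinearIsometryEquiv.piLpCongrLeft_apply, Equiv.piCongrLeft'_apply] using h
    have hsum : ∑ j, ∫ c, c j * c j ∂(unifSphere k) = 1 := by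
      rw [← integral_finsetSum _ fun j _ => integrable_coord_mul j j]
      have : (fun c : EuclideanSpace ℝ (Fin k) => ∑ j, c j * c j) =ᵐ[unifSphere k] fun _ => 1 := by
        filter_upwards [ae_unifSphere] with c hc
        have h := EuclideanSpace.real_norm_sq_eq c
        rw [hc] at h
        simp only [← pow_two]
        linarith
      rw [integral_congr_ae this]
      simp
    rw [Finset.sum_congr rfl fun j _ => hswap j] at hsum
    simp only [Finset.sum_const, Finset.card_univ, Fintype.card_fin, nsmul_eq_mul] at hsum
    have : (k : ℝ) ≠ 0 := Nat.cast_ne_zero.2 (NeZero.ne k)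
    rw [eq_div_iff this, mul_comm]
    exact hsum
  · have h := integral_unifSphere_comp (k := k)
      (LinearIsometryEquiv.piLpCongrRight 2 fun l => if l = i then LinearIsometryEquiv.neg ℝ
        else LinearIsometryEquiv.refl ℝ ℝ) (fun c => c i * c j)
    simp only [LinearIsometryEquiv.piLpCongrRight_apply, if_true, Ne.symm hij, if_false,
      LinearIsometryEquiv.coe_neg, LinearIsometryEquiv.coe_refl, id, neg_mul, integral_neg] at h
    linarith

end Sphere

/-! ### Moments of the measures on the cylinders -/

section Cylinder

variable {k : ℕ} {M : Type*} [TopologicalSpace M] [ChartedSpace (Model k) M]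
    [IsManifold 𝓘(ℝ, Model k) ∞ M]

instance instSecondCountableTopologyCotan (q : M) : SecondCountableTopology (Cotan k q) :=
  inferInstanceAs (SecondCountableTopology (Model k →L[ℝ] ℝ))

instance instContinuousAddCotan (q : M) : ContinuousAdd (Cotan k q) :=
  inferInstanceAs (ContinuousAdd (Model k →L[ℝ] ℝ))

instance instT2SpaceCotan (q : M) : T2Space (Cotan k q) :=
  inferInstanceAs (T2Space (Model k →L[ℝ] ℝ))

theorem continuous_eval (q : M) (w : Tan k q) : Continuous fun l : Cotan k q => l w :=
  (ContinuousLinearMap.apply ℝ ℝ (show Model k from w)).continuous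

variable {S : CorankOneStructure k M} (V : S.Complement) (q : M)

/-- `V.lift` as a linear map. -/
def CorankOneStructure.Complement.liftL : S.D q →ₗ[ℝ] Cotan k q where
  toFun := V.lift q
  map_add' v w := by
    ext x
    simp [CorankOneStructure.Complement.lift]
  map_smul' r v := by
    ext x
    simp [CorankOneStructure.Complement.lift]

theorem lift_apply (v : S.D q) (w : Tan k q) :
    V.lift q v w = S.g q v (Submodule.projectionOnto (S.D q) (V.V q) (V.isCompl q) w) := rfl

theorem lift_apply_mem (v w : S.D q) : V.lift q v (w : Tan k q) = S.g q v w := by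
  rw [lift_apply, Submodule.projectionOnto_apply_left]

theorem lift_sum (c : Fin k → ℝ) (X : Fin k → S.D q) :
    V.lift q (∑ i, c i • X i) = ∑ i, c i • V.lift q (X i) := by
  change V.liftL q _ = _
  rw [map_sum]
  simp only [map_smul]
  rfl

theorem continuous_lift_sum (X : Fin k → S.D q) :
    Continuous fun c : EuclideanSpace ℝ (Fin k) => V.lift q (∑ i, c i • X i) := by
  simp only [lift_sum]
  have : ∀ i, Continuous fun c : EuclideanSpace ℝ (Fin k) =>
      c i • (V.lift q (X i) : Model k →L[ℝ] ℝ) := fun i => by fun_prop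
  exact continuous_finsetSum (M := Model k →L[ℝ] ℝ) _ fun i _ => this i

theorem onb_spec : IsONB (S.g q) (S.onb q) := (S.exists_onb q).choose_spec

variable [NeZero k] (ν : Measure (Cotan k q)) [IsProbabilityMeasure ν]

theorem cylMeasure_eq : V.cylMeasure q ν =
    ((unifSphere k).prod ν).map
      (fun p => V.lift q (∑ i, p.1 i • S.onb q i) + p.2) := by
  have h : Measurable fun c : EuclideanSpace ℝ (Fin k) => V.lift q (∑ i, c i • S.onb q i) :=
    (continuous_lift_sum V q _).measurable
  rw [CorankOneStructure.Complement.cylMeasure, CorankOneStructure.Complement.sphereMeasure]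
  conv_lhs => rw [← Measure.map_id (μ := ν), Measure.map_prod_map _ _ h measurable_id]
  rw [Measure.map_map measurable_add (h.prodMap measurable_id)]
  rfl

theorem measurable_cyl : Measurable fun p : EuclideanSpace ℝ (Fin k) × Cotan k q =>
    V.lift q (∑ i, p.1 i • S.onb q i) + p.2 :=
  ((continuous_lift_sum V q _).measurable.comp measurable_fst).add measurable_snd

instance instIsProbabilityMeasureCyl : IsProbabilityMeasure (V.cylMeasure q ν) := by
  rw [cylMeasure_eq]
  exact Measure.isProbabilityMeasure_map (measurable_cyl V q).aemeasurable

variable {ν} (hν : ∀ᵐ l ∂ν, ∀ v ∈ S.D q, l v = 0)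

-- Vertical covectors annihilate `D`, so on `D` a covector of the cylinder is read off from its
-- spherical part alone.
include hν in
theorem ae_prod_pairing : ∀ᵐ p ∂((unifSphere k).prod ν), ‖p.1‖ = 1 ∧
    ∀ j, (V.lift q (∑ i, p.1 i • S.onb q i) + p.2) (S.onb q j : Tan k q) = p.1 j := by
  have h1 : ∀ᵐ p ∂((unifSphere k).prod ν), ‖p.1‖ = 1 :=
    Measure.quasiMeasurePreserving_fst.ae ae_unifSphere
  have h2 : ∀ᵐ p ∂((unifSphere k).prod ν), ∀ v ∈ S.D q, p.2 v = 0 :=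
    Measure.quasiMeasurePreserving_snd.ae hν
  filter_upwards [h1, h2] with p hp1 hp2
  refine ⟨hp1, fun j => ?_⟩
  rw [add_apply, hp2 _ (S.onb q j).2, lift_apply_mem, map_sum]
  simp [(onb_spec q).1]

include hν in
theorem ae_cyl : ∀ᵐ l ∂(V.cylMeasure q ν), ∑ j, (l (S.onb q j : Tan k q)) ^ 2 = 1 := by
  have hm : MeasurableSet {l : Cotan k q | ∑ j, (l (S.onb q j : Tan k q)) ^ 2 = 1} :=
    (isClosed_eq (continuous_finsetSum _ fun j _ => (continuous_eval q _).pow 2)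
      continuous_const).measurableSet
  rw [cylMeasure_eq, ae_map_iff (measurable_cyl V q).aemeasurable hm]
  filter_upwards [ae_prod_pairing V q hν] with p hp
  simp only [hp.2]
  rw [← EuclideanSpace.real_norm_sq_eq, hp.1, one_pow]

theorem lift_sum_apply (c : Fin k → ℝ) (w : Tan k q) :
    V.lift q (∑ i, c i • S.onb q i) w = ∑ i, c i * V.lift q (S.onb q i) w := by
  rw [lift_sum, sum_apply]
  simp

-- The spherical part is bounded, and the vertical part is square integrable by hypothesis.
include hν in
theorem memLp_cyl (h2 : ∀ w : Tan k q, MemLp (fun l : Cotan k q => l w) 2 ν) (w : Tan k q) :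
    MemLp (fun l : Cotan k q => l w) 2 (V.cylMeasure q ν) := by
  rw [cylMeasure_eq, memLp_map_measure_iff (continuous_eval q w).aestronglyMeasurable
    (measurable_cyl V q).aemeasurable]
  have h3 : MemLp (fun p : EuclideanSpace ℝ (Fin k) × Cotan k q => p.2 w) 2
      ((unifSphere k).prod ν) := (h2 w).comp_measurePreserving measurePreserving_snd
  have h4 : MemLp (fun p : EuclideanSpace ℝ (Fin k) × Cotan k q =>
      V.lift q (∑ i, p.1 i • S.onb q i) w) 2 ((unifSphere k).prod ν) := by
    refine MemLp.of_bound ((continuous_eval q w).comp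
      ((continuous_lift_sum V q _).comp continuous_fst)).aestronglyMeasurable
      (∑ i, |V.lift q (S.onb q i) w|) ?_
    filter_upwards [ae_prod_pairing V q hν] with p hp
    rw [lift_sum_apply]
    refine (norm_sum_le _ _).trans (Finset.sum_le_sum fun i _ => ?_)
    rw [norm_mul]
    exact mul_le_of_le_one_left (abs_nonneg _) ((PiLp.norm_apply_le p.1 i).trans hp.1.le)
  exact h4.add h3

include hν in
theorem integral_cyl_onb (j : Fin k) :
    ∫ l, l (S.onb q j : Tan k q) ∂(V.cylMeasure q ν) = 0 := by
  rw [cylMeasure_eq, integral_map (measurable_cyl V q).aemeasurable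
    (continuous_eval q _).aestronglyMeasurable]
  have : (fun p : EuclideanSpace ℝ (Fin k) × Cotan k q =>
      (V.lift q (∑ i, p.1 i • S.onb q i) + p.2) (S.onb q j : Tan k q)) =ᵐ[(unifSphere k).prod ν]
      fun p => p.1 j := by
    filter_upwards [ae_prod_pairing V q hν] with p hp
    exact hp.2 j
  rw [integral_congr_ae this, integral_fun_fst (fun c : EuclideanSpace ℝ (Fin k) => c j),
    integral_coord, smul_zero]

-- In λ(X_j) λ(w) the vertical part of λ enters only through λ(w). Its product with the spherical
-- coordinate factorizes and has integral zero, so the second moments do not depend on `ν`. This is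
-- why the microscopic Laplacian does not depend on the adapted family.
include hν in
theorem integral_cyl_onb_mul (h2 : ∀ w : Tan k q, MemLp (fun l : Cotan k q => l w) 2 ν)
    (j : Fin k) (w : Tan k q) :
    ∫ l, l (S.onb q j : Tan k q) * l w ∂(V.cylMeasure q ν) =
      1 / (k : ℝ) * V.lift q (S.onb q j) w := by
  have hc : Continuous fun l : Cotan k q => l (S.onb q j : Tan k q) * l w :=
    (continuous_eval q _).mul (continuous_eval q w)
  rw [cylMeasure_eq, integral_map (measurable_cyl V q).aemeasurable hc.aestronglyMeasurable]
  have : (fun p : EuclideanSpace ℝ (Fin k) × Cotan k q =>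
      (V.lift q (∑ i, p.1 i • S.onb q i) + p.2) (S.onb q j : Tan k q) *
      (V.lift q (∑ i, p.1 i • S.onb q i) + p.2) w) =ᵐ[(unifSphere k).prod ν]
      fun p => ∑ i, V.lift q (S.onb q i) w * (p.1 j * p.1 i) + p.1 j * p.2 w := by
    filter_upwards [ae_prod_pairing V q hν] with p hp
    rw [hp.2 j, add_apply, lift_sum_apply, mul_add, Finset.mul_sum]
    congr 1
    exact Finset.sum_congr rfl fun i _ => by ring
  have hint : ∀ i, Integrable (fun p : EuclideanSpace ℝ (Fin k) × Cotan k q =>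
      V.lift q (S.onb q i) w * (p.1 j * p.1 i)) ((unifSphere k).prod ν) := fun i =>
    ((integrable_coord_mul j i).comp_fst ν).const_mul _
  have hint2 : Integrable (fun p : EuclideanSpace ℝ (Fin k) × Cotan k q => p.1 j * p.2 w)
      ((unifSphere k).prod ν) :=
    (integrable_coord j).mul_prod ((h2 w).integrable (by norm_num))
  rw [integral_congr_ae this, integral_add (integrable_finsetSum _ fun i _ => hint i) hint2,
    integral_finsetSum _ fun i _ => hint i, integral_prod_mul (fun c : EuclideanSpace ℝ (Fin k) =>
      c j) (fun l : Cotan k q => l w), integral_coord, zero_mul, add_zero]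
  simp_rw [integral_const_mul]
  have h3 : ∀ i, ∫ p, (p.1 j * p.1 i) ∂((unifSphere k).prod ν) =
      if j = i then 1 / (k : ℝ) else 0 := fun i => by
    rw [integral_fun_fst (fun c : EuclideanSpace ℝ (Fin k) => c j * c i), integral_coord_mul]
    simp
  simp only [h3]
  simp [mul_comm]

-- For the Dirac mass at 0 a covector is determined by its values on `D`, so its square at w expands
-- into the moments just computed.
omit ν [IsProbabilityMeasure ν] hν in
theorem integral_cyl_dirac_sq (w : Tan k q) :
    ∫ l, (l w) ^ 2 ∂(V.cylMeasure q (Measure.dirac 0)) =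
      1 / (k : ℝ) * ∑ j, (V.lift q (S.onb q j) w) ^ 2 := by
  have hν : ∀ᵐ l ∂(Measure.dirac (0 : Cotan k q)), ∀ v ∈ S.D q, l v = 0 := by
    rw [ae_dirac_iff]
    · simp
    · have : {l : Cotan k q | ∀ v ∈ S.D q, l v = 0} = ⋂ v ∈ S.D q, {l | l v = 0} := by
        ext l; simp
      rw [this]
      exact (isClosed_biInter fun v _ =>
        isClosed_eq (continuous_eval q v) continuous_const).measurableSet
  have h2 : ∀ w : Tan k q, MemLp (fun l : Cotan k q => l w) 2 (Measure.dirac (0 : Cotan k q)) := by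
    intro w
    refine MemLp.of_bound (continuous_eval q w).aestronglyMeasurable 0 ?_
    rw [ae_dirac_iff (measurableSet_le (continuous_eval q w).measurable.norm measurable_const)]
    simp
  have h3 : ∀ᵐ l ∂(V.cylMeasure q (Measure.dirac 0)),
      (l w) ^ 2 = ∑ j, V.lift q (S.onb q j) w * (l (S.onb q j : Tan k q) * l w) := by
    have hc1 : Continuous fun l : Cotan k q => (l w) ^ 2 := (continuous_eval q w).pow 2
    have hc2 : Continuous fun l : Cotan k q =>
        ∑ j, V.lift q (S.onb q j) w * (l (S.onb q j : Tan k q) * l w) :=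
      continuous_finsetSum _ fun j _ =>
        continuous_const.mul ((continuous_eval q _).mul (continuous_eval q w))
    rw [cylMeasure_eq, ae_map_iff (measurable_cyl V q).aemeasurable
      (isClosed_eq hc1 hc2).measurableSet]
    have h4 : ∀ᵐ p ∂((unifSphere k).prod (Measure.dirac (0 : Cotan k q))), p.2 = 0 :=
      Measure.quasiMeasurePreserving_snd.ae (p := fun l : Cotan k q => l = 0)
        ((ae_dirac_iff (isClosed_singleton (x := (0 : Cotan k q))).measurableSet).2 rfl)
    filter_upwards [ae_prod_pairing V q hν, h4] with p hp hp2
    simp only [hp.2]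
    rw [pow_two, add_apply, lift_sum_apply, hp2, zero_apply, add_zero, Finset.sum_mul]
    exact Finset.sum_congr rfl fun j _ => by ring
  have hint : ∀ j, Integrable (fun l : Cotan k q => l (S.onb q j : Tan k q) * l w)
      (V.cylMeasure q (Measure.dirac 0)) := fun j =>
    (memLp_cyl V q hν h2 _).integrable_mul (memLp_cyl V q hν h2 w)
  rw [integral_congr_ae h3, integral_finsetSum _ fun j _ => (hint j).const_mul _, Finset.mul_sum]
  refine Finset.sum_congr rfl fun j _ => ?_
  rw [integral_const_mul, integral_cyl_onb_mul V q hν h2]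
  ring

end Cylinder

/-! ### Coordinate representations -/

section Charts

variable {k : ℕ} {M : Type*} [TopologicalSpace M] [ChartedSpace (Model k) M]

/-- The preferred chart at `q`. -/
abbrev chart (k : ℕ) {M : Type*} [TopologicalSpace M] [ChartedSpace (Model k) M] (q : M) :
    PartialEquiv M (Model k) := extChartAt 𝓘(ℝ, Model k) q

/-- The differential of the chart at `q`. -/
def dChart (q p : M) : Tan k p →L[ℝ] Model k :=
  mfderiv 𝓘(ℝ, Model k) 𝓘(ℝ, Model k) (chart k q) p

/-- The differential of the inverse of the chart at `q`. -/
def dChartSymm (q : M) (x : Model k) : Model k →L[ℝ] Tan k ((chart k q).symm x) :=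
  mfderiv 𝓘(ℝ, Model k) 𝓘(ℝ, Model k) (chart k q).symm x

/-- A vector field in the chart at `q`. -/
def chartVField (q : M) (X : VField k M) (x : Model k) : Model k :=
  dChart q ((chart k q).symm x) (X ((chart k q).symm x))

/-- A one-form in the chart at `q`. -/
def chartForm (q : M) (η : (p : M) → Cotan k p) (x : Model k) : Model k →L[ℝ] ℝ :=
  (η ((chart k q).symm x)).comp (dChartSymm q x)

theorem chart_symm_map (q : M) {x : Model k} (hx : x ∈ (chart k q).target) :
    (chart k q).symm x ∈ (chart k q).source := (chart k q).map_target hx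

theorem chart_source_subset (q : M) {p : M} (hp : p ∈ (chart k q).source) :
    p ∈ (chartAt (Model k) q).source := by
  rwa [extChartAt_source] at hp

theorem isOpen_chart_target (q : M) : IsOpen (chart k q).target := isOpen_extChartAt_target q

theorem isOpen_chart_preimage (q : M) {U : Set M} (hU : IsOpen U) :
    IsOpen ((chart k q).target ∩ (chart k q).symm ⁻¹' U) :=
  (continuousOn_extChartAt_symm q).isOpen_inter_preimage (isOpen_chart_target q) hU

variable [IsManifold 𝓘(ℝ, Model k) ∞ M]

instance instIsManifoldOne : IsManifold 𝓘(ℝ, Model k) 1 M :=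
  IsManifold.of_le (n := ∞) (by norm_cast)

theorem dChart_comp_dChartSymm (q : M) {x : Model k} (hx : x ∈ (chart k q).target) :
    (dChart q ((chart k q).symm x)).comp (dChartSymm q x) = ContinuousLinearMap.id ℝ (Model k) := by
  have := mfderiv_extChartAt_comp_mfderivWithin_extChartAt_symm (I := 𝓘(ℝ, Model k)) hx
  rw [ModelWithCorners.range_eq_univ, mfderivWithin_univ] at this
  exact this

theorem dChartSymm_comp_dChart (q : M) {x : Model k} (hx : x ∈ (chart k q).target) :
    (dChartSymm q x).comp (dChart q ((chart k q).symm x)) =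
      ContinuousLinearMap.id ℝ (Tan k ((chart k q).symm x)) := by
  have := mfderivWithin_extChartAt_symm_comp_mfderiv_extChartAt (I := 𝓘(ℝ, Model k)) hx
  rw [ModelWithCorners.range_eq_univ, mfderivWithin_univ] at this
  exact this

theorem dChart_dChartSymm (q : M) {x : Model k} (hx : x ∈ (chart k q).target) (v : Model k) :
    dChart q ((chart k q).symm x) (dChartSymm q x v) = v :=
  congrArg (fun L : Model k →L[ℝ] Model k => L v) (dChart_comp_dChartSymm q hx)

theorem dChartSymm_dChart (q : M) {x : Model k} (hx : x ∈ (chart k q).target)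
    (v : Tan k ((chart k q).symm x)) :
    dChartSymm q x (dChart q ((chart k q).symm x) v) = v :=
  congrArg (fun L : Tan k ((chart k q).symm x) →L[ℝ] Tan k ((chart k q).symm x) => L v)
    (dChartSymm_comp_dChart q hx)

theorem dChart_self (q : M) : dChart q q = ContinuousLinearMap.id ℝ (Model k) :=
  mfderiv_extChartAt_self (I := 𝓘(ℝ, Model k))

theorem mem_chart_target (q : M) : chart k q q ∈ (chart k q).target := mem_extChartAt_target q

theorem chart_symm_self (q : M) : (chart k q).symm (chart k q q) = q := extChartAt_to_inv q

theorem chartVField_self (q : M) (X : VField k M) : chartVField q X (chart k q q) = X q := by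
  -- The fibre over `(chart k q).symm (chart k q q)` is the fibre over `q` only up to a
  -- propositional equality; a free base point avoids transporting vectors along it.
  have h : ∀ p, p = q → dChart q p (X p) = dChart q q (X q) := by rintro p rfl; rfl
  exact (h _ (chart_symm_self q)).trans (congrArg (fun L : Model k →L[ℝ] Model k => L (X q))
    (dChart_self q))

theorem chartVField_chart (q : M) (X : VField k M) {p : M} (hp : p ∈ (chart k q).source) :
    chartVField q X (chart k q p) = dChart q p (X p) := by
  have h : ∀ p', p' = p → dChart q p' (X p') = dChart q p (X p) := by rintro p rfl; rfl
  exact h _ ((chart k q).left_inv hp)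

theorem chartForm_apply_chartVField (q : M) (η : (p : M) → Cotan k p) (X : VField k M)
    {x : Model k} (hx : x ∈ (chart k q).target) :
    chartForm q η x (chartVField q X x) = η ((chart k q).symm x) (X ((chart k q).symm x)) := by
  change η _ (dChartSymm q x (dChart q _ _)) = _
  rw [dChartSymm_dChart q hx]

theorem chartForm_self (q : M) (η : (p : M) → Cotan k p) :
    chartForm q η (chart k q q) = η q := by
  ext v
  have hx := mem_chart_target (k := k) q
  have h := chartForm_apply_chartVField q η (fun p => v) hx
  have e : chartVField q (fun p => (v : Tan k p)) (chart k q q) = v := chartVField_self q _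
  refine (congrArg (chartForm q η _) e).symm.trans (h.trans ?_)
  have h : ∀ p, p = q → η p v = η q v := by rintro p rfl; rfl
  exact h _ (chart_symm_self q)

theorem contDiffOn_chartFun (q : M) {F : Type*} [NormedAddCommGroup F] [NormedSpace ℝ F]
    {f : M → F} {U : Set M} (hf : ContMDiffOn 𝓘(ℝ, Model k) 𝓘(ℝ, F) ∞ f U) :
    ContDiffOn ℝ ∞ (f ∘ (chart k q).symm) ((chart k q).target ∩ (chart k q).symm ⁻¹' U) := by
  rw [← contMDiffOn_iff_contDiffOn]
  exact hf.comp ((contMDiffOn_extChartAt_symm q).mono inter_subset_left) fun x hx => hx.2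

theorem contMDiffOn_of_chartFun (q : M) {F : Type*} [NormedAddCommGroup F] [NormedSpace ℝ F]
    {f : Model k → F} {Ω : Set (Model k)} (hf : ContDiffOn ℝ ∞ f Ω) :
    ContMDiffOn 𝓘(ℝ, Model k) 𝓘(ℝ, F) ∞ (fun p => f (chart k q p))
      ((chart k q).source ∩ (chart k q) ⁻¹' Ω) := by
  have h : ContMDiffOn 𝓘(ℝ, Model k) 𝓘(ℝ, Model k) ∞ (chart k q) (chart k q).source := by
    rw [extChartAt_source]
    exact contMDiffOn_extChartAt
  exact (contMDiffOn_iff_contDiffOn.2 hf).comp (h.mono inter_subset_left) fun x hx => hx.2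

theorem trivializationAt_snd (q : M) {p : M} (hp : p ∈ (chart k q).source) (v : Tan k p) :
    (trivializationAt (Model k) (TangentSpace 𝓘(ℝ, Model k)) q
      (⟨p, v⟩ : TangentBundle 𝓘(ℝ, Model k) M)).2 = dChart q p v := by
  have h := TangentBundle.continuousLinearMapAt_trivializationAt (I := 𝓘(ℝ, Model k)) (x₀ := q)
    (chart_source_subset q hp)
  have h2 := congrArg (fun L => L v) h
  refine Eq.trans ?_ h2
  rw [Bundle.Trivialization.continuousLinearMapAt_apply,
    Bundle.Trivialization.linearMapAt_apply, if_pos (by simpa using chart_source_subset q hp)]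

theorem smoothVFieldOn_iff_chart (q : M) {X : VField k M} {U : Set M}
    (hU : U ⊆ (chart k q).source) :
    SmoothVFieldOn X U ↔
      ContMDiffOn 𝓘(ℝ, Model k) 𝓘(ℝ, Model k) ∞ (fun p => dChart q p (X p)) U := by
  have h := (trivializationAt (Model k) (TangentSpace 𝓘(ℝ, Model k)) q).contMDiffOn_iff
    (IM := 𝓘(ℝ, Model k)) (IB := 𝓘(ℝ, Model k)) (n := ∞) (s := U)
    (f := fun p => (⟨p, X p⟩ : TangentBundle 𝓘(ℝ, Model k) M)) (fun p hp => by
      rw [Bundle.Trivialization.mem_source]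
      simpa using chart_source_subset q (hU hp))
  rw [SmoothVFieldOn]
  refine h.trans ?_
  constructor
  · rintro ⟨-, h2⟩
    exact h2.congr fun p hp => (trivializationAt_snd q (hU hp) _).symm
  · intro h2
    exact ⟨contMDiffOn_id, h2.congr fun p hp => trivializationAt_snd q (hU hp) _⟩

theorem SmoothVFieldOn.contDiffOn_chart (q : M) {X : VField k M} {U : Set M}
    (hX : SmoothVFieldOn X U) : ContDiffOn ℝ ∞ (chartVField q X)
      ((chart k q).target ∩ (chart k q).symm ⁻¹' U) := by
  have h1 : SmoothVFieldOn X (U ∩ (chart k q).source) :=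
    ContMDiffOn.mono hX inter_subset_left
  have h2 := contDiffOn_chartFun q ((smoothVFieldOn_iff_chart q inter_subset_right).1 h1)
  refine h2.mono fun x hx => ⟨hx.1, hx.2, chart_symm_map q hx.1⟩

/-- The vector field with a given representation in the chart at `q`. -/
def ofChartVField (q : M) (Y : Model k → Model k) : VField k M := fun p =>
  (dChart (k := k) q p).inverse (Y (chart k q p))

theorem dChart_inverse_apply (q : M) {p : M} (hp : p ∈ (chart k q).source) (v : Model k) :
    dChart q p ((dChart (k := k) q p).inverse v) = v := by
  have h : (dChart (k := k) q p).IsInvertible := isInvertible_mfderiv_extChartAt (I := 𝓘(ℝ, Model k)) hp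
  exact h.self_apply_inverse v

theorem dChart_injective (q : M) {p : M} (hp : p ∈ (chart k q).source) :
    Function.Injective (dChart (k := k) q p) := by
  have h : (dChart (k := k) q p).IsInvertible := isInvertible_mfderiv_extChartAt (I := 𝓘(ℝ, Model k)) hp
  exact h.injective

theorem dChart_ofChartVField (q : M) (Y : Model k → Model k) {p : M}
    (hp : p ∈ (chart k q).source) : dChart q p (ofChartVField q Y p) = Y (chart k q p) :=
  dChart_inverse_apply q hp _

theorem chartVField_ofChartVField (q : M) (Y : Model k → Model k) {x : Model k}
    (hx : x ∈ (chart k q).target) : chartVField q (ofChartVField q Y) x = Y x := by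
  rw [chartVField, dChart_ofChartVField q Y (chart_symm_map q hx), (chart k q).right_inv hx]

theorem smoothVFieldOn_ofChartVField (q : M) {Y : Model k → Model k} {Ω : Set (Model k)}
    (hY : ContDiffOn ℝ ∞ Y Ω) :
    SmoothVFieldOn (ofChartVField q Y) ((chart k q).source ∩ (chart k q) ⁻¹' Ω) := by
  rw [smoothVFieldOn_iff_chart q inter_subset_left]
  exact (contMDiffOn_of_chartFun q hY).congr fun p hp => dChart_ofChartVField q Y hp.1

/-- In finite dimension it suffices to test the form on the constant fields of the chart, which are
smooth fields on its domain. -/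
theorem SmoothOneForm.contDiffOn_chart {η : (p : M) → Cotan k p} (hη : SmoothOneForm η) (q : M) :
    ContDiffOn ℝ ∞ (chartForm q η) (chart k q).target := by
  rw [contDiffOn_clm_apply]
  intro v
  have h1 : SmoothVFieldOn (ofChartVField q fun _ : Model k => v) (chart k q).source := by
    simpa using smoothVFieldOn_ofChartVField q (contDiffOn_const (c := v) (s := univ))
  have h2 := contDiffOn_chartFun q (hη _ (isOpen_extChartAt_source q) _ h1)
  refine (h2.mono fun x hx => ⟨hx, chart_symm_map q hx⟩).congr fun x hx => ?_
  have h3 := chartForm_apply_chartVField q η (ofChartVField q fun _ : Model k => v) hx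
  rw [chartVField_ofChartVField q _ hx] at h3
  exact h3

theorem mvfderiv_apply_eq (q : M) {f : M → ℝ} {p : M} (hp : p ∈ (chart k q).source)
    (hf : MDifferentiableAt 𝓘(ℝ, Model k) 𝓘(ℝ, ℝ) f p) (v : Tan k p) :
    mvfderiv 𝓘(ℝ, Model k) f p v =
      fderiv ℝ (f ∘ (chart k q).symm) (chart k q p) (dChart q p v) := by
  have h1 : DifferentiableAt ℝ (f ∘ (chart k q).symm) (chart k q p) := by
    rw [← mdifferentiableAt_iff_differentiableAt]
    refine MDifferentiableAt.comp (I' := 𝓘(ℝ, Model k)) _ ?_ ?_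
    · rwa [(chart k q).left_inv hp]
    · have := mdifferentiableWithinAt_extChartAt_symm (I := 𝓘(ℝ, Model k))
        ((chart k q).map_source hp)
      rwa [ModelWithCorners.range_eq_univ, mdifferentiableWithinAt_univ] at this
  have h2 : MDifferentiableAt 𝓘(ℝ, Model k) 𝓘(ℝ, Model k) (chart k q) p :=
    mdifferentiableAt_extChartAt (chart_source_subset q hp)
  have h3 : f =ᶠ[𝓝 p] (f ∘ (chart k q).symm) ∘ (chart k q) := by
    filter_upwards [(isOpen_extChartAt_source q).mem_nhds hp] with z hz
    simp only [Function.comp_apply, (chart k q).left_inv hz]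
  have h4 : mfderiv 𝓘(ℝ, Model k) 𝓘(ℝ, ℝ) f p = _ :=
    h3.mfderiv_eq.trans (mfderiv_comp p h1.mdifferentiableAt h2)
  have h5 := congrArg (fun L => L v) h4
  refine Eq.trans ?_ (h5.trans ?_)
  · rfl
  · rw [mfderiv_eq_fderiv]; rfl

/-- The bracket on M is pulled back from the chart, and at the centre of the preferred chart the
pullback map is the identity. -/
theorem mlieBracket_eq_chart {q : M} (V W : VField k M) :
    VectorField.mlieBracket 𝓘(ℝ, Model k) V W q =
      VectorField.lieBracket ℝ (chartVField q V) (chartVField q W) (chart k q q) := by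
  have key : ∀ V : VField k M, VectorField.mpullbackWithin 𝓘(ℝ, Model k) 𝓘(ℝ, Model k)
      (chart k q).symm V (range 𝓘(ℝ, Model k)) =ᶠ[𝓝 (chart k q q)] chartVField q V := by
    intro V
    filter_upwards [(isOpen_chart_target q).mem_nhds (mem_chart_target q)] with x hx
    rw [VectorField.mpullbackWithin_apply, ModelWithCorners.range_eq_univ, mfderivWithin_univ]
    have h : (mfderiv 𝓘(ℝ, Model k) 𝓘(ℝ, Model k) (chart k q).symm x).inverse =
        dChart q ((chart k q).symm x) :=
      ContinuousLinearMap.inverse_eq (dChartSymm_comp_dChart q hx) (dChart_comp_dChartSymm q hx)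
    rw [h]
    rfl
  rw [← VectorField.mlieBracketWithin_univ, VectorField.mlieBracketWithin_apply]
  have h2 : (mfderiv 𝓘(ℝ, Model k) 𝓘(ℝ, Model k) (chart k q) q).inverse =
      ContinuousLinearMap.id ℝ (Model k) := by
    have := dChart_self (k := k) q
    rw [dChart] at this
    rw [this]
    exact ContinuousLinearMap.inverse_id
  rw [h2, preimage_univ, univ_inter]
  have hr := ModelWithCorners.range_eq_univ 𝓘(ℝ, Model k)
  have gen : ∀ (s : Set (Model k)) (A B : Model k → Model k) (x : Model k), s = univ →
      VectorField.lieBracketWithin ℝ A B s x = VectorField.lieBracket ℝ A B x := by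
    rintro s A B x rfl
    rw [VectorField.lieBracketWithin_univ]
  have fin := Filter.EventuallyEq.lieBracket_vectorField_eq (𝕜 := ℝ) (E := Model k) (key V) (key W)
  exact (gen _ _ _ _ hr).trans fin

end Charts

/-! ### Orthonormal frames -/

section Frames

variable {k : ℕ} {M : Type*} [TopologicalSpace M] [ChartedSpace (Model k) M]
    [IsManifold 𝓘(ℝ, Model k) ∞ M] (S : CorankOneStructure k M)

theorem IsONB.expand {q : M} {X : Fin k → S.D q} (hX : IsONB (S.g q) X) (v : S.D q) :
    v = ∑ i, S.g q (X i) v • X i := by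
  have hv : v ∈ Submodule.span ℝ (range X) := hX.2 ▸ Submodule.mem_top
  obtain ⟨c, rfl⟩ := (Submodule.mem_span_range_iff_exists_fun ℝ).1 hv
  refine Finset.sum_congr rfl fun i _ => ?_
  simp [hX.1]

theorem IsONB.g_eq {q : M} {X : Fin k → S.D q} (hX : IsONB (S.g q) X) (v w : S.D q) :
    S.g q v w = ∑ i, S.g q (X i) v * S.g q (X i) w := by
  conv_lhs => rw [IsONB.expand S hX v]
  simp

theorem g_sharp (q : M) (l : Cotan k q) (v : S.D q) :
    S.g q (S.sharp q l) v = l (v : Tan k q) :=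
  LinearMap.BilinForm.apply_toDual_symm_apply _ _

theorem IsONB.sharp_eq {q : M} {X : Fin k → S.D q} (hX : IsONB (S.g q) X) (l : Cotan k q) :
    S.sharp q l = ∑ i, l (X i : Tan k q) • X i := by
  conv_lhs => rw [IsONB.expand S hX (S.sharp q l)]
  refine Finset.sum_congr rfl fun i _ => ?_
  rw [S.symm, g_sharp]

theorem IsONB.hamiltonian_eq {q : M} {X : Fin k → S.D q} (hX : IsONB (S.g q) X) (l : Cotan k q) :
    S.hamiltonian ⟨q, l⟩ = 1 / 2 * ∑ i, (l (X i : Tan k q)) ^ 2 := by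
  rw [CorankOneStructure.hamiltonian]
  simp only [IsONB.sharp_eq S hX]
  simp [pow_two]

theorem IsONB.linearIndependent {q : M} {X : Fin k → S.D q} (hX : IsONB (S.g q) X) :
    LinearIndependent ℝ X := by
  rw [Fintype.linearIndependent_iff]
  intro c hc i
  have := congrArg (S.g q (X i)) hc
  simpa [hX.1] using this

theorem finrank_D (q : M) : Module.finrank ℝ (S.D q) = k := by
  have h := onb_spec (S := S) q
  have := finrank_span_eq_card (IsONB.linearIndependent S h)
  rw [h.2, finrank_top, Fintype.card_fin] at this
  exact this

/-- `X` is a smooth orthonormal frame on `U`. -/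
structure IsFrameOn (U : Set M) (X : Fin k → VField k M) : Prop where
  smooth : ∀ i, SmoothVFieldOn (X i) U
  mem : ∀ p ∈ U, ∀ i, X i p ∈ S.D p
  onb : ∀ p (hp : p ∈ U), IsONB (S.g p) (fun i => ⟨X i p, mem p hp i⟩)

theorem isONB_rotate {q : M} {X : Fin k → S.D q} (hX : IsONB (S.g q) X)
    {A : Matrix (Fin k) (Fin k) ℝ} (hA : A * A.transpose = 1) :
    IsONB (S.g q) (fun i => ∑ j, A i j • X j) := by
  have hA' : A.transpose * A = 1 := mul_eq_one_comm.1 hA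
  constructor
  · intro i j
    have h := congrFun (congrFun hA i) j
    rw [Matrix.mul_apply, Matrix.one_apply] at h
    rw [← h]
    simp [hX.1, mul_comm]
  · rw [eq_top_iff, ← hX.2, Submodule.span_le]
    rintro _ ⟨j, rfl⟩
    have h : X j = ∑ i, A i j • ∑ l, A i l • X l := by
      simp only [Finset.smul_sum, smul_smul]
      rw [Finset.sum_comm]
      simp only [← Finset.sum_smul]
      have h2 : ∀ l, ∑ i, A i j * A i l = if j = l then 1 else 0 := fun l => by
        have h := congrFun (congrFun hA' j) l
        rwa [Matrix.mul_apply, Matrix.one_apply] at h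
      simp [h2]
    rw [h]
    exact Submodule.sum_mem _ fun i _ => Submodule.smul_mem _ _ (Submodule.subset_span ⟨i, rfl⟩)

theorem smoothVFieldOn_sum {ι : Type*} {s : Finset ι} {X : ι → VField k M} {U : Set M}
    (hX : ∀ i ∈ s, SmoothVFieldOn (X i) U) : SmoothVFieldOn (fun p => ∑ i ∈ s, X i p) U :=
  ContMDiffOn.sum_section hX

theorem smoothVFieldOn_smul {X : VField k M} {f : M → ℝ} {U : Set M}
    (hf : ContMDiffOn 𝓘(ℝ, Model k) 𝓘(ℝ, ℝ) ∞ f U)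
    (hX : SmoothVFieldOn X U) : SmoothVFieldOn (fun p => f p • X p) U :=
  ContMDiffOn.smul_section hf hX

theorem smoothVFieldOn_const_smul {X : VField k M} (r : ℝ) {U : Set M}
    (hX : SmoothVFieldOn X U) : SmoothVFieldOn (fun p => r • X p) U :=
  smoothVFieldOn_smul (contMDiffOn_const (c := r)) hX

/-- A local frame is rotated by the constant orthogonal matrix that carries its value at q to the
prescribed basis. The chosen bases `S.onb` are not smooth in the base point, so each needs such an
extension. -/
theorem exists_frame_extending (q : M) {Y : Fin k → S.D q} (hY : IsONB (S.g q) Y) :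
    ∃ (U : Set M) (X : Fin k → VField k M), IsOpen U ∧ q ∈ U ∧ IsFrameOn S U X ∧
      ∀ i, X i q = Y i := by
  obtain ⟨U, hU, hq, X, hX, hXo⟩ := S.frame q
  obtain ⟨hm, ho⟩ := hXo q hq
  let A : Matrix (Fin k) (Fin k) ℝ := fun i j => S.g q ⟨X j q, hm j⟩ (Y i)
  have hA : A * A.transpose = 1 := by
    ext i j
    rw [Matrix.mul_apply, Matrix.one_apply, ← hY.1 i j, IsONB.g_eq S ho]
    rfl
  have hmem : ∀ p ∈ U, ∀ i, ∑ j, A i j • X j p ∈ S.D p := fun p hp i => by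
    obtain ⟨hm, -⟩ := hXo p hp
    exact Submodule.sum_mem _ fun j _ => Submodule.smul_mem _ _ (hm j)
  refine ⟨U, fun i p => ∑ j, A i j • X j p, hU, hq, ⟨fun i => ?_, hmem, fun p hp => ?_⟩, fun i => ?_⟩
  · exact smoothVFieldOn_sum fun j _ => smoothVFieldOn_const_smul _ (hX j)
  · obtain ⟨hm, ho⟩ := hXo p hp
    convert isONB_rotate S ho hA using 2 with i
    apply Subtype.ext
    simp
  · have h := congrArg (fun v : S.D q => (v : Tan k q)) (IsONB.expand S ho (Y i))
    simp only [Submodule.coe_sum, Submodule.coe_smul] at h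
    exact h.symm

theorem exists_frame (q : M) : ∃ (U : Set M) (X : Fin k → VField k M), IsOpen U ∧ q ∈ U ∧
    IsFrameOn S U X ∧ ∀ i, X i q = S.onb q i :=
  exists_frame_extending S q (onb_spec q)

end Frames

/-! ### The exterior derivative of a one-form -/

section Forms

variable {k : ℕ} {M : Type*} [TopologicalSpace M] [ChartedSpace (Model k) M]
    [IsManifold 𝓘(ℝ, Model k) ∞ M] {η : (p : M) → Cotan k p}

theorem dOneForm_apply (η : (p : M) → Cotan k p) (q : M) (v w : Tan k q) :
    dOneForm η q v w = fderiv ℝ (chartForm q η) (chart k q q) v w -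
      fderiv ℝ (chartForm q η) (chart k q q) w v := rfl

theorem dOneForm_swap (η : (p : M) → Cotan k p) (q : M) (v w : Tan k q) :
    dOneForm η q v w = -dOneForm η q w v := by
  rw [dOneForm_apply, dOneForm_apply]
  ring

theorem dOneForm_self (η : (p : M) → Cotan k p) (q : M) (v : Tan k q) :
    dOneForm η q v v = 0 := by
  rw [dOneForm_apply, sub_self]

theorem SmoothOneForm.differentiableAt_chart (hη : SmoothOneForm η) (q : M) :
    DifferentiableAt ℝ (chartForm q η) (chart k q q) :=
  ((hη.contDiffOn_chart q).contDiffAt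
    ((isOpen_chart_target q).mem_nhds (mem_chart_target q))).differentiableAt (by simp)

theorem SmoothVFieldOn.differentiableAt_chart {X : VField k M} {U : Set M}
    (hX : SmoothVFieldOn X U) (hU : IsOpen U) {q : M} (hq : q ∈ U) :
    DifferentiableAt ℝ (chartVField q X) (chart k q q) :=
  ((SmoothVFieldOn.contDiffOn_chart q hX).contDiffAt ((isOpen_chart_preimage q hU).mem_nhds
    ⟨mem_chart_target q, by rwa [mem_preimage, chart_symm_self]⟩)).differentiableAt (by simp)

/-- Cartan's formula, in the chart. -/
theorem dOneForm_eq (hη : SmoothOneForm η) {q : M} {V W : VField k M}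
    (hV : DifferentiableAt ℝ (chartVField q V) (chart k q q))
    (hW : DifferentiableAt ℝ (chartVField q W) (chart k q q)) :
    dOneForm η q (V q) (W q) =
      fderiv ℝ (fun x => chartForm q η x (chartVField q W x)) (chart k q q) (V q) -
      fderiv ℝ (fun x => chartForm q η x (chartVField q V x)) (chart k q q) (W q) -
      η q (VectorField.mlieBracket 𝓘(ℝ, Model k) V W q) := by
  have h0 := hη.differentiableAt_chart q
  have h1 : ∀ {V : VField k M}, DifferentiableAt ℝ (chartVField q V) (chart k q q) →
      ∀ v : Model k, fderiv ℝ (fun x => chartForm q η x (chartVField q V x)) (chart k q q) v =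
        fderiv ℝ (chartForm q η) (chart k q q) v (V q) +
          η q (fderiv ℝ (chartVField q V) (chart k q q) v) := by
    intro V hV v
    rw [(h0.hasFDerivAt.clm_apply hV.hasFDerivAt).fderiv, chartForm_self, add_apply,
      ContinuousLinearMap.flip_apply, add_comm]
    refine congrArg₂ (· + ·) ?_ rfl
    exact congrArg (fderiv ℝ (chartForm q η) (chart k q q) v) (chartVField_self q V)
  have h2 : η q (VectorField.mlieBracket 𝓘(ℝ, Model k) V W q) =
      η q (fderiv ℝ (chartVField q W) (chart k q q) (V q)) -
        η q (fderiv ℝ (chartVField q V) (chart k q q) (W q)) := by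
    rw [mlieBracket_eq_chart, VectorField.lieBracket, chartVField_self, chartVField_self]
    exact map_sub (η q) _ _
  rw [h2, dOneForm_apply]
  linarith [h1 hW (V q), h1 hV (W q)]

/-- In Cartan's formula the two derivative terms vanish, since η is zero along horizontal fields. -/
theorem eta_mlieBracket (hη : SmoothOneForm η) {D : (q : M) → Submodule ℝ (Tan k q)}
    (hker : ∀ (q : M) (v : Tan k q), v ∈ D q ↔ η q v = 0) {q : M} {V W : VField k M}
    (hV : IsSectionNear D q V) (hW : IsSectionNear D q W) :
    η q (VectorField.mlieBracket 𝓘(ℝ, Model k) V W q) = -dOneForm η q (V q) (W q) := by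
  have key : ∀ V : VField k M, IsSectionNear D q V →
      DifferentiableAt ℝ (chartVField q V) (chart k q q) ∧
      ∀ v : Model k,
        fderiv ℝ (fun x => chartForm q η x (chartVField q V x)) (chart k q q) v = 0 := by
    rintro V ⟨U, hU, hq, hs, hm⟩
    refine ⟨hs.differentiableAt_chart hU hq, fun v => ?_⟩
    have : (fun x => chartForm q η x (chartVField q V x)) =ᶠ[𝓝 (chart k q q)] fun _ => 0 := by
      filter_upwards [(isOpen_chart_preimage q hU).mem_nhds
        ⟨mem_chart_target q, by rwa [mem_preimage, chart_symm_self]⟩] with x hx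
      rw [chartForm_apply_chartVField q η V hx.1]
      exact (hker _ _).1 (hm _ hx.2)
    rw [this.fderiv_eq, fderiv_fun_const]
    rfl
  have h := dOneForm_eq hη (key V hV).1 (key W hW).1
  linarith [(key V hV).2 (W q), (key W hW).2 (V q)]

end Forms

/-! ### Changes of coordinates -/

section Transition

variable {k : ℕ} {M : Type*} [TopologicalSpace M] [ChartedSpace (Model k) M]
    [IsManifold 𝓘(ℝ, Model k) ∞ M]

/-- The change of coordinates from the chart at `p` to the chart at `q`. -/
def transition (k : ℕ) {M : Type*} [TopologicalSpace M] [ChartedSpace (Model k) M] (p q : M) :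
    Model k → Model k := chart k q ∘ (chart k p).symm

/-- The domain of `transition k p q`. -/
def transitionDomain (k : ℕ) {M : Type*} [TopologicalSpace M] [ChartedSpace (Model k) M]
    (p q : M) : Set (Model k) := (chart k p).target ∩ (chart k p).symm ⁻¹' (chart k q).source

theorem isOpen_transitionDomain (p q : M) : IsOpen (transitionDomain k p q) :=
  isOpen_chart_preimage p (isOpen_extChartAt_source q)

theorem contDiffOn_transition (p q : M) :
    ContDiffOn ℝ ∞ (transition k p q) (transitionDomain k p q) := by
  have h : ContMDiffOn 𝓘(ℝ, Model k) 𝓘(ℝ, Model k) ∞ (chart k q) (chart k q).source := by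
    rw [extChartAt_source]
    exact contMDiffOn_extChartAt
  exact contDiffOn_chartFun p h

theorem mdifferentiableAt_chart_symm (p : M) {x : Model k} (hx : x ∈ (chart k p).target) :
    MDifferentiableAt 𝓘(ℝ, Model k) 𝓘(ℝ, Model k) (chart k p).symm x := by
  have := mdifferentiableWithinAt_extChartAt_symm (I := 𝓘(ℝ, Model k)) hx
  rwa [ModelWithCorners.range_eq_univ, mdifferentiableWithinAt_univ] at this

theorem fderiv_transition (p q : M) {x : Model k} (hx : x ∈ transitionDomain k p q) :
    fderiv ℝ (transition k p q) x = (dChart q ((chart k p).symm x)).comp (dChartSymm p x) := by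
  rw [← mfderiv_eq_fderiv]
  exact mfderiv_comp (I' := 𝓘(ℝ, Model k)) x
    (mdifferentiableAt_extChartAt (chart_source_subset q hx.2)) (mdifferentiableAt_chart_symm p hx.1)

theorem fderiv_transition_chartVField (p q : M) {x : Model k} (hx : x ∈ transitionDomain k p q)
    (X : VField k M) :
    fderiv ℝ (transition k p q) x (chartVField p X x) = chartVField q X (transition k p q x) := by
  have h1 : fderiv ℝ (transition k p q) x (chartVField p X x) =
      dChart q ((chart k p).symm x) (dChartSymm p x (chartVField p X x)) := by
    rw [fderiv_transition p q hx]
    rfl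
  rw [h1, chartVField, dChartSymm_dChart p hx.1]
  exact (chartVField_chart q X hx.2).symm

theorem chartForm_dChart (q : M) (η : (p : M) → Cotan k p) {p : M} (hp : p ∈ (chart k q).source)
    (v : Tan k p) : chartForm q η (chart k q p) (dChart q p v) = η p v := by
  have h1 := chartForm_apply_chartVField q η (ofChartVField q fun _ => dChart q p v)
    ((chart k q).map_source hp)
  have h2 : ∀ p', p' = p → ∀ u : VField k M, η p' (u p') = η p (u p) := by rintro p' rfl u; rfl
  rw [h2 _ ((chart k q).left_inv hp)] at h1
  rw [chartVField_chart q _ hp] at h1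
  have h3 : ofChartVField q (fun _ => dChart q p v) p = v :=
    dChart_injective q hp (dChart_ofChartVField q _ hp)
  rwa [h3] at h1

theorem chartForm_transition (p q : M) (η : (p : M) → Cotan k p) {x : Model k}
    (hx : x ∈ transitionDomain k p q) :
    chartForm p η x =
      (chartForm q η (transition k p q x)).comp (fderiv ℝ (transition k p q) x) := by
  ext v
  rw [fderiv_transition p q hx]
  exact (chartForm_dChart q η hx.2 (dChartSymm p x v)).symm

theorem mem_transitionDomain (p q : M) {z : M} (hp : z ∈ (chart k p).source)
    (hq : z ∈ (chart k q).source) : chart k p z ∈ transitionDomain k p q :=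
  ⟨(chart k p).map_source hp, by rwa [mem_preimage, (chart k p).left_inv hp]⟩

theorem transition_chart (p q : M) {z : M} (hp : z ∈ (chart k p).source) :
    transition k p q (chart k p z) = chart k q z := by
  rw [transition, Function.comp_apply, (chart k p).left_inv hp]

theorem fderiv_transition_self (p q : M) (hq : p ∈ (chart k q).source) (v : Model k) :
    fderiv ℝ (transition k p q) (chart k p p) v = dChart q p v := by
  have hp := mem_extChartAt_source (I := 𝓘(ℝ, Model k)) p
  obtain ⟨X, rfl⟩ : ∃ X : VField k M, X p = v := ⟨fun _ => v, rfl⟩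
  have h := fderiv_transition_chartVField p q (mem_transitionDomain p q hp hq) X
  rw [transition_chart p q hp, chartVField_chart q _ hq] at h
  refine Eq.trans ?_ h
  exact congrArg _ (chartVField_self p _).symm

/-- `dOneForm` is defined in a chart that moves with the point; smoothness of the Reeb field
requires a fixed chart. -/
theorem dOneForm_eq_chart {η : (p : M) → Cotan k p} (hη : SmoothOneForm η) (q : M) {p : M}
    (hq : p ∈ (chart k q).source) (v w : Tan k p) :
    dOneForm η p v w =
      fderiv ℝ (chartForm q η) (chart k q p) (dChart q p v) (dChart q p w) -
      fderiv ℝ (chartForm q η) (chart k q p) (dChart q p w) (dChart q p v) := by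
  have hp := mem_extChartAt_source (I := 𝓘(ℝ, Model k)) p
  have hx := mem_transitionDomain p q hp hq
  have hΩ := (isOpen_transitionDomain p q).mem_nhds hx
  have hc := (contDiffOn_transition p q).contDiffAt hΩ
  have h2 : DifferentiableAt ℝ (fderiv ℝ (transition k p q)) (chart k p p) :=
    (hc.fderiv_right (m := 1) (by norm_cast)).differentiableAt (by norm_num)
  have h3 : DifferentiableAt ℝ (chartForm q η) (transition k p q (chart k p p)) := by
    rw [transition_chart p q hp]
    exact ((hη.contDiffOn_chart q).contDiffAt
      ((isOpen_chart_target q).mem_nhds ((chart k q).map_source hq))).differentiableAt (by simp)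
  have h4 := (h3.hasFDerivAt.comp _ (hc.differentiableAt (by simp)).hasFDerivAt).clm_comp
    h2.hasFDerivAt
  have h5 := h4.congr_of_eventuallyEq (f₁ := chartForm p η) (by
    filter_upwards [hΩ] with x hx
    exact chartForm_transition p q η hx)
  have hsymm : ∀ v w, fderiv ℝ (fderiv ℝ (transition k p q)) (chart k p p) v w =
      fderiv ℝ (fderiv ℝ (transition k p q)) (chart k p p) w v :=
    hc.isSymmSndFDerivAt (by simp; norm_cast)
  -- Differentiating the pulled-back form gives an extra term with the second derivative of the
  -- change of coordinates. It is symmetric, so antisymmetrization removes it.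
  have h6 : ∀ v w : Model k, fderiv ℝ (chartForm p η) (chart k p p) v w =
      chartForm q η (chart k q p) (fderiv ℝ (fderiv ℝ (transition k p q)) (chart k p p) v w) +
      fderiv ℝ (chartForm q η) (chart k q p) (dChart q p v) (dChart q p w) := by
    intro v w
    rw [h5.fderiv, ← transition_chart p q hp, ← fderiv_transition_self p q hq,
      ← fderiv_transition_self p q hq]
    simp
  have e1 := h6 v w
  have e2 := h6 w v
  rw [hsymm w v] at e2
  rw [dOneForm_apply]
  linarith

end Transition

/-! ### The Reeb field -/

section Reeb

/-- If v is in the kernel of B + a ⊗ a, pairing with v itself gives a(v)² = 0 because B is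
alternating, and then nondegeneracy of B on ker a forces v = 0. -/
theorem bijective_of_contact {E : Type*} [NormedAddCommGroup E] [InnerProductSpace ℝ E]
    [FiniteDimensional ℝ E] {B : E →L[ℝ] E →L[ℝ] ℝ} (hB : ∀ v, B v v = 0) {a : E →L[ℝ] ℝ}
    (hc : ∀ v, a v = 0 → (∀ w, a w = 0 → B v w = 0) → v = 0) :
    (B + a.smulRight a).IsInvertible := by
  have hinj : Function.Injective (B + a.smulRight a).toLinearMap := by
    rw [injective_iff_map_eq_zero]
    intro v hv
    have h1 : ∀ w, B v w + a v * a w = 0 := fun w => congrArg (fun L : E →L[ℝ] ℝ => L w) hv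
    have h2 : a v = 0 := by
      have := h1 v
      rw [hB, zero_add] at this
      exact mul_self_eq_zero.1 this
    refine hc v h2 fun w _ => ?_
    have := h1 w
    rwa [h2, zero_mul, add_zero] at this
  have hd : Module.finrank ℝ E = Module.finrank ℝ (E →L[ℝ] ℝ) :=
    (InnerProductSpace.toDual ℝ E).toLinearEquiv.finrank_eq
  exact ⟨(LinearEquiv.ofInjectiveOfFinrankEq _ hinj hd).toContinuousLinearEquiv, by ext; rfl⟩

/-- The two Reeb conditions are packed into one linear equation with an invertible operator, which
yields existence, uniqueness and smooth dependence together. -/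
theorem reeb_iff {E : Type*} [NormedAddCommGroup E] [NormedSpace ℝ E]
    {B : E →L[ℝ] E →L[ℝ] ℝ} (hB : ∀ v, B v v = 0) {a : E →L[ℝ] ℝ} (ha : a ≠ 0)
    (hc : ∀ v, a v = 0 → (∀ w, a w = 0 → B v w = 0) → v = 0) (z : E) :
    ((∀ w, B z w = 0) ∧ a z = 1) ↔ (B + a.smulRight a) z = a := by
  constructor
  · rintro ⟨h1, h2⟩
    ext w
    simp [h1, h2]
  · intro h
    have h1 : ∀ w, B z w + a z * a w = a w := fun w => congrArg (fun L : E →L[ℝ] ℝ => L w) h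
    have h2 : a z = 1 := by
      have h3 := h1 z
      rw [hB, zero_add] at h3
      rcases mul_eq_zero.1 (show a z * (a z - 1) = 0 by linarith) with h4 | h4
      -- If a(z) were 0, the equation would make z orthogonal to ker a for B, hence z = 0 and a = 0.
      · exfalso
        have hz : z = 0 := hc z h4 fun w hw => by
          have := h1 w
          rwa [h4, zero_mul, add_zero, hw] at this
        apply ha
        ext w
        have := h1 w
        rw [hz] at this
        simpa using this.symm
      · linarith
    refine ⟨fun w => ?_, h2⟩
    have := h1 w
    rw [h2] at this
    linarith

variable {k : ℕ} {M : Type*} [TopologicalSpace M] [ChartedSpace (Model k) M]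
    [IsManifold 𝓘(ℝ, Model k) ∞ M] {S : CorankOneStructure k M} {η : (p : M) → Cotan k p}

theorem sharp_eq_zero {q : M} {l : Cotan k q} (h : ∀ v ∈ S.D q, l v = 0) : S.sharp q l = 0 := by
  by_contra h0
  have := S.pos q _ h0
  rw [g_sharp, h _ (S.sharp q l).2] at this
  exact lt_irrefl _ this

theorem eq_zero_of_contact (hη : S.IsNormalizedContactForm η) (q : M) (v : Tan k q)
    (hv : η q v = 0) (h : ∀ w : Tan k q, η q w = 0 → dOneForm η q v w = 0) : v = 0 := by
  have h1 := hη.contact q ⟨v, (hη.ker q v).2 hv⟩ (sharp_eq_zero fun w hw => by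
    rw [neg_apply, h w ((hη.ker q w).1 hw), neg_zero])
  exact congrArg Subtype.val h1

theorem eta_ne_zero (hη : S.IsNormalizedContactForm η) (q : M) : η q ≠ 0 := by
  intro h
  have h1 : S.D q = ⊤ := by
    rw [eq_top_iff]
    intro v _
    rw [hη.ker, h]
    rfl
  have h2 := finrank_D S q
  rw [h1, finrank_top] at h2
  have h3 : Module.finrank ℝ (Tan k q) = k + 1 := finrank_euclideanSpace_fin
  omega

/-- The exterior derivative of a one-form in the chart at `q`, corrected by `η ⊗ η`. -/
def reebOp (q : M) (η : (p : M) → Cotan k p) (x : Model k) : Model k →L[ℝ] Model k →L[ℝ] ℝ :=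
  fderiv ℝ (chartForm q η) x - (fderiv ℝ (chartForm q η) x).flip +
    (chartForm q η x).smulRight (chartForm q η x)

theorem contact_chart (hη : S.IsNormalizedContactForm η) (q : M) {p : M}
    (hp : p ∈ (chart k q).source) (v : Model k) (hv : chartForm q η (chart k q p) v = 0)
    (h : ∀ w, chartForm q η (chart k q p) w = 0 →
      (fderiv ℝ (chartForm q η) (chart k q p) - (fderiv ℝ (chartForm q η) (chart k q p)).flip) v w
        = 0) : v = 0 := by
  have e := dChart_inverse_apply q hp v
  rw [← e] at hv h ⊢
  rw [chartForm_dChart q η hp] at hv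
  have := eq_zero_of_contact hη p _ hv fun w hw => by
    rw [dOneForm_eq_chart hη.smooth q hp]
    exact h _ (by rw [chartForm_dChart q η hp, hw])
  rw [this, map_zero]

theorem chartForm_ne_zero (hη : S.IsNormalizedContactForm η) (q : M) {p : M}
    (hp : p ∈ (chart k q).source) : chartForm q η (chart k q p) ≠ 0 := by
  intro h
  apply eta_ne_zero hη p
  ext v
  rw [← chartForm_dChart q η hp, h]
  rfl

theorem isReebField_iff_chart (hη : S.IsNormalizedContactForm η) (q : M) {p : M}
    (hp : p ∈ (chart k q).source) (z : Tan k p) :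
    ((∀ w : Tan k p, dOneForm η p z w = 0) ∧ η p z = 1) ↔
      reebOp q η (chart k q p) (dChart q p z) = chartForm q η (chart k q p) := by
  rw [reebOp, ← reeb_iff (B := fderiv ℝ (chartForm q η) (chart k q p) -
      (fderiv ℝ (chartForm q η) (chart k q p)).flip) (fun v => by simp)
    (chartForm_ne_zero hη q hp) (contact_chart hη q hp), chartForm_dChart q η hp]
  refine and_congr ⟨fun h w => ?_, fun h w => ?_⟩ Iff.rfl
  · have := h ((dChart (k := k) q p).inverse w)
    rw [dOneForm_eq_chart hη.smooth q hp, dChart_inverse_apply q hp] at this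
    exact this
  · rw [dOneForm_eq_chart hη.smooth q hp]
    exact h _

theorem isInvertible_reebOp (hη : S.IsNormalizedContactForm η) (q : M) {p : M}
    (hp : p ∈ (chart k q).source) : (reebOp q η (chart k q p)).IsInvertible :=
  bijective_of_contact (fun v => by simp) (contact_chart hη q hp)

theorem isReebField_iff_eq (hη : S.IsNormalizedContactForm η) (q : M) {p : M}
    (hp : p ∈ (chart k q).source) (z : Tan k p) :
    ((∀ w : Tan k p, dOneForm η p z w = 0) ∧ η p z = 1) ↔
      z = ofChartVField q (fun x => (reebOp q η x).inverse (chartForm q η x)) p := by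
  have hi := isInvertible_reebOp hη q hp
  rw [isReebField_iff_chart hη q hp]
  constructor
  · intro h
    apply dChart_injective q hp
    rw [dChart_ofChartVField q _ hp, ← h, hi.inverse_apply_self]
  · rintro rfl
    rw [dChart_ofChartVField q _ hp, hi.self_apply_inverse]

theorem existsUnique_reeb (hη : S.IsNormalizedContactForm η) :
    ∃! Z : VField k M, IsReebField η Z := by
  have h : ∀ q : M, ∃! z : Tan k q, (∀ w : Tan k q, dOneForm η q z w = 0) ∧ η q z = 1 := by
    intro q
    simp only [isReebField_iff_eq hη q (mem_extChartAt_source q)]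
    exact existsUnique_eq
  choose Z hZ hZu using h
  exact ⟨Z, hZ, fun Z' hZ' => funext fun q => hZu q _ (hZ' q)⟩

theorem contDiffOn_reebOp (hη : SmoothOneForm η) (q : M) :
    ContDiffOn ℝ ∞ (reebOp q η) (chart k q).target := by
  have h1 := hη.contDiffOn_chart q
  have h2 : ContDiffOn ℝ ∞ (fderiv ℝ (chartForm q η)) (chart k q).target :=
    h1.fderiv_of_isOpen (isOpen_chart_target q) (by simp)
  have h3 : ContDiffOn ℝ ∞ (fun x => (fderiv ℝ (chartForm q η) x).flip) (chart k q).target :=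
    contDiffOn_clm_apply.2 fun v => contDiffOn_clm_apply.2 fun w =>
      (h2.clm_apply contDiffOn_const).clm_apply contDiffOn_const
  exact (h2.sub h3).add (h1.smulRight h1)

/-- In a fixed chart the field solves a linear equation with smooth data, and inversion is smooth at
invertible operators. -/
theorem IsReebField.smooth (hη : S.IsNormalizedContactForm η) {Z : VField k M}
    (hZ : IsReebField η Z) (q : M) : SmoothVFieldOn Z (chart k q).source := by
  have h1 : ContDiffOn ℝ ∞ (fun x => (reebOp q η x).inverse (chartForm q η x))
      (chart k q).target := by
    intro x hx
    have hp := chart_symm_map q hx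
    have hi := isInvertible_reebOp hη q hp
    rw [(chart k q).right_inv hx] at hi
    obtain ⟨e, he⟩ := hi
    have h2 : ContDiffAt ℝ ∞ ContinuousLinearMap.inverse (reebOp q η x) := by
      rw [← he]
      exact contDiffAt_map_inverse e
    exact (h2.comp_contDiffWithinAt x (contDiffOn_reebOp hη.smooth q x hx)).clm_apply
      (hη.smooth.contDiffOn_chart q x hx)
  have h2 := smoothVFieldOn_ofChartVField q h1
  have h3 : (chart k q).source ∩ chart k q ⁻¹' (chart k q).target = (chart k q).source :=
    inter_eq_left.2 fun p hp => (chart k q).map_source hp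
  rw [h3] at h2
  refine ContMDiffOn.congr h2 fun p hp => ?_
  rw [(isReebField_iff_eq hη q hp _).1 (hZ p)]

end Reeb

/-! ### Popp's volume -/

section Popp

variable {k : ℕ} {M : Type*} [TopologicalSpace M] [ChartedSpace (Model k) M]
    [IsManifold 𝓘(ℝ, Model k) ∞ M] {S : CorankOneStructure k M} {η : (p : M) → Cotan k p}

theorem g_J (q : M) (v w : S.D q) :
    S.g q v (S.J η q w) = dOneForm η q (v : Tan k q) (w : Tan k q) := by
  rw [CorankOneStructure.J, S.symm, g_sharp, dOneForm_swap]
  rfl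

theorem sum_dOneForm_sq (hη : S.IsNormalizedContactForm η) {q : M} {X : Fin k → S.D q}
    (hX : IsONB (S.g q) X) :
    ∑ s : Fin k × Fin k, (dOneForm η q (X s.1 : Tan k q) (X s.2 : Tan k q)) ^ 2 = 1 := by
  rw [Fintype.sum_prod_type, ← hη.norm_eq_one q X hX]
  simp only [g_J]

theorem dOneForm_expand {q : M} {X : Fin k → S.D q} (hX : IsONB (S.g q) X) (v w : S.D q) :
    dOneForm η q (v : Tan k q) (w : Tan k q) = ∑ s : Fin k × Fin k,
      S.g q (X s.1) v * S.g q (X s.2) w *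
        dOneForm η q (X s.1 : Tan k q) (X s.2 : Tan k q) := by
  conv_lhs => rw [IsONB.expand S hX v, IsONB.expand S hX w]
  rw [Fintype.sum_prod_type]
  simp only [Submodule.coe_sum, Submodule.coe_smul, map_sum, map_smul, sum_apply, smul_apply,
    smul_eq_mul, Finset.mul_sum]
  rw [Finset.sum_comm]
  refine Finset.sum_congr rfl fun i _ => Finset.sum_congr rfl fun j _ => by ring

theorem isSectionNear_frame {U : Set M} {X : Fin k → VField k M} (hX : IsFrameOn S U X)
    (hU : IsOpen U) {q : M} (hq : q ∈ U) (r : ℝ) (i : Fin k) :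
    IsSectionNear S.D q (fun p => r • X i p) :=
  ⟨U, hU, hq, smoothVFieldOn_const_smul r (hX.smooth i), fun p hp =>
    Submodule.smul_mem _ _ (hX.mem p hp i)⟩

/-- The norm of a tensor is the Euclidean norm of its coefficient matrix in an orthonormal basis. -/
theorem sum_sum_g_mul_g {q : M} {X : Fin k → S.D q} (hX : IsONB (S.g q) X) {m : ℕ}
    (v w : Fin m → S.D q) :
    ∑ s, ∑ t, S.g q (v s) (v t) * S.g q (w s) (w t) =
      ∑ a : Fin k × Fin k, (∑ s, S.g q (X a.1) (v s) * S.g q (X a.2) (w s)) ^ 2 := by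
  simp only [pow_two, Finset.sum_mul_sum]
  conv_rhs => rw [Finset.sum_comm]
  refine Finset.sum_congr rfl fun s _ => ?_
  conv_rhs => rw [Finset.sum_comm]
  refine Finset.sum_congr rfl fun t _ => ?_
  rw [IsONB.g_eq S hX (v s), IsONB.g_eq S hX (w s), Finset.sum_mul_sum, Fintype.sum_prod_type]
  refine Finset.sum_congr rfl fun i _ => Finset.sum_congr rfl fun j _ => by ring

/-- Modulo `D` the bracket map on tensors is, after applying η, the linear functional −dη. Its
coefficients have square sum ‖J‖² = 1, so the least norm of a preimage of x is |η(x)|. -/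
theorem quotNormSq_eq (hη : S.IsNormalizedContactForm η) (q : M) (x : Tan k q) :
    S.quotNormSq q x = (η q x) ^ 2 := by
  obtain ⟨U, F, hU, hq, hF, hFq⟩ := exists_frame S q
  have hX := onb_spec (S := S) q
  set X := S.onb q with hXdef
  have hω := sum_dOneForm_sq hη hX
  refine IsLeast.csInf_eq ⟨?_, ?_⟩
  · let e := (finProdFinEquiv (m := k) (n := k)).symm
    -- The minimizer has coefficients proportional to those of −dη, the equality case of
    -- Cauchy–Schwarz.
    let a : Fin k × Fin k → ℝ := fun s =>
      -η q x * dOneForm η q (X s.1 : Tan k q) (X s.2 : Tan k q)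
    have hV : ∀ s : Fin (k * k), IsSectionNear S.D q (fun p => a (e s) • F (e s).1 p) ∧
        a (e s) • F (e s).1 q = ((a (e s) • X (e s).1 : S.D q) : Tan k q) := fun s =>
      ⟨isSectionNear_frame hF hU hq _ _, by rw [hFq]; rfl⟩
    have hW : ∀ s : Fin (k * k), IsSectionNear S.D q (fun p => (1 : ℝ) • F (e s).2 p) ∧
        (1 : ℝ) • F (e s).2 q = ((X (e s).2 : S.D q) : Tan k q) := fun s =>
      ⟨isSectionNear_frame hF hU hq _ _, by rw [hFq, one_smul]⟩
    refine ⟨k * k, fun s => a (e s) • X (e s).1, fun s => X (e s).2,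
      fun s p => a (e s) • F (e s).1 p, fun s p => (1 : ℝ) • F (e s).2 p, hV, hW, ?_, ?_⟩
    · rw [hη.ker, map_sub, map_sum]
      have h1 : ∀ s, η q (VectorField.mlieBracket 𝓘(ℝ, Model k)
          (fun p => a (e s) • F (e s).1 p) (fun p => (1 : ℝ) • F (e s).2 p) q) =
          η q x * dOneForm η q (X (e s).1 : Tan k q) (X (e s).2 : Tan k q) ^ 2 := by
        intro s
        rw [eta_mlieBracket hη.smooth hη.ker (hV s).1 (hW s).1, (hV s).2, (hW s).2,
          Submodule.coe_smul, map_smul, smul_apply, smul_eq_mul]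
        ring
      rw [Finset.sum_congr rfl fun s _ => h1 s, ← Finset.mul_sum,
        Equiv.sum_comp e (fun s => dOneForm η q (X s.1 : Tan k q) (X s.2 : Tan k q) ^ 2), hω,
        mul_one, sub_self]
    · rw [sum_sum_g_mul_g hX]
      have h2 : ∀ b : Fin k × Fin k,
          ∑ s, S.g q (X b.1) (a (e s) • X (e s).1) * S.g q (X b.2) (X (e s).2) = a b := by
        intro b
        rw [Equiv.sum_comp e (fun s => S.g q (X b.1) (a s • X s.1) * S.g q (X b.2) (X s.2)),
          Finset.sum_eq_single b]
        · simp [hX.1]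
        · intro c _ hc
          rw [map_smul, hX.1, hX.1]
          by_cases h1 : b.1 = c.1
          · have h2 : b.2 ≠ c.2 := fun h2 => hc (Prod.ext h1.symm h2.symm)
            simp [h2]
          · simp [h1]
        · simp
      simp only [h2, a, mul_pow, neg_sq]
      rw [← Finset.mul_sum, hω, mul_one]
  · rintro r ⟨m, v, w, V, W, hV, hW, hx, rfl⟩
    rw [hη.ker, map_sub, map_sum, sub_eq_zero] at hx
    have h1 : η q x = -∑ a : Fin k × Fin k,
        (∑ s, S.g q (X a.1) (v s) * S.g q (X a.2) (w s)) *
          dOneForm η q (X a.1 : Tan k q) (X a.2 : Tan k q) := by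
      simp only [Finset.sum_mul]
      rw [hx, Finset.sum_comm, ← Finset.sum_neg_distrib]
      refine Finset.sum_congr rfl fun s _ => ?_
      rw [eta_mlieBracket hη.smooth hη.ker (hV s).1 (hW s).1, (hV s).2, (hW s).2,
        dOneForm_expand hX]
    rw [h1, neg_sq, sum_sum_g_mul_g hX]
    -- Cauchy–Schwarz for the coefficients of the tensor against those of dη gives the lower bound.
    refine (Finset.sum_mul_sq_le_sq_mul_sq _ _ _).trans ?_
    rw [hω, mul_one]

/-- The change of basis matrix is orthogonal, so its determinant is ±1. -/
theorem IsONB.abs_alternating {q : M} {X Y : Fin k → S.D q} (hX : IsONB (S.g q) X)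
    (hY : IsONB (S.g q) Y) (f : (S.D q) [⋀^Fin k]→ₗ[ℝ] ℝ) : |f X| = |f Y| := by
  let e : Module.Basis (Fin k) ℝ (S.D q) :=
    Module.Basis.mk (IsONB.linearIndependent S hX) hX.2.ge
  have he : ⇑e = X := Module.Basis.coe_mk _ _
  have hr : ∀ v i, e.repr v i = S.g q (X i) v := by
    intro v i
    conv_lhs => rw [IsONB.expand S hX v]
    simp only [map_sum, map_smul, ← he, Module.Basis.repr_self]
    simp [Finsupp.single_apply]
  have h1 : (e.toMatrix Y).transpose * e.toMatrix Y = 1 := by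
    ext i j
    rw [Matrix.mul_apply, Matrix.one_apply, ← hY.1 i j, IsONB.g_eq S hX]
    simp only [Matrix.transpose_apply, Module.Basis.toMatrix_apply, hr]
  have h2 : (e.toMatrix Y).det ^ 2 = 1 := by
    have := congrArg Matrix.det h1
    rwa [Matrix.det_mul, Matrix.det_transpose, Matrix.det_one, ← pow_two] at this
  have h3 := congrArg (fun f => f Y) (f.eq_smul_basis_det e)
  simp only [AlternatingMap.smul_apply, smul_eq_mul, Module.Basis.det_apply, he] at h3
  have h4 : |(e.toMatrix Y).det| = 1 := by
    rw [← sq_eq_sq₀ (abs_nonneg _) zero_le_one, sq_abs, h2, one_pow]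
  rw [h3, abs_mul, h4, mul_one]

theorem linearIndependent_snoc {q : M} {X : Fin k → S.D q} (hX : IsONB (S.g q) X) {x : Tan k q}
    (hx : x ∉ S.D q) :
    LinearIndependent ℝ (Fin.snoc (α := fun _ => Tan k q) (fun i => (X i : Tan k q)) x) := by
  have h := (IsONB.linearIndependent S hX).map' (S.D q).subtype (Submodule.ker_subtype _)
  refine linearIndependent_finSnoc.2 ⟨h, fun hm => hx ?_⟩
  refine (Submodule.span_le (p := S.D q)).2 ?_ hm
  rintro _ ⟨i, rfl⟩
  exact (X i).2

theorem vol_snoc_ne_zero {q : M} {X : Fin k → S.D q} (hX : IsONB (S.g q) X) {x : Tan k q}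
    (hx : x ∉ S.D q) {τ : (Tan k q) [⋀^Fin (k + 1)]→ₗ[ℝ] ℝ} (hω : τ ≠ 0) :
    τ (Fin.snoc (α := fun _ => Tan k q) (fun i => (X i : Tan k q)) x) ≠ 0 := by
  have h := linearIndependent_snoc hX hx
  have hd : Fintype.card (Fin (k + 1)) = Module.finrank ℝ (Tan k q) := by
    rw [Fintype.card_fin]
    exact (finrank_euclideanSpace_fin (𝕜 := ℝ) (n := k + 1)).symm
  have := (τ.map_basis_ne_zero_iff (basisOfLinearIndependentOfCardEqFinrank h hd)).2 hω
  rwa [coe_basisOfLinearIndependentOfCardEqFinrank] at this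

/-- Two horizontal orthonormal bases differ by a determinant ±1, and x differs from y or −y by a
horizontal vector, which does not contribute beside a basis of `D`. -/
theorem abs_vol_snoc_eq (hη : S.IsNormalizedContactForm η) {q : M} {X Y : Fin k → S.D q}
    (hX : IsONB (S.g q) X) (hY : IsONB (S.g q) Y) {x y : Tan k q} (hxy : |η q x| = |η q y|)
    (τ : (Tan k q) [⋀^Fin (k + 1)]→ₗ[ℝ] ℝ) :
    |τ (Fin.snoc (α := fun _ => Tan k q) (fun i => (X i : Tan k q)) x)| =
      |τ (Fin.snoc (α := fun _ => Tan k q) (fun i => (Y i : Tan k q)) y)| := by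
  have hdep : ∀ {Y : Fin k → S.D q}, IsONB (S.g q) Y → ∀ u ∈ S.D q,
      τ (Fin.snoc (α := fun _ => Tan k q) (fun i => (Y i : Tan k q)) u) = 0 := by
    intro Y hY u hu
    refine τ.map_linearDependent _ fun hl => ?_
    refine (linearIndependent_finSnoc.1 hl).2 ?_
    have h1 := congrArg Subtype.val (IsONB.expand S hY ⟨u, hu⟩)
    rw [Submodule.coe_sum] at h1
    change u = _ at h1
    rw [h1]
    exact Submodule.sum_mem _ fun i _ => Submodule.smul_mem _ _ (Submodule.subset_span ⟨i, rfl⟩)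
  have hupd : ∀ (Y : Fin k → S.D q) u,
      Fin.snoc (α := fun _ => Tan k q) (fun i => (Y i : Tan k q)) u =
      Function.update (Fin.snoc (α := fun _ => Tan k q) (fun i => (Y i : Tan k q)) 0)
        (Fin.last k) u := fun Y u => by
    rw [Fin.update_snoc_last]
  -- Moving x to the front costs a sign and leaves an alternating form on `D`.
  have hrot : ∀ (Y : Fin k → S.D q),
      |τ (Fin.snoc (α := fun _ => Tan k q) (fun i => (Y i : Tan k q)) x)| =
      |((τ.curryLeft x).compLinearMap (S.D q).subtype) Y| := by
    intro Y
    rw [Fin.snoc_eq_cons_rotate]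
    have h1 := τ.map_perm (Fin.cons x fun i => (Y i : Tan k q)) (finRotate (k + 1))
    change |τ ((Fin.cons x fun i => (Y i : Tan k q)) ∘ (finRotate (k + 1)))| = _
    rw [h1]
    rcases Int.units_eq_one_or (Equiv.Perm.sign (finRotate (k + 1))) with h | h
    · rw [h, one_smul]; rfl
    · rw [h, Units.neg_smul, one_smul, abs_neg]; rfl
  have h1 : |τ (Fin.snoc (α := fun _ => Tan k q) (fun i => (X i : Tan k q)) x)| =
      |τ (Fin.snoc (α := fun _ => Tan k q) (fun i => (Y i : Tan k q)) x)| := by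
    rw [hrot X, hrot Y]
    exact IsONB.abs_alternating hX hY _
  rw [h1]
  rcases abs_eq_abs.1 hxy with h | h
  · have h2 := hdep hY (x - y) ((hη.ker _ _).2 (by rw [map_sub, h, sub_self]))
    rw [hupd, AlternatingMap.map_update_sub, ← hupd, ← hupd, sub_eq_zero] at h2
    rw [h2]
  · have h2 := hdep hY (x + y) ((hη.ker _ _).2 (by rw [map_add, h, neg_add_cancel]))
    rw [hupd, AlternatingMap.map_update_add, ← hupd, ← hupd, add_eq_zero_iff_eq_neg] at h2
    rw [h2, abs_neg]

theorem contMDiffOn_vol_snoc {τ : TopForm k M} (hω : IsVolumeForm τ) {U : Set M} (hU : IsOpen U)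
    {X : Fin k → VField k M} (hX : ∀ i, SmoothVFieldOn (X i) U) {Z : VField k M}
    (hZ : SmoothVFieldOn Z U) :
    ContMDiffOn 𝓘(ℝ, Model k) 𝓘(ℝ, ℝ) ∞
      (fun p => τ p (Fin.snoc (α := fun _ => Tan k p) (fun i => X i p) (Z p))) U := by
  have h := hω.smooth U hU (Fin.snoc (α := fun _ => VField k M) X Z) (fun i => by
    refine Fin.lastCases ?_ (fun j => ?_) i
    · rwa [Fin.snoc_last]
    · rw [Fin.snoc_castSucc]; exact hX j)
  refine h.congr fun p _ => congrArg (τ p) (funext fun i => ?_)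
  refine Fin.lastCases ?_ (fun j => ?_) i
  · rw [Fin.snoc_last, Fin.snoc_last]
  · rw [Fin.snoc_castSucc, Fin.snoc_castSucc]

theorem not_mem_D_of_eta (hη : S.IsNormalizedContactForm η) {q : M} {x : Tan k q}
    (hx : η q x = 1) : x ∉ S.D q := by
  rw [hη.ker, hx]
  exact one_ne_zero

/-- A given volume is divided by the absolute value it takes on an orthonormal basis followed by the
Reeb vector. This keeps its orientation and makes it ±1 on all the required bases. -/
theorem exists_isPoppVolume (hη : S.IsNormalizedContactForm η) {τ : TopForm k M}
    (hω : IsVolumeForm τ) : ∃ P : TopForm k M, S.IsPoppVolume P := by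
  obtain ⟨Z, hZ, -⟩ := existsUnique_reeb hη
  let ρ : M → ℝ := fun p =>
    |τ p (Fin.snoc (α := fun _ => Tan k p) (fun i => (S.onb p i : Tan k p)) (Z p))|
  have hρ : ∀ p, ρ p ≠ 0 := fun p => abs_ne_zero.2
    (vol_snoc_ne_zero (onb_spec p) (not_mem_D_of_eta hη (hZ p).2) (hω.ne_zero p))
  have hρs : ContMDiff 𝓘(ℝ, Model k) 𝓘(ℝ, ℝ) ∞ ρ := by
    intro q
    obtain ⟨U, X, hU, hq, hX, -⟩ := exists_frame S q
    have hU' : IsOpen (U ∩ (chart k q).source) := hU.inter (isOpen_extChartAt_source q)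
    have hq' : q ∈ U ∩ (chart k q).source := ⟨hq, mem_extChartAt_source q⟩
    have h1 := contMDiffOn_vol_snoc hω hU'
      (fun i => ContMDiffOn.mono (hX.smooth i) inter_subset_left)
      (ContMDiffOn.mono (hZ.smooth hη q) inter_subset_right)
    have h2 := (h1 q hq').contMDiffAt (hU'.mem_nhds hq')
    have h3 : τ q (Fin.snoc (α := fun _ => Tan k q) (fun i => X i q) (Z q)) ≠ 0 :=
      vol_snoc_ne_zero (hX.onb q hq) (not_mem_D_of_eta hη (hZ q).2) (hω.ne_zero q)
    have h4 := (contDiffAt_abs (n := ⊤) h3).contMDiffAt.comp q h2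
    refine h4.congr_of_eventuallyEq ?_
    filter_upwards [hU.mem_nhds hq] with p hp
    -- The basis `S.onb p` may jump with p, but the absolute value is the same for the smooth frame;
    -- that function is nonzero, where the absolute value is smooth.
    exact abs_vol_snoc_eq hη (onb_spec p) (hX.onb p hp) rfl (τ p)
  refine ⟨fun p => (ρ p)⁻¹ • τ p, ⟨?_, ?_⟩, ?_⟩
  · intro U hU Y hY
    exact ((hρs.contMDiffOn (s := U)).inv₀ fun p _ => hρ p).mul (hω.smooth U hU Y hY)
  · intro p
    exact smul_ne_zero (inv_ne_zero (hρ p)) (hω.ne_zero p)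
  · intro q X x hX hx
    rw [quotNormSq_eq hη, sq_eq_one_iff, ← abs_eq zero_le_one] at hx
    have h1 : |τ q (Fin.snoc (α := fun _ => Tan k q) (fun i => (X i : Tan k q)) x)| = ρ q :=
      abs_vol_snoc_eq hη hX (onb_spec q) (by rw [hx, (hZ q).2, abs_one]) (τ q)
    change |(ρ q)⁻¹ * τ q (Fin.snoc (α := fun _ => Tan k q) (fun i => (X i : Tan k q)) x)| = 1
    rw [abs_mul, h1, abs_inv, abs_of_nonneg (abs_nonneg _ : 0 ≤ ρ q), inv_mul_cancel₀ (hρ q)]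

end Popp

/-! ### Normal extremals in coordinates -/

section HamiltonEquations

variable {E : Type*} [NormedAddCommGroup E] [NormedSpace ℝ E] {ι : Type*} [Fintype ι]

theorem fderiv_momentum (y : ι → E) (ξ α : E →L[ℝ] ℝ) :
    fderiv ℝ (fun ξ : E →L[ℝ] ℝ => 1 / 2 * ∑ i, (ξ (y i)) ^ 2) ξ α =
      α (∑ i, ξ (y i) • y i) := by
  have h1 : ∀ i, HasFDerivAt (fun ξ : E →L[ℝ] ℝ => (ξ (y i)) ^ 2)
      ((2 * ξ (y i)) • ContinuousLinearMap.apply ℝ ℝ (y i)) ξ := fun i => by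
    have := ((ContinuousLinearMap.apply ℝ ℝ (y i)).hasFDerivAt (x := ξ)).pow 2
    simpa using this
  have h2 := (HasFDerivAt.fun_sum (u := Finset.univ) fun i _ => h1 i).const_mul (1 / 2 : ℝ)
  rw [h2.fderiv]
  simp only [smul_apply, sum_apply, ContinuousLinearMap.apply_apply, smul_eq_mul, map_sum, map_smul,
    Finset.mul_sum]
  exact Finset.sum_congr rfl fun i _ => by ring

theorem fderiv_position {Y : ι → E → E} {x : E} (hY : ∀ i, DifferentiableAt ℝ (Y i) x)
    (ξ : E →L[ℝ] ℝ) (v : E) :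
    fderiv ℝ (fun x => 1 / 2 * ∑ i, (ξ (Y i x)) ^ 2) x v =
      (∑ i, ξ (Y i x) • ξ.comp (fderiv ℝ (Y i) x)) v := by
  have h1 : ∀ i, HasFDerivAt (fun x => (ξ (Y i x)) ^ 2)
      ((2 * ξ (Y i x)) • ξ.comp (fderiv ℝ (Y i) x)) x := fun i => by
    have := (ξ.hasFDerivAt.comp x (hY i).hasFDerivAt).pow 2
    simpa using this
  have h2 := (HasFDerivAt.fun_sum (u := Finset.univ) fun i _ => h1 i).const_mul (1 / 2 : ℝ)
  rw [h2.fderiv]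
  simp only [smul_apply, sum_apply, smul_eq_mul, Finset.mul_sum]
  exact Finset.sum_congr rfl fun i _ => by ring

end HamiltonEquations

/-! ### Normal geodesics: realization in a chart, uniqueness, exponential map. -/

section Extremals

open CorankOneStructure (momCoord posCoord)

variable {k : ℕ} {M : Type*} [TopologicalSpace M] [ChartedSpace (Model k) M]
    [IsManifold 𝓘(ℝ, Model k) ∞ M] {S : CorankOneStructure k M}

theorem chartHamiltonian_eq {U : Set M} {X : Fin k → VField k M} (hX : IsFrameOn S U X) (p : M)
    {x : Model k} (hx : (chart k p).symm x ∈ U) (ξ : Model k →L[ℝ] ℝ) :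
    S.chartHamiltonian p x ξ = 1 / 2 * ∑ i, (ξ (chartVField p (X i) x)) ^ 2 :=
  IsONB.hamiltonian_eq S (hX.onb _ hx) _

/-- In a local orthonormal frame the Hamiltonian is ½ ∑ ξ(X_i)², so its partial derivatives are the
components of `hamField`. -/
theorem hamilton_iff {U : Set M} {X : Fin k → VField k M} (hX : IsFrameOn S U X)
    (hU : IsOpen U) (p : M) {x : Model k} (hx : x ∈ (chart k p).target)
    (hxU : (chart k p).symm x ∈ U) (ξ : Model k →L[ℝ] ℝ) (x' : Model k) (ξ' : Model k →L[ℝ] ℝ) :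
    ((∀ α : Model k →L[ℝ] ℝ, fderiv ℝ (fun ξ => S.chartHamiltonian p x ξ) ξ α = α x') ∧
      (∀ v : Model k, fderiv ℝ (fun x => S.chartHamiltonian p x ξ) x v = -ξ' v)) ↔
    (x', ξ') = hamField (fun i => chartVField p (X i)) (x, ξ) := by
  have hΩ := (isOpen_chart_preimage p hU).mem_nhds ⟨hx, hxU⟩
  have hd : ∀ i, DifferentiableAt ℝ (chartVField p (X i)) x := fun i =>
    ((SmoothVFieldOn.contDiffOn_chart p (hX.smooth i)).contDiffAt hΩ).differentiableAt (by simp)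
  have h1 : (fun ξ => S.chartHamiltonian p x ξ) =
      fun ξ => 1 / 2 * ∑ i, (ξ (chartVField p (X i) x)) ^ 2 :=
    funext fun ξ => chartHamiltonian_eq hX p hxU ξ
  have h2 : (fun x => S.chartHamiltonian p x ξ) =ᶠ[𝓝 x]
      fun x => 1 / 2 * ∑ i, (ξ (chartVField p (X i) x)) ^ 2 := by
    filter_upwards [hΩ] with z hz
    exact chartHamiltonian_eq hX p hz.2 ξ
  rw [h1, h2.fderiv_eq, Prod.ext_iff]
  refine and_congr ?_ ?_
  · simp only [fderiv_momentum, hamField]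
    rw [SeparatingDual.eq_iff_forall_dual_eq (R := ℝ)]
    exact forall_congr' fun α => eq_comm
  · simp only [fderiv_position hd, hamField]
    rw [eq_comm, neg_eq_iff_eq_neg, ContinuousLinearMap.ext_iff]
    exact Iff.rfl

theorem momCoord_eq (p q : M) {z : M} (hp : z ∈ (chart k p).source) (hq : z ∈ (chart k q).source)
    (ξ : Model k →L[ℝ] ℝ) :
    momCoord p (⟨z, ξ.comp (dChart q z)⟩ : CotangentSpace k M) =
      ξ.comp (fderiv ℝ (transition k p q) (chart k p z)) := by
  rw [fderiv_transition p q (mem_transitionDomain p q hp hq)]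
  have h : ∀ z', z' = z → (ξ.comp (dChart q z') : Model k →L[ℝ] ℝ) =
      (ξ.comp (dChart q z) : Model k →L[ℝ] ℝ) := by
    rintro z' rfl
    rfl
  have h2 := h _ ((chart k p).left_inv hp)
  exact congrArg (fun L : Model k →L[ℝ] ℝ => L.comp
    (dChartSymm p (chart k p z) : Model k →L[ℝ] Model k)) h2.symm

theorem momCoord_self (q : M) (l : Cotan k q) : momCoord q (⟨q, l⟩ : CotangentSpace k M) = l :=
  chartForm_self q (fun _ => (l : Model k →L[ℝ] ℝ))

theorem mk_comp_dChart_self (q : M) (l : Cotan k q) {z : M} (hz : z = q) :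
    (⟨z, (show Model k →L[ℝ] ℝ from l).comp (dChart q z)⟩ : CotangentSpace k M) = ⟨q, l⟩ := by
  subst hz
  rw [dChart_self]
  rfl

theorem fderiv_transition_injective (p q : M) {x : Model k} (hx : x ∈ transitionDomain k p q) :
    Function.Injective (fderiv ℝ (transition k p q) x) := by
  rw [fderiv_transition p q hx]
  refine (dChart_injective q hx.2).comp fun v w h => ?_
  exact (dChart_dChartSymm p hx.1 v).symm.trans
    ((congrArg (dChart p _) h).trans (dChart_dChartSymm p hx.1 w))

/-- Fields on the model space that represent a frame near the image of `q`. -/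
structure IsChartFrame (S : CorankOneStructure k M) (q : M) (U : Set M) (X : Fin k → VField k M)
    (B : Set (Model k)) (Y : Fin k → Model k → Model k) : Prop where
  isOpen : IsOpen U
  frame : IsFrameOn S U X
  isOpen_ball : IsOpen B
  subset : B ⊆ (chart k q).target ∩ (chart k q).symm ⁻¹' U
  smooth : ∀ i, ContDiff ℝ ∞ (Y i)
  eqOn : ∀ i, EqOn (Y i) (chartVField q (X i)) B

variable {q : M} {U : Set M} {X : Fin k → VField k M} {B : Set (Model k)}
    {Y : Fin k → Model k → Model k}

theorem IsChartFrame.hamField_eq (h : IsChartFrame S q U X B Y) {x : Model k} (hx : x ∈ B)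
    (ξ : Model k →L[ℝ] ℝ) :
    hamField (fun i => chartVField q (X i)) (x, ξ) = hamField Y (x, ξ) := by
  have h1 : ∀ i, chartVField q (X i) x = Y i x := fun i => (h.eqOn i hx).symm
  have h2 : ∀ i, fderiv ℝ (chartVField q (X i)) x = fderiv ℝ (Y i) x := fun i =>
    ((h.eqOn i).eventuallyEq_of_mem (h.isOpen_ball.mem_nhds hx)).fderiv_eq.symm
  simp only [hamField, h1, h2]

/-- A normal extremal has to satisfy Hamilton's equations in every chart that meets it. The chart at
q gives them by construction, and the other charts follow from `hasDerivWithinAt_hamField_change`.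
-/
theorem IsChartFrame.isNormalExtremal (h : IsChartFrame S q U X B Y) {T : ℝ} (hT : 0 < T)
    {γ : ℝ → Model k × (Model k →L[ℝ] ℝ)} (hγ : IsHamCurve Y T γ)
    (hB : ∀ t ∈ Icc 0 T, (γ t).1 ∈ B) :
    S.IsNormalExtremal T (fun s => ⟨(chart k q).symm (γ s).1,
      (γ s).2.comp (dChart q ((chart k q).symm (γ s).1))⟩) := by
  have hγc : ContinuousOn γ (Icc 0 T) := fun t ht => (hγ t ht).continuousWithinAt
  have hγ1 : ContinuousOn (fun s => (γ s).1) (Icc 0 T) := continuous_fst.comp_continuousOn hγc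
  refine ⟨(continuousOn_extChartAt_symm q).comp hγ1 fun s hs => (h.subset (hB s hs)).1, ?_⟩
  intro p t ht hp
  change (chart k q).symm (γ t).1 ∈ (chart k p).source at hp
  have hBt := hB t ht
  have hxt := (h.subset hBt).1
  have hdom : (γ t).1 ∈ transitionDomain k q p := ⟨hxt, hp⟩
  set y : ℝ → Model k := fun s => transition k q p (γ s).1 with hy_def
  have hyt : y t ∈ transitionDomain k p q :=
    mem_transitionDomain p q hp (chart_symm_map q hxt)
  have hev : ∀ᶠ u in 𝓝[Icc 0 T] t, u ∈ Icc 0 T ∧ (γ u).1 ∈ transitionDomain k q p :=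
    (eventually_mem_nhdsWithin).and
      ((hγ1 t ht).eventually ((isOpen_transitionDomain q p).mem_nhds hdom))
  have hinv : ∀ x ∈ transitionDomain k q p, transition k p q (transition k q p x) = x := by
    intro x hx
    change transition k p q (chart k p ((chart k q).symm x)) = x
    rw [transition_chart p q hx.2, (chart k q).right_inv hx.1]
  have hmom : ∀ x ∈ transitionDomain k q p, ∀ ξ : Model k →L[ℝ] ℝ,
      momCoord p (⟨(chart k q).symm x, ξ.comp (dChart q ((chart k q).symm x))⟩ :
        CotangentSpace k M) = ξ.comp (fderiv ℝ (transition k p q) (transition k q p x)) :=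
    fun x hx ξ => momCoord_eq p q hx.2 (chart_symm_map q hx.1) ξ
  have hF : HasFDerivAt (transition k q p) (fderiv ℝ (transition k q p) (γ t).1) (γ t).1 :=
    (((contDiffOn_transition q p).contDiffAt ((isOpen_transitionDomain q p).mem_nhds hdom)
      ).differentiableAt (by simp)).hasFDerivAt
  have hy : HasDerivWithinAt y (fderiv ℝ (transition k q p) (γ t).1 (hamField Y (γ t)).1)
      (Icc 0 T) t := by
    have h1 := HasFDerivAt.comp_hasDerivWithinAt (f := fun u => (γ u).1) t hF
      (hasDerivWithinAt_fst (hγ t ht))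
    exact h1
  have hψ := (contDiffOn_transition p q).contDiffAt ((isOpen_transitionDomain p q).mem_nhds hyt)
  have hψt : transition k p q (y t) = (γ t).1 := hinv _ hdom
  have hUp : (chart k p).symm (y t) ∈ U := by
    have : (chart k p).symm (y t) = (chart k q).symm (γ t).1 := (chart k p).left_inv hp
    rw [this]
    exact (h.subset hBt).2
  have key := hasDerivWithinAt_hamField_change (X := Y) (Y := fun i => chartVField p (X i))
    (uniqueDiffOn_Icc hT t ht) (hγ t ht) hy (hψ.of_le (by norm_cast)) (by
      filter_upwards [hev] with u hu
      exact hinv _ hu.2) hψt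
    (fderiv_transition_injective p q hyt)
    (fun i => (h.smooth i).differentiable (by simp) _)
    (fun i => ((SmoothVFieldOn.contDiffOn_chart p (h.frame.smooth i)).contDiffAt
      ((isOpen_chart_preimage p h.isOpen).mem_nhds ⟨hyt.1, hUp⟩)).differentiableAt (by simp))
    (fun i => by
      have hB' : ∀ᶠ z in 𝓝 (y t), transition k p q z ∈ B :=
        hψ.continuousAt.eventually (h.isOpen_ball.mem_nhds (by rwa [hψt]))
      filter_upwards [hB', (isOpen_transitionDomain p q).mem_nhds hyt] with z hz hz2
      rw [fderiv_transition_chartVField p q hz2, h.eqOn i hz])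
  refine ⟨_, _, hasDerivWithinAt_fst key, (hasDerivWithinAt_snd key).congr_of_eventuallyEq ?_ ?_, ?_⟩
  · filter_upwards [hev] with u hu
    exact hmom _ hu.2 _
  · exact hmom _ hdom _
  · have h1 := (hamilton_iff h.frame h.isOpen p hyt.1 hUp
      ((γ t).2.comp (fderiv ℝ (transition k p q) (y t))) _ _).2 rfl
    have h2 := hmom _ hdom (γ t).2
    change momCoord p _ = (γ t).2.comp (fderiv ℝ (transition k p q) (y t)) at h2
    dsimp only
    rw [h2]
    exact h1

/-- `expMap` selects an arbitrary normal extremal, so uniqueness is needed. The times of agreement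
form a closed set, as M is Hausdorff, and agreement propagates to the right by local uniqueness for
the differential equation. -/
theorem IsChartFrame.base_eq [T2Space M] (h : IsChartFrame S q U X B Y) {T : ℝ}
    {γ : ℝ → Model k × (Model k →L[ℝ] ℝ)} (hγ : IsHamCurve Y T γ)
    (hB : ∀ t ∈ Icc 0 T, (γ t).1 ∈ B) {l : Cotan k q} (hγ0 : γ 0 = (chart k q q, l))
    {c : ℝ → CotangentSpace k M} (hc : S.IsNormalExtremal T c) (hc0 : c 0 = ⟨q, l⟩) :
    ∀ t ∈ Icc 0 T, (c t).1 = (chart k q).symm (γ t).1 := by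
  intro t₀ ht₀
  have hT : 0 ≤ T := ht₀.1.trans ht₀.2
  have hγc : ContinuousOn γ (Icc 0 T) := fun t ht => (hγ t ht).continuousWithinAt
  have hγ1 : ContinuousOn (fun s => (γ s).1) (Icc 0 T) := continuous_fst.comp_continuousOn hγc
  set y : ℝ → Model k × (Model k →L[ℝ] ℝ) := fun s => (posCoord q (c s), momCoord q (c s))
  have hycont : ∀ t ∈ Icc 0 T, (c t).1 ∈ (chart k q).source →
      ContinuousWithinAt y (Icc 0 T) t := by
    intro t ht hs
    obtain ⟨x', ξ', h1, h2, -⟩ := hc.2 q t ht hs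
    exact (h1.continuousWithinAt).prodMk h2.continuousWithinAt
  have hy : ∀ t ∈ Icc 0 T, (c t).1 ∈ (chart k q).source → (y t).1 ∈ B →
      HasDerivWithinAt y (hamField Y (y t)) (Icc 0 T) t := by
    intro t ht hs hBt
    obtain ⟨x', ξ', h1, h2, h3⟩ := hc.2 q t ht hs
    have h4 := (hamilton_iff h.frame h.isOpen q (h.subset hBt).1 (h.subset hBt).2 _ _ _).1 h3
    rw [h.hamField_eq hBt] at h4
    have h5 : HasDerivWithinAt y (x', ξ') (Icc 0 T) t := h1.prodMk h2
    rwa [h4] at h5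
  -- Base points are compared in M as well, since equal coordinates say nothing once the extremal is
  -- outside the domain of the chart.
  let A : Set ℝ := {t | (c t).1 = (chart k q).symm (γ t).1 ∧ y t = γ t}
  have hclosed : IsClosed (A ∩ Icc 0 T) := by
    refine isClosed_of_closure_subset fun t ht => ?_
    have htI : t ∈ Icc 0 T := isClosed_Icc.closure_subset_iff.2 inter_subset_right ht
    have hne := mem_closure_iff_nhdsWithin_neBot.1 ht
    have hle : 𝓝[A ∩ Icc 0 T] t ≤ 𝓝[Icc 0 T] t := nhdsWithin_mono _ inter_subset_right
    have e1 : (c t).1 = (chart k q).symm (γ t).1 := by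
      have h1 := (hc.1 t htI).mono_left hle
      have h2 : Tendsto (fun s => (chart k q).symm (γ s).1) (𝓝[A ∩ Icc 0 T] t)
          (𝓝 ((chart k q).symm (γ t).1)) :=
        (((continuousOn_extChartAt_symm q).comp hγ1
          fun s hs => (h.subset (hB s hs)).1) t htI).mono_left hle
      refine tendsto_nhds_unique_of_eventuallyEq h1 h2 ?_
      filter_upwards [self_mem_nhdsWithin] with s hs
      exact hs.1.1
    refine ⟨⟨e1, ?_⟩, htI⟩
    have hs : (c t).1 ∈ (chart k q).source := by
      rw [e1]
      exact chart_symm_map q (h.subset (hB t htI)).1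
    refine tendsto_nhds_unique_of_eventuallyEq ((hycont t htI hs).mono_left hle)
      ((hγc t htI).mono_left hle) ?_
    filter_upwards [self_mem_nhdsWithin] with s hs
    exact hs.1.2
  have h0 : (0 : ℝ) ∈ A := by
    refine ⟨?_, ?_⟩
    · rw [hc0, hγ0, chart_symm_self]
    · change (posCoord q (c 0), momCoord q (c 0)) = γ 0
      rw [hc0, hγ0, momCoord_self]
      rfl
  have hsub := hclosed.Icc_subset_of_forall_mem_nhdsWithin h0 fun t ht => by
    obtain ⟨⟨e1, e2⟩, htI⟩ := ht
    have htI' := Ico_subset_Icc_self htI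
    have hBt := hB t htI'
    have hs : (c t).1 ∈ (chart k q).source := by
      rw [e1]
      exact chart_symm_map q (h.subset hBt).1
    -- The field is only locally Lipschitz; both curves stay in the neighbourhood `N` for a short
    -- time after t.
    obtain ⟨K, N, hN, hK⟩ := ((contDiff_hamField h.smooth).contDiffAt (x := γ t)
      ).exists_lipschitzOnWith
    have hyt := hycont t htI' hs
    have ev : ∀ᶠ u in 𝓝[Icc 0 T] t, ((c u).1 ∈ (chart k q).source ∧ (y u).1 ∈ B ∧ y u ∈ N ∧
        γ u ∈ N) := by
      refine ((hc.1 t htI').eventually ((isOpen_extChartAt_source q).mem_nhds hs)).and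
        (((continuous_fst.continuousAt.comp_continuousWithinAt hyt).eventually
          (h.isOpen_ball.mem_nhds (by rw [Function.comp_apply, e2]; exact hBt))).and
        ((hyt.eventually (by rw [e2]; exact hN)).and ((hγc t htI').eventually hN)))
    have ev2 : ∀ᶠ u in 𝓝[≥] t, u ∈ Icc 0 T ∧ ((c u).1 ∈ (chart k q).source ∧ (y u).1 ∈ B ∧
        y u ∈ N ∧ γ u ∈ N) := by
      have hmem : Icc 0 T ∈ 𝓝[≥] t := Icc_mem_nhdsGE_of_mem htI
      refine (eventually_of_mem hmem fun u hu => hu).and ?_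
      exact ev.filter_mono (nhdsWithin_le_iff.2 hmem)
    obtain ⟨u, hu, hsu⟩ := mem_nhdsGE_iff_exists_Icc_subset.1 ev2
    have hder : ∀ f : ℝ → Model k × (Model k →L[ℝ] ℝ),
        (∀ s ∈ Icc t u, HasDerivWithinAt f (hamField Y (f s)) (Icc 0 T) s) →
        ContinuousOn f (Icc t u) ∧
          ∀ s ∈ Ico t u, HasDerivWithinAt f (hamField Y (f s)) (Ici s) s := by
      intro f hf
      refine ⟨fun s hs => ((hf s hs).mono fun r hr => (hsu hr).1).continuousWithinAt,
        fun s hs => ?_⟩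
      have := (hf s (Ico_subset_Icc_self hs)).mono (fun r hr => (hsu hr).1 : Icc t u ⊆ Icc 0 T)
      exact this.mono_of_mem_nhdsWithin (Icc_mem_nhdsGE_of_mem hs)
    have hd1 := hder y fun s hs => hy s (hsu hs).1 (hsu hs).2.1 (hsu hs).2.2.1
    have hd2 := hder γ fun s hs => hγ s (hsu hs).1
    have heq := ODE_solution_unique_of_mem_Icc_right (v := fun _ => hamField Y) (s := fun _ => N)
      (fun _ _ => hK) hd1.1 hd1.2 (fun s hs => (hsu (Ico_subset_Icc_self hs)).2.2.2.1) hd2.1 hd2.2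
      (fun s hs => (hsu (Ico_subset_Icc_self hs)).2.2.2.2) e2
    refine mem_of_superset (Ioc_mem_nhdsGT hu) fun s hs => ?_
    have hs' := Ioc_subset_Icc_self hs
    refine ⟨?_, heq hs'⟩
    have e3 : chart k q (c s).1 = (γ s).1 := congrArg Prod.fst (heq hs')
    rw [← e3, (chart k q).left_inv (hsu hs').2.1]
  exact (hsub ht₀).1

theorem IsChartFrame.expMap_eq [T2Space M] (h : IsChartFrame S q U X B Y) {T : ℝ} (hT : 0 < T)
    {γ : ℝ → Model k × (Model k →L[ℝ] ℝ)} (hγ : IsHamCurve Y T γ)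
    (hB : ∀ t ∈ Icc 0 T, (γ t).1 ∈ B) {l : Cotan k q} (hγ0 : γ 0 = (chart k q q, l)) :
    S.expMap q T l = (chart k q).symm (γ T).1 := by
  have hex : ∃ c : ℝ → CotangentSpace k M, S.IsNormalExtremal T c ∧ c 0 = ⟨q, l⟩ := by
    refine ⟨_, h.isNormalExtremal hT hγ hB, ?_⟩
    have key : ∀ y : Model k × (Model k →L[ℝ] ℝ), y = (chart k q q, (l : Model k →L[ℝ] ℝ)) →
        (⟨(chart k q).symm y.1, y.2.comp (dChart q ((chart k q).symm y.1))⟩ :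
          CotangentSpace k M) = ⟨q, l⟩ := by
      rintro _ rfl
      exact mk_comp_dChart_self q l (chart_symm_self q)
    exact key _ hγ0
  rw [CorankOneStructure.expMap, dif_pos hex]
  exact h.base_eq hγ hB hγ0 hex.choose_spec.1 hex.choose_spec.2 T ⟨hT.le, le_rfl⟩

end Extremals

/-! ### Averages along Hamiltonian flows -/

section Averages

variable {E : Type*} [NormedAddCommGroup E] [NormedSpace ℝ E] [FiniteDimensional ℝ E]
    {ι : Type*} [Fintype ι]

/-- In finite dimension the operator norm is bounded by a multiple of the sum of the values on a
basis. -/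
theorem integrable_norm_of_eval [MeasurableSpace (E →L[ℝ] ℝ)] [BorelSpace (E →L[ℝ] ℝ)]
    {μ : Measure (E →L[ℝ] ℝ)} (h : ∀ w : E, Integrable (fun ξ : E →L[ℝ] ℝ => ξ w) μ) :
    Integrable (fun ξ : E →L[ℝ] ℝ => ‖ξ‖) μ := by
  let b := Module.finBasis ℝ E
  obtain ⟨C, hC, hb⟩ := b.exists_opNorm_le (F := ℝ)
  refine Integrable.mono' (g := fun ξ : E →L[ℝ] ℝ => C * ∑ i, ‖ξ (b i)‖)
    ((integrable_finsetSum _ fun i _ => (h (b i)).norm).const_mul C)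
    continuous_norm.aestronglyMeasurable (Eventually.of_forall fun ξ => ?_)
  rw [norm_norm]
  exact hb (Finset.sum_nonneg fun i _ => norm_nonneg _) fun i =>
    Finset.single_le_sum (f := fun i => ‖ξ (b i)‖) (fun i _ => norm_nonneg _) (Finset.mem_univ i)

variable {X : ι → E → E} {x₀ : E} {γ : (E →L[ℝ] ℝ) → ℝ → E × (E →L[ℝ] ℝ)}

/-- Integral curves of `hamField X` on `[0, 1]`, one for each covector of unit length at `x₀`. -/
def IsHamFlow (X : ι → E → E) (x₀ : E) (γ : (E →L[ℝ] ℝ) → ℝ → E × (E →L[ℝ] ℝ)) : Prop :=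
  ∀ ξ : E →L[ℝ] ℝ, ∑ i, (ξ (X i x₀)) ^ 2 = 1 → γ ξ 0 = (x₀, ξ) ∧ IsHamCurve X 1 (γ ξ)

theorem exists_isHamFlow (hX : ∀ i, ContDiff ℝ ∞ (X i)) (hc : ∀ i, HasCompactSupport (X i))
    (x₀ : E) : ∃ γ, IsHamFlow X x₀ γ := by
  have h : ∀ ξ : E →L[ℝ] ℝ, ∃ γ : ℝ → E × (E →L[ℝ] ℝ), ∑ i, (ξ (X i x₀)) ^ 2 = 1 →
      γ 0 = (x₀, ξ) ∧ IsHamCurve X 1 γ := by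
    intro ξ
    by_cases h : ∑ i, (ξ (X i x₀)) ^ 2 = 1
    · obtain ⟨γ, h1, h2⟩ := exists_isHamCurve hX hc zero_le_one (y₀ := (x₀, ξ)) h.le
      exact ⟨γ, fun _ => ⟨h1, h2⟩⟩
    · exact ⟨fun _ => 0, fun h' => absurd h' h⟩
  choose γ hγ using h
  exact ⟨γ, hγ⟩

theorem IsHamFlow.bounds (h : IsHamFlow X x₀ γ) (hX : ∀ i, ContDiff ℝ ∞ (X i)) {B : ℝ}
    (hB0 : 0 ≤ B) (hB : ∀ i x, ‖X i x‖ ≤ B ∧ ‖fderiv ℝ (X i) x‖ ≤ B) {ξ : E →L[ℝ] ℝ}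
    (hξ : ∑ i, (ξ (X i x₀)) ^ 2 = 1) {t : ℝ} (ht : t ∈ Icc (0 : ℝ) 1) :
    ‖(γ ξ t).1 - x₀‖ ≤ Fintype.card ι * B * t ∧
      ‖(γ ξ t).2‖ ≤ ‖ξ‖ * Real.exp (Fintype.card ι * B) := by
  obtain ⟨h0, hγ⟩ := h ξ hξ
  have h1 := hγ.bounds hX hB (by rw [h0]; exact hξ.le) t ht
  rw [h0] at h1
  refine ⟨h1.1, h1.2.trans (mul_le_mul_of_nonneg_left (Real.exp_le_exp.2 ?_) (norm_nonneg _))⟩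
  exact mul_le_of_le_one_right (by positivity) ht.2

/-- Its role is measurability in ξ: the curves were chosen covector by covector. -/
theorem IsHamFlow.continuousOn (h : IsHamFlow X x₀ γ) (hX : ∀ i, ContDiff ℝ ∞ (X i))
    (hc : ∀ i, HasCompactSupport (X i)) {t : ℝ} (ht : t ∈ Icc (0 : ℝ) 1) :
    ContinuousOn (fun ξ => γ ξ t) {ξ : E →L[ℝ] ℝ | ∑ i, (ξ (X i x₀)) ^ 2 = 1} := by
  obtain ⟨B, hB0, hB⟩ := exists_bound_fields hX hc
  intro ξ hξ
  -- This radius bounds the momenta of all curves whose initial covector is within distance 1 of ξ.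
  obtain ⟨K, hK⟩ := IsHamCurve.dist_le hX hc ((‖ξ‖ + 1) * Real.exp (Fintype.card ι * B))
  have hb : ∀ ξ' : E →L[ℝ] ℝ, ∑ i, (ξ' (X i x₀)) ^ 2 = 1 → ‖ξ'‖ ≤ ‖ξ‖ + 1 →
      ∀ s ∈ Icc (0 : ℝ) 1, ‖(γ ξ' s).2‖ ≤ (‖ξ‖ + 1) * Real.exp (Fintype.card ι * B) :=
    fun ξ' hξ' hle s hs => (h.bounds hX hB0 hB hξ' hs).2.trans
      (mul_le_mul_of_nonneg_right hle (Real.exp_pos _).le)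
  change Tendsto _ _ _
  rw [tendsto_iff_dist_tendsto_zero]
  have hlim : Tendsto (fun ξ' : E →L[ℝ] ℝ => dist ξ' ξ * Real.exp (K * t))
      (𝓝[{ξ : E →L[ℝ] ℝ | ∑ i, (ξ (X i x₀)) ^ 2 = 1}] ξ) (𝓝 0) := by
    have h1 : Tendsto (fun ξ' : E →L[ℝ] ℝ => dist ξ' ξ * Real.exp (K * t)) (𝓝 ξ)
        (𝓝 (dist ξ ξ * Real.exp (K * t))) :=
      ((continuous_id.dist continuous_const).mul continuous_const).tendsto ξ
    rw [dist_self, zero_mul] at h1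
    exact h1.mono_left nhdsWithin_le_nhds
  refine squeeze_zero' (Eventually.of_forall fun _ => dist_nonneg) ?_ hlim
  filter_upwards [self_mem_nhdsWithin, mem_nhdsWithin_of_mem_nhds (Metric.ball_mem_nhds ξ one_pos)]
    with ξ' hξ' hball
  have hn : ‖ξ'‖ ≤ ‖ξ‖ + 1 := by
    have h1 := norm_le_norm_add_norm_sub' ξ' ξ
    rw [Metric.mem_ball, dist_eq_norm] at hball
    linarith
  have h1 := hK 1 (γ ξ') (γ ξ) (h ξ' hξ').2 (h ξ hξ).2 (hb ξ' hξ' hn)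
    (hb ξ hξ (by linarith)) t ht
  rw [(h ξ' hξ').1, (h ξ hξ).1] at h1
  refine h1.trans (le_of_eq ?_)
  rw [Prod.dist_eq, dist_self, max_eq_right dist_nonneg]

variable [MeasurableSpace (E →L[ℝ] ℝ)] [BorelSpace (E →L[ℝ] ℝ)] {μ : Measure (E →L[ℝ] ℝ)}
    [IsProbabilityMeasure μ]

theorem IsHamFlow.aestronglyMeasurable (h : IsHamFlow X x₀ γ) (hX : ∀ i, ContDiff ℝ ∞ (X i))
    (hc : ∀ i, HasCompactSupport (X i)) (hμ : ∀ᵐ ξ ∂μ, ∑ i, (ξ (X i x₀)) ^ 2 = 1)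
    {f : E → ℝ} (hf : Continuous f) {t : ℝ} (ht : t ∈ Icc (0 : ℝ) 1) :
    AEStronglyMeasurable (fun ξ => f (γ ξ t).1) μ := by
  have hm : MeasurableSet {ξ : E →L[ℝ] ℝ | ∑ i, (ξ (X i x₀)) ^ 2 = 1} :=
    (isClosed_eq (by fun_prop) continuous_const).measurableSet
  have h1 := (hf.comp_continuousOn (continuous_fst.comp_continuousOn
    (h.continuousOn hX hc ht))).aestronglyMeasurable (μ := μ) hm
  have h3 : μ.restrict {ξ : E →L[ℝ] ℝ | ∑ i, (ξ (X i x₀)) ^ 2 = 1} = μ :=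
    Measure.restrict_eq_self_of_ae_mem hμ
  rwa [h3] at h1

/-- The second order asymptotics of averages over the Hamiltonian flow. -/
theorem IsHamFlow.tendsto_integral (h : IsHamFlow X x₀ γ) (hX : ∀ i, ContDiff ℝ ∞ (X i))
    (hc : ∀ i, HasCompactSupport (X i)) (hμ : ∀ᵐ ξ ∂μ, ∑ i, (ξ (X i x₀)) ^ 2 = 1)
    (h2 : ∀ w : E, MemLp (fun ξ : E →L[ℝ] ℝ => ξ w) 2 μ) (h0 : ∀ i, ∫ ξ, ξ (X i x₀) ∂μ = 0)
    {f : E → ℝ} (hf : ContDiff ℝ ∞ f) (hfc : HasCompactSupport f) :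
    Tendsto (fun t : ℝ => 1 / t ^ 2 * ∫ ξ, (f (γ ξ t).1 - f x₀) ∂μ) (𝓝[>] 0)
      (𝓝 (1 / 2 * ∫ ξ, hamSecond X (fun i x => fderiv ℝ f x (X i x)) (x₀, ξ) ∂μ)) := by
  set a : ι → E → ℝ := fun i x => fderiv ℝ f x (X i x) with ha_def
  have hint : ∀ w : E, Integrable (fun ξ : E →L[ℝ] ℝ => ξ w) μ := fun w =>
    (h2 w).integrable (by norm_num)
  have ha : ∀ i, ContDiff ℝ ∞ (a i) := fun i =>
    (hf.fderiv_right (m := ∞) (by simp)).clm_apply (hX i)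
  have hac : ∀ i, HasCompactSupport (a i) := fun i => by
    refine (hfc.fderiv (𝕜 := ℝ)).mono fun x hx => ?_
    rw [Function.mem_support] at hx ⊢
    intro h'
    apply hx
    rw [ha_def]
    simp [h']
  obtain ⟨B, hB0, hB⟩ := exists_bound_fields hX hc
  obtain ⟨A, hA0, hA⟩ := exists_bound_fields ha hac
  obtain ⟨Cf, hCf⟩ := hfc.exists_bound_of_continuous hf.continuous
  have hφ : ∀ ξ : E →L[ℝ] ℝ, ∑ i, (ξ (X i x₀)) ^ 2 = 1 → ∀ t ∈ Icc (0 : ℝ) 1,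
      HasDerivWithinAt (fun u => f (γ ξ u).1) (∑ i, (γ ξ t).2 (X i (γ ξ t).1) * a i (γ ξ t).1)
        (Icc 0 1) t := fun ξ hξ t ht =>
    hasDerivWithinAt_comp_fst ((h ξ hξ).2 t ht) (hf.differentiable (by simp) _)
  have hu : ∀ ξ : E →L[ℝ] ℝ, ∑ i, (ξ (X i x₀)) ^ 2 = 1 → ∀ t ∈ Icc (0 : ℝ) 1,
      HasDerivWithinAt (fun u => ∑ i, (γ ξ u).2 (X i (γ ξ u).1) * a i (γ ξ u).1)
        (hamSecond X a (γ ξ t)) (Icc 0 1) t := fun ξ hξ t ht =>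
    hasDerivWithinAt_hamSecond ((h ξ hξ).2 t ht) (fun i => (hX i).differentiable (by simp))
      (fun i => (ha i).differentiable (by simp))
  set e := Real.exp (Fintype.card ι * B)
  have he : 0 < e := Real.exp_pos _
  set n : ℝ := (Fintype.card ι : ℝ)
  have hn : 0 ≤ n := Nat.cast_nonneg _
  -- The dominating function is affine in ‖ξ‖, so integrability of the linear functions is enough.
  set C : (E →L[ℝ] ℝ) → ℝ := fun ξ => n * (n * (‖ξ‖ * e * (2 * B ^ 2)) * A + n * (A * B)) with hC
  have hbound : ∀ ξ : E →L[ℝ] ℝ, ∑ i, (ξ (X i x₀)) ^ 2 = 1 → ∀ t ∈ Icc (0 : ℝ) 1,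
      |hamSecond X a (γ ξ t)| ≤ C ξ := by
    intro ξ hξ t ht
    have h1 : ∑ i, ((γ ξ t).2 (X i (γ ξ t).1)) ^ 2 ≤ 1 := by
      rw [(h ξ hξ).2.sum_sq_eq hX t ht, (h ξ hξ).1]
      exact hξ.le
    refine (abs_hamSecond_le hA0 hB hA h1).trans ?_
    have h3 := (h.bounds hX hB0 hB hξ ht).2
    simp only [hC]
    gcongr
  have hCint : Integrable C μ :=
    ((((((integrable_norm_of_eval hint).mul_const e).mul_const (2 * B ^ 2)).const_mul n).mul_const
      A).add (integrable_const _)).const_mul n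
  set F : ℝ → (E →L[ℝ] ℝ) → ℝ := fun t ξ =>
    (f (γ ξ t).1 - f x₀ - t * ∑ i, ξ (X i x₀) * a i x₀) / t ^ 2 with hF
  have hsum_int : Integrable (fun ξ : E →L[ℝ] ℝ => ∑ i, ξ (X i x₀) * a i x₀) μ :=
    integrable_finsetSum _ fun i _ => (hint _).mul_const _
  have hmeas : ∀ t ∈ Icc (0 : ℝ) 1, AEStronglyMeasurable (fun ξ => f (γ ξ t).1 - f x₀) μ :=
    fun t ht => (h.aestronglyMeasurable hX hc hμ hf.continuous ht).sub aestronglyMeasurable_const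
  have hev : ∀ᶠ t : ℝ in 𝓝[>] 0, t ∈ Ioc (0 : ℝ) 1 := Ioc_mem_nhdsGT one_pos
  have hDCT : Tendsto (fun t => ∫ ξ, F t ξ ∂μ) (𝓝[>] 0)
      (𝓝 (∫ ξ, hamSecond X a (x₀, ξ) / 2 ∂μ)) := by
    refine tendsto_integral_filter_of_dominated_convergence C ?_ ?_ hCint ?_
    · filter_upwards [hev] with t ht
      exact (((hmeas t (Ioc_subset_Icc_self ht)).sub
        (hsum_int.aestronglyMeasurable.const_mul t)).aemeasurable.div_const _).aestronglyMeasurable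
    · filter_upwards [hev] with t ht
      filter_upwards [hμ] with ξ hξ
      have h1 := abs_sub_taylor_le (hφ ξ hξ) (hu ξ hξ) (hbound ξ hξ) (Ioc_subset_Icc_self ht)
      rw [(h ξ hξ).1] at h1
      rw [hF, Real.norm_eq_abs, abs_div, abs_of_pos (pow_pos ht.1 2), div_le_iff₀ (pow_pos ht.1 2)]
      exact h1
    · filter_upwards [hμ] with ξ hξ
      have h1 := tendsto_taylor_two one_pos (hφ ξ hξ) (hu ξ hξ 0 ⟨le_rfl, zero_le_one⟩)
      rw [(h ξ hξ).1] at h1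
      exact h1
  -- The linear Taylor term has mean zero, so it can be subtracted inside the integral without
  -- changing it.
  have hzero : ∫ ξ, (∑ i, ξ (X i x₀) * a i x₀) ∂μ = 0 := by
    rw [integral_finsetSum _ fun i _ => (hint _).mul_const _]
    exact Finset.sum_eq_zero fun i _ => by rw [integral_mul_const, h0 i, zero_mul]
  rw [← integral_const_mul]
  refine (hDCT.congr' ?_).trans_eq ?_
  · filter_upwards [hev] with t ht
    have hb : Integrable (fun ξ => f (γ ξ t).1 - f x₀) μ :=
      Integrable.of_bound (hmeas t (Ioc_subset_Icc_self ht)) (Cf + Cf)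
        (Eventually.of_forall fun ξ => (norm_sub_le _ _).trans (add_le_add (hCf _) (hCf _)))
    simp only [hF]
    rw [integral_div, integral_sub hb (hsum_int.const_mul t), integral_const_mul, hzero]
    ring
  · congr 1
    exact integral_congr_ae (Eventually.of_forall fun ξ => by ring)

theorem integral_hamSecond {a : ι → E → ℝ}
    (h2 : ∀ w : E, MemLp (fun ξ : E →L[ℝ] ℝ => ξ w) 2 μ) {m : ι → E → ℝ}
    (hm : ∀ i w, ∫ ξ, ξ (X i x₀) * ξ w ∂μ = m i w) :
    ∫ ξ, hamSecond X a (x₀, ξ) ∂μ =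
      ∑ i, ((∑ j, m j (VectorField.lieBracket ℝ (X j) (X i) x₀)) * a i x₀ +
        ∑ j, m i (X j x₀) * fderiv ℝ (a i) x₀ (X j x₀)) := by
  have hI : ∀ v w : E, Integrable (fun ξ : E →L[ℝ] ℝ => ξ v * ξ w) μ := fun v w =>
    (h2 v).integrable_mul (h2 w)
  have h1 : ∀ i, Integrable (fun ξ : E →L[ℝ] ℝ =>
      (∑ j, ξ (X j x₀) * ξ (VectorField.lieBracket ℝ (X j) (X i) x₀)) * a i x₀) μ := fun i =>
    (integrable_finsetSum _ fun j _ => hI _ _).mul_const _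
  have h3 : ∀ i, Integrable (fun ξ : E →L[ℝ] ℝ =>
      ∑ j, ξ (X i x₀) * ξ (X j x₀) * fderiv ℝ (a i) x₀ (X j x₀)) μ := fun i =>
    integrable_finsetSum _ fun j _ => (hI _ _).mul_const _
  have h4 : ∀ ξ : E →L[ℝ] ℝ, hamSecond X a (x₀, ξ) = ∑ i,
      ((∑ j, ξ (X j x₀) * ξ (VectorField.lieBracket ℝ (X j) (X i) x₀)) * a i x₀ +
        ∑ j, ξ (X i x₀) * ξ (X j x₀) * fderiv ℝ (a i) x₀ (X j x₀)) := by
    intro ξ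
    simp only [hamSecond, Finset.mul_sum, mul_assoc]
  simp only [h4]
  have h5 : ∀ i, Integrable (fun ξ : E →L[ℝ] ℝ =>
      (∑ j, ξ (X j x₀) * ξ (VectorField.lieBracket ℝ (X j) (X i) x₀)) * a i x₀ +
        ∑ j, ξ (X i x₀) * ξ (X j x₀) * fderiv ℝ (a i) x₀ (X j x₀)) μ := fun i => (h1 i).add (h3 i)
  rw [integral_finsetSum _ fun i _ => h5 i]
  refine Finset.sum_congr rfl fun i _ => ?_
  rw [integral_add (h1 i) (h3 i), integral_mul_const, integral_finsetSum _ fun j _ => hI _ _,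
    integral_finsetSum _ fun j _ => (hI _ _).mul_const _]
  simp only [integral_mul_const, hm]

end Averages

/-! ### The microscopic Laplacian -/

section Micro

variable {k : ℕ} {M : Type*} [TopologicalSpace M] [ChartedSpace (Model k) M]
    [IsManifold 𝓘(ℝ, Model k) ∞ M] {S : CorankOneStructure k M}

/-- The derivative of a function along a vector field, in the chart at `q`. -/
def chartDeriv (q : M) (X : VField k M) (φ : M → ℝ) (x : Model k) : ℝ :=
  fderiv ℝ (φ ∘ (chart k q).symm) x (chartVField q X x)

/-- The value at `q` of the microscopic Laplacian, in terms of a frame that extends the chosen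
orthonormal basis of `D_q`. -/
def microValue (V : S.Complement) (q : M) (X : Fin k → VField k M) (φ : M → ℝ) : ℝ :=
  ∑ i, ((∑ j, V.lift q (S.onb q j)
      (VectorField.lieBracket ℝ (chartVField q (X j)) (chartVField q (X i)) (chart k q q) :
        Model k)) * chartDeriv q (X i) φ (chart k q q) +
    fderiv ℝ (chartDeriv q (X i) φ) (chart k q q) (chartVField q (X i) (chart k q q)))

theorem contDiffOn_smoothFun (φ : CorankOneStructure.SmoothFun k M) (q : M) :
    ContDiffOn ℝ ∞ (φ ∘ (chart k q).symm) (chart k q).target := by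
  have := contDiffOn_chartFun q (U := univ) (contMDiffOn_univ.2 φ.contMDiff)
  rwa [preimage_univ, inter_univ] at this

theorem IsHamCurve.mono {E ι : Type*} [NormedAddCommGroup E] [NormedSpace ℝ E] [Fintype ι]
    {X : ι → E → E} {T T' : ℝ} {γ : ℝ → E × (E →L[ℝ] ℝ)} (h : IsHamCurve X T γ) (hT : T' ≤ T) :
    IsHamCurve X T' γ := fun t ht =>
  (h t ⟨ht.1, ht.2.trans hT⟩).mono (Icc_subset_Icc_right hT)

/-- The frame and the function are replaced by compactly supported data on the model space that
agree with them on a ball, so that the global estimates apply. -/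
theorem exists_isChartFrame {q : M} {U : Set M} {X : Fin k → VField k M} (hU : IsOpen U)
    (hq : q ∈ U) (hX : IsFrameOn S U X) (φ : CorankOneStructure.SmoothFun k M) :
    ∃ (r : ℝ) (Y : Fin k → Model k → Model k) (f : Model k → ℝ), 0 < r ∧
      IsChartFrame S q U X (Metric.ball (chart k q q) r) Y ∧ (∀ i, HasCompactSupport (Y i)) ∧
      ContDiff ℝ ∞ f ∧ HasCompactSupport f ∧
      EqOn f (φ ∘ (chart k q).symm) (Metric.ball (chart k q q) r) := by
  have hΩ := isOpen_chart_preimage (k := k) q hU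
  have hx : chart k q q ∈ (chart k q).target ∩ (chart k q).symm ⁻¹' U :=
    ⟨mem_chart_target q, by rwa [mem_preimage, chart_symm_self]⟩
  choose Y hY hYc hYe using fun i => exists_contDiff_hasCompactSupport_eventuallyEq hΩ
    (SmoothVFieldOn.contDiffOn_chart q (hX.smooth i)) hx
  obtain ⟨f, hf, hfc, hfe⟩ := exists_contDiff_hasCompactSupport_eventuallyEq
    (isOpen_chart_target q) (contDiffOn_smoothFun φ q) (mem_chart_target q)
  have hall : ∀ᶠ x in 𝓝 (chart k q q), (x ∈ (chart k q).target ∩ (chart k q).symm ⁻¹' U) ∧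
      (∀ i, Y i x = chartVField q (X i) x) ∧ f x = (φ ∘ (chart k q).symm) x :=
    (Filter.eventually_of_mem (hΩ.mem_nhds hx) fun _ h => h).and ((eventually_all.2 hYe).and hfe)
  obtain ⟨r, hr, hball⟩ := Metric.eventually_nhds_iff_ball.1 hall
  exact ⟨r, Y, f, hr, ⟨hU, hX, Metric.isOpen_ball, fun x hx => (hball x hx).1, hY,
    fun i x hx => (hball x hx).2.1 i⟩, hYc, hf, hfc, fun x hx => (hball x hx).2.2⟩

/-- For small times the exponential map is the flow in the chart, uniformly over the cylinder. The
limit is the averaged second derivative, and the factor 2k cancels Taylor's 1/2 and the moment 1/k.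
-/
theorem tendsto_micro [T2Space M] [NeZero k] (V : S.Complement) {q : M} {U : Set M}
    {X : Fin k → VField k M} (hU : IsOpen U) (hq : q ∈ U) (hX : IsFrameOn S U X)
    (hXq : ∀ i, X i q = S.onb q i) {ν : Measure (Cotan k q)} [IsProbabilityMeasure ν]
    (hν : ∀ᵐ l ∂ν, ∀ v ∈ S.D q, l v = 0)
    (h2 : ∀ w : Tan k q, MemLp (fun l : Cotan k q => l w) 2 ν)
    (φ : CorankOneStructure.SmoothFun k M) :
    Tendsto (fun t : ℝ => 2 * (k : ℝ) / t ^ 2 *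
        ∫ l, (φ (S.expMap q t l) - φ q) ∂(V.cylMeasure q ν)) (𝓝[>] 0)
      (𝓝 (microValue V q X φ)) := by
  obtain ⟨r, Y, f, hr, hCF, hYc, hf, hfc, hfe⟩ := exists_isChartFrame hU hq hX φ
  set x₀ := chart k q q with hx₀
  have hx₀B : x₀ ∈ Metric.ball x₀ r := Metric.mem_ball_self hr
  have hYx : ∀ i, Y i x₀ = (S.onb q i : Tan k q) := fun i =>
    ((hCF.eqOn i hx₀B).trans (chartVField_self q (X i))).trans (hXq i)
  obtain ⟨γ, hγ⟩ := exists_isHamFlow hCF.smooth hYc x₀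
  obtain ⟨B, hB0, hB⟩ := exists_bound_fields hCF.smooth hYc
  -- The measure on covectors at q is read on the dual of the model space, with the same σ-algebra.
  let _ : MeasurableSpace (Model k →L[ℝ] ℝ) := instMeasurableSpaceCotan q
  have : BorelSpace (Model k →L[ℝ] ℝ) := instBorelSpaceCotan q
  let μ : Measure (Model k →L[ℝ] ℝ) := V.cylMeasure q ν
  have : IsProbabilityMeasure μ := instIsProbabilityMeasureCyl V q ν
  have hμ : ∀ᵐ ξ ∂μ, ∑ i, (ξ (Y i x₀)) ^ 2 = 1 := by
    simp only [hYx]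
    exact ae_cyl V q hν
  have hμ2 : ∀ w : Model k, MemLp (fun ξ : Model k →L[ℝ] ℝ => ξ w) 2 μ := fun w =>
    memLp_cyl V q hν h2 w
  have hμ0 : ∀ i, ∫ ξ, ξ (Y i x₀) ∂μ = 0 := fun i => by
    rw [hYx i]
    exact integral_cyl_onb V q hν i
  have hμm : ∀ i w, ∫ ξ, ξ (Y i x₀) * ξ w ∂μ = 1 / (k : ℝ) * V.lift q (S.onb q i) w :=
    fun i w => by
      rw [hYx i]
      exact integral_cyl_onb_mul V q hν h2 i w
  have hmain := (hγ.tendsto_integral hCF.smooth hYc hμ hμ2 hμ0 hf hfc).const_mul (2 * (k : ℝ))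
  rw [integral_hamSecond hμ2 hμm] at hmain
  have hk : (k : ℝ) ≠ 0 := Nat.cast_ne_zero.2 (NeZero.ne k)
  have hnhds : Metric.ball x₀ r ∈ 𝓝 x₀ := Metric.isOpen_ball.mem_nhds hx₀B
  have hYe : ∀ i, Y i =ᶠ[𝓝 x₀] chartVField q (X i) := fun i =>
    (hCF.eqOn i).eventuallyEq_of_mem hnhds
  have hae : ∀ i, (fun x => fderiv ℝ f x (Y i x)) =ᶠ[𝓝 x₀] chartDeriv q (X i) φ := fun i => by
    filter_upwards [(hfe.eventuallyEq_of_mem hnhds).fderiv (𝕜 := ℝ), hYe i] with x h1 h3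
    rw [chartDeriv, h1, h3]
  have hlift : ∀ i j, V.lift q (S.onb q i) (Y j x₀ : Model k) = if i = j then 1 else 0 :=
    fun i j => by
      rw [hYx j]
      exact (lift_apply_mem V q _ _).trans ((onb_spec q).1 i j)
  have hval : 2 * (k : ℝ) * (1 / 2 * ∑ i, ((∑ j, 1 / (k : ℝ) * V.lift q (S.onb q j)
        (VectorField.lieBracket ℝ (Y j) (Y i) x₀ : Model k)) * fderiv ℝ f x₀ (Y i x₀) +
      ∑ j, 1 / (k : ℝ) * V.lift q (S.onb q i) (Y j x₀ : Model k) *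
        fderiv ℝ (fun x => fderiv ℝ f x (Y i x)) x₀ (Y j x₀))) = microValue V q X φ := by
    rw [← mul_assoc, Finset.mul_sum, microValue]
    refine Finset.sum_congr rfl fun i _ => ?_
    rw [(hae i).fderiv_eq, (hae i).eq_of_nhds, (hYe i).eq_of_nhds.symm]
    have h3 : ∀ j, VectorField.lieBracket ℝ (Y j) (Y i) x₀ =
        VectorField.lieBracket ℝ (chartVField q (X j)) (chartVField q (X i)) x₀ := fun j =>
      Filter.EventuallyEq.lieBracket_vectorField_eq (hYe j) (hYe i)
    simp only [h3, hlift, mul_ite, mul_one, mul_zero, ite_mul, zero_mul, Finset.sum_ite_eq,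
      Finset.mem_univ, if_true]
    rw [← Finset.mul_sum, ← hx₀]
    field_simp
  rw [hval] at hmain
  refine hmain.congr' ?_
  -- Positions move at speed at most k B, so up to time T₀ all the curves remain in the ball where
  -- chart data and cut-off data coincide. The added 1 makes the inequality strict and the
  -- denominator positive.
  set T₀ := min 1 (r / (k * B + 1)) with hT₀
  have hkB : 0 < (k : ℝ) * B + 1 := by positivity
  have hT₀pos : 0 < T₀ := lt_min one_pos (div_pos hr hkB)
  filter_upwards [Ioc_mem_nhdsGT hT₀pos] with t ht
  have ht1 : t ≤ 1 := ht.2.trans (min_le_left _ _)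
  have htr : (k * B + 1) * t ≤ r := by
    rw [mul_comm, ← le_div_iff₀ hkB]
    exact ht.2.trans (min_le_right _ _)
  have hint : ∫ ξ, (f (γ ξ t).1 - f x₀) ∂μ =
      ∫ l, (φ (S.expMap q t l) - φ q) ∂(V.cylMeasure q ν) := by
    refine integral_congr_ae ?_
    filter_upwards [hμ] with ξ hξ
    have hpos : ∀ s ∈ Icc 0 t, (γ ξ s).1 ∈ Metric.ball x₀ r := by
      intro s hs
      have h3 := (hγ.bounds hCF.smooth hB0 hB hξ ⟨hs.1, hs.2.trans ht1⟩).1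
      rw [Fintype.card_fin] at h3
      rw [Metric.mem_ball, dist_eq_norm]
      have h4 : (k : ℝ) * B * s ≤ k * B * t := mul_le_mul_of_nonneg_left hs.2 (by positivity)
      have h5 := ht.1
      linarith
    obtain ⟨h0, hc⟩ := hγ ξ hξ
    have hexp : S.expMap q t ξ = (chart k q).symm (γ ξ t).1 :=
      hCF.expMap_eq ht.1 (hc.mono ht1) hpos h0
    have e1 : f (γ ξ t).1 = φ (S.expMap q t ξ) := by
      rw [hexp]
      exact hfe (hpos t ⟨ht.1.le, le_rfl⟩)
    have e2 : f x₀ = φ q := by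
      rw [hfe hx₀B, Function.comp_apply, hx₀, chart_symm_self]
    rw [e1, e2]
  rw [hint]
  ring

end Micro

/-! ### Existence of adapted measures -/

section Adapted

variable {k : ℕ} {M : Type*} [TopologicalSpace M] [ChartedSpace (Model k) M]
    [IsManifold 𝓘(ℝ, Model k) ∞ M] {S : CorankOneStructure k M}

theorem continuousAt_dChart {X : VField k M} {q : M}
    (hX : ContinuousAt (fun p => (⟨p, X p⟩ : TangentBundle 𝓘(ℝ, Model k) M)) q) :
    ContinuousAt (fun p => dChart q p (X p)) q := by
  have hq : q ∈ (chart k q).source := mem_extChartAt_source (I := 𝓘(ℝ, Model k)) q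
  set e := trivializationAt (Model k) (TangentSpace 𝓘(ℝ, Model k) : M → Type _) q
  have h1 : (⟨q, X q⟩ : TangentBundle 𝓘(ℝ, Model k) M) ∈ e.source := by
    rw [Bundle.Trivialization.mem_source]
    exact FiberBundle.mem_baseSet_trivializationAt' q
  have h2 : ContinuousAt (fun p => (e (⟨p, X p⟩ : TangentBundle 𝓘(ℝ, Model k) M)).2) q :=
    (continuous_snd.continuousAt).comp
      (ContinuousAt.comp (g := e) (e.continuousOn_toFun.continuousAt
        (e.open_source.mem_nhds h1)) hX)
  refine h2.congr ?_
  filter_upwards [(isOpen_extChartAt_source q).mem_nhds hq] with p hp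
  exact trivializationAt_snd q hp _

theorem SmoothVFieldOn.continuousAt {X : VField k M} {U : Set M} (hX : SmoothVFieldOn X U)
    (hU : IsOpen U) {q : M} (hq : q ∈ U) :
    ContinuousAt (fun p => (⟨p, X p⟩ : TangentBundle 𝓘(ℝ, Model k) M)) q :=
  (ContMDiffOn.continuousOn hX).continuousAt (hU.mem_nhds hq)

variable (V : S.Complement)

/-- The right-hand side does not mention the basis, so the arbitrary bases `S.onb` can be exchanged
for a continuous frame. -/
theorem sum_lift_sq (q : M) {X : Fin k → S.D q} (hX : IsONB (S.g q) X) (w : Tan k q) :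
    ∑ j, (V.lift q (X j) w) ^ 2 =
      S.g q (Submodule.projectionOnto (S.D q) (V.V q) (V.isCompl q) w)
        (Submodule.projectionOnto (S.D q) (V.V q) (V.isCompl q) w) := by
  rw [IsONB.g_eq S hX]
  exact Finset.sum_congr rfl fun j _ => pow_two _

/-- The linear map with columns `X_1, …, X_k, X₀`, in the chart at `q`. -/
def columns (q : M) (X : Fin k → VField k M) (X₀ : VField k M) (p : M) :
    ((Fin k → ℝ) × ℝ) →L[ℝ] Model k :=
  ∑ i, ((ContinuousLinearMap.proj i).comp (ContinuousLinearMap.fst ℝ (Fin k → ℝ) ℝ)).smulRight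
    (dChart q p (X i p)) + (ContinuousLinearMap.snd ℝ (Fin k → ℝ) ℝ).smulRight (dChart q p (X₀ p))

theorem columns_apply (q : M) (X : Fin k → VField k M) (X₀ : VField k M) (p : M)
    (c : (Fin k → ℝ) × ℝ) :
    columns q X X₀ p c = dChart q p (∑ i, c.1 i • X i p + c.2 • X₀ p) := by
  simp only [columns, add_apply, sum_apply, ContinuousLinearMap.smulRight_apply,
    ContinuousLinearMap.comp_apply, map_add, map_sum, map_smul]
  rfl

theorem exists_columns_eq (q : M) {X : Fin k → VField k M} {X₀ : VField k M} {p : M}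
    (hm : ∀ i, X i p ∈ S.D p) (hX : IsONB (S.g p) (fun i => ⟨X i p, hm i⟩))
    (hV : V.V p = Submodule.span ℝ {X₀ p}) (w : Tan k p) :
    ∃ c₀ : ℝ, columns q X X₀ p (fun i => V.lift p ⟨X i p, hm i⟩ w, c₀) = dChart q p w := by
  obtain ⟨c₀, hc₀⟩ : ∃ c₀ : ℝ, c₀ • X₀ p =
      w - (Submodule.projectionOnto (S.D p) (V.V p) (V.isCompl p) w : Tan k p) := by
    rw [← Submodule.mem_span_singleton, ← hV,
      ← Submodule.projectionOnto_apply_eq_zero_iff (V.isCompl p), map_sub,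
      Submodule.projectionOnto_apply_left, sub_self]
  refine ⟨c₀, ?_⟩
  rw [columns_apply]
  have h1 := congrArg Subtype.val (IsONB.expand S hX
    (Submodule.projectionOnto (S.D p) (V.V p) (V.isCompl p) w))
  have h3 : ∑ i, V.lift p ⟨X i p, hm i⟩ w • X i p =
      (Submodule.projectionOnto (S.D p) (V.V p) (V.isCompl p) w : Tan k p) := by
    rw [h1, Submodule.coe_sum]
    rfl
  change dChart q p (∑ i, V.lift p ⟨X i p, hm i⟩ w • X i p + c₀ • X₀ p) = _
  rw [h3, hc₀, add_sub_cancel]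

theorem isInvertible_columns (q : M) {X : Fin k → VField k M} {X₀ : VField k M} {p : M}
    (hp : p ∈ (chart k q).source)
    (hm : ∀ i, X i p ∈ S.D p) (hX : IsONB (S.g p) (fun i => ⟨X i p, hm i⟩))
    (hV : V.V p = Submodule.span ℝ {X₀ p}) : (columns q X X₀ p).IsInvertible := by
  have hs : Function.Surjective (columns q X X₀ p).toLinearMap := by
    intro v
    obtain ⟨c₀, h⟩ := exists_columns_eq V q hm hX hV ((dChart (k := k) q p).inverse v)
    exact ⟨_, h.trans (dChart_inverse_apply q hp v)⟩
  have hi := (LinearMap.injective_iff_surjective_of_finrank_eq_finrank (by simp)).2 hs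
  exact ⟨(LinearEquiv.ofBijective _ ⟨hi, hs⟩).toContinuousLinearEquiv, by ext <;> rfl⟩

/-- The components in the frame X_1, …, X_k, X_0 are obtained by inverting `columns`, and inversion
is continuous at an invertible map. -/
theorem continuous_sum_lift_sq {X : VField k M}
    (hX : Continuous (fun q => (⟨q, X q⟩ : TangentBundle 𝓘(ℝ, Model k) M))) :
    Continuous fun q => ∑ j, (V.lift q (S.onb q j) (X q)) ^ 2 := by
  rw [continuous_iff_continuousAt]
  intro q
  obtain ⟨U, F, hU, hqU, hF, -⟩ := exists_frame S q
  obtain ⟨U₀, hU₀, hqU₀, X₀, hX₀, hV⟩ := V.smooth q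
  have hq : q ∈ (chart k q).source := mem_extChartAt_source (I := 𝓘(ℝ, Model k)) q
  have hc : ContinuousAt (columns q F X₀) q := by
    refine ContinuousAt.add (tendsto_finsetSum _ fun i _ => ?_) ?_
    · exact ((ContinuousLinearMap.smulRightL ℝ ((Fin k → ℝ) × ℝ) (Model k) _).continuous.continuousAt
        ).comp (continuousAt_dChart (SmoothVFieldOn.continuousAt (hF.smooth i) hU hqU))
    · exact ((ContinuousLinearMap.smulRightL ℝ ((Fin k → ℝ) × ℝ) (Model k) _).continuous.continuousAt
        ).comp (continuousAt_dChart (SmoothVFieldOn.continuousAt hX₀ hU₀ hqU₀))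
  obtain ⟨e, he⟩ := isInvertible_columns V q hq (hF.mem q hqU) (hF.onb q hqU) (hV q hqU₀)
  have hinv : ContinuousAt ContinuousLinearMap.inverse (columns q F X₀ q) := by
    rw [← he]
    exact (contDiffAt_map_inverse (n := 1) e).continuousAt
  have h1 : ContinuousAt (fun p => (columns q F X₀ p).inverse (dChart q p (X p))) q :=
    (hinv.comp hc).clm_apply (continuousAt_dChart hX.continuousAt)
  have h2 : ContinuousAt (fun p => ∑ i,
      (((columns q F X₀ p).inverse (dChart q p (X p))).1 i) ^ 2) q :=
    tendsto_finsetSum _ fun i _ =>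
      (((continuous_apply i).continuousAt.comp (continuous_fst.continuousAt.comp h1)).pow 2)
  refine h2.congr ?_
  filter_upwards [hU.mem_nhds hqU, hU₀.mem_nhds hqU₀, (isOpen_extChartAt_source q).mem_nhds hq]
    with p hpU hpU₀ hp
  obtain ⟨c₀, h3⟩ := exists_columns_eq V q (hF.mem p hpU) (hF.onb p hpU) (hV p hpU₀) (X p)
  obtain ⟨e', he'⟩ := isInvertible_columns V q hp (hF.mem p hpU) (hF.onb p hpU) (hV p hpU₀)
  rw [sum_lift_sq V p (onb_spec p), ← sum_lift_sq V p (hF.onb p hpU), ← h3, ← he',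
    ContinuousLinearMap.inverse_equiv]
  simp

/-- The vertical measure is taken to be the Dirac mass at 0. -/
theorem exists_isAdapted [NeZero k] : ∃ ν, V.IsAdapted ν := by
  refine ⟨fun q => Measure.dirac 0, fun q => inferInstance, fun q => ?_, fun q w => ?_,
    fun X hX => ?_⟩
  · rw [ae_dirac_iff]
    · simp
    · have : {l : Cotan k q | ∀ v ∈ S.D q, l v = 0} = ⋂ v ∈ S.D q, {l | l v = 0} := by
        ext l; simp
      rw [this]
      exact (isClosed_biInter fun v _ =>
        isClosed_eq (continuous_eval q v) continuous_const).measurableSet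
  · refine MemLp.of_bound (continuous_eval q w).aestronglyMeasurable 0 ?_
    rw [ae_dirac_iff (measurableSet_le (continuous_eval q w).measurable.norm measurable_const)]
    simp
  · simp only [integral_cyl_dirac_sq]
    exact continuous_const.mul (continuous_sum_lift_sq V hX)

theorem isMicroLaplacian_iff [T2Space M] [NeZero k]
    {L : CorankOneStructure.SmoothFun k M → M → ℝ} :
    V.IsMicroLaplacian L ↔ ∀ (q : M) (U : Set M) (X : Fin k → VField k M), IsOpen U → q ∈ U →
      IsFrameOn S U X → (∀ i, X i q = S.onb q i) → ∀ φ, L φ q = microValue V q X φ := by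
  constructor
  · rintro ⟨⟨ν, hν⟩, h⟩ q U X hU hq hX hXq φ
    have := hν.prob q
    exact tendsto_nhds_unique (h ν hν φ q)
      (tendsto_micro V hU hq hX hXq (hν.vertical q) (hν.two_decreasing q) φ)
  · intro h
    refine ⟨exists_isAdapted V, fun ν hν φ q => ?_⟩
    have := hν.prob q
    obtain ⟨U, X, hU, hq, hX, hXq⟩ := exists_frame S q
    rw [h q U X hU hq hX hXq φ]
    exact tendsto_micro V hU hq hX hXq (hν.vertical q) (hν.two_decreasing q) φ

theorem existsUnique_isMicroLaplacian [T2Space M] [NeZero k] :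
    ∃! L : CorankOneStructure.SmoothFun k M → M → ℝ, V.IsMicroLaplacian L := by
  choose U X hU hq hX hXq using exists_frame S
  refine ⟨fun φ q => microValue V q (X q) φ, ⟨exists_isAdapted V, fun ν hν φ q => ?_⟩, ?_⟩
  · have := hν.prob q
    exact tendsto_micro V (hU q) (hq q) (hX q) (hXq q) (hν.vertical q) (hν.two_decreasing q) φ
  · intro L hL
    funext φ q
    exact (isMicroLaplacian_iff V).1 hL q _ _ (hU q) (hq q) (hX q) (hXq q) φ

end Adapted

/-! ### Derivatives of determinants -/

section Determinants

variable {n : ℕ} {E : Type*} [NormedAddCommGroup E] [NormedSpace ℝ E] [FiniteDimensional ℝ E]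

theorem alternatingMap_update_basis (b : Module.Basis (Fin n) ℝ E) (f : E [⋀^Fin n]→ₗ[ℝ] ℝ)
    (i : Fin n) (u : E) : f (Function.update b i u) = b.coord i u * f b := by
  have h : f.toMultilinearMap.toLinearMap b i = f b • b.coord i := by
    refine b.ext fun j => ?_
    rw [MultilinearMap.toLinearMap_apply, LinearMap.smul_apply, Module.Basis.coord_apply,
      Module.Basis.repr_self, smul_eq_mul]
    rcases eq_or_ne i j with rfl | hij
    · rw [Function.update_eq_self, Finsupp.single_eq_same, mul_one]
      rfl
    · rw [Finsupp.single_eq_of_ne hij, mul_zero]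
      exact f.map_update_self b hij
  have h2 := congrArg (fun L => L u) h
  rw [mul_comm]
  exact h2

theorem sum_coord_eq_trace (b : Module.Basis (Fin n) ℝ E) (A : E →L[ℝ] E) :
    ∑ i, b.coord i (A (b i)) = LinearMap.trace ℝ E A.toLinearMap := by
  rw [LinearMap.trace_eq_matrix_trace ℝ b, Matrix.trace]
  exact Finset.sum_congr rfl fun i _ => by rw [Matrix.diag_apply, LinearMap.toMatrix_apply]; rfl

theorem continuous_basis_det (e : Module.Basis (Fin n) ℝ E) : Continuous fun v => e.det v := by
  simp only [Module.Basis.det_apply]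
  refine Continuous.matrix_det (continuous_matrix fun i j => ?_)
  exact (e.coord i).continuous_of_finiteDimensional.comp (continuous_apply j)

/-- The Leibniz rule for the Lie derivative of a top form, divided by the value of the form:
differentiating the determinant yields the components of DY_i(T), and replacing them by brackets
leaves the trace of DT. -/
theorem fderiv_density (e b : Module.Basis (Fin n) ℝ E) {Y : Fin n → E → E} {x : E}
    (hY : ∀ i, DifferentiableAt ℝ (Y i) x) (hb : ∀ i, b i = Y i x) {w : E → ℝ}
    (hw : DifferentiableAt ℝ w x) (hw0 : w x ≠ 0) (T : E → E) :
    fderiv ℝ (fun z => w z * e.det fun i => Y i z) x (T x) / (w x * e.det fun i => Y i x) =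
      fderiv ℝ w x (T x) / w x + LinearMap.trace ℝ E (fderiv ℝ T x).toLinearMap +
        ∑ i, b.coord i (VectorField.lieBracket ℝ T (Y i) x) := by
  let F : ContinuousMultilinearMap ℝ (fun _ : Fin n => E) ℝ :=
    ⟨e.det.toMultilinearMap, continuous_basis_det e⟩
  have h1 : HasFDerivAt (fun z => e.det fun i => Y i z)
      (∑ i, (F.toContinuousLinearMap (fun j => Y j x) i).comp (fderiv ℝ (Y i) x)) x :=
    HasFDerivAt.multilinear_comp F fun i => (hY i).hasFDerivAt
  have hYb : (fun j => Y j x) = b := funext fun j => (hb j).symm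
  have h2 := (hw.hasFDerivAt.mul h1).fderiv
  have hdet : e.det b ≠ 0 := (e.isUnit_det b).ne_zero
  have h3 : ∀ i v, F.toContinuousLinearMap b i v = b.coord i v * e.det b := fun i v =>
    alternatingMap_update_basis b e.det i v
  have h4 : fderiv ℝ (fun z => w z * e.det fun i => Y i z) x (T x) =
      w x * (∑ i, b.coord i (fderiv ℝ (Y i) x (T x)) * e.det b) +
        e.det b * fderiv ℝ w x (T x) := by
    refine (congrArg (fun L : E →L[ℝ] ℝ => L (T x)) h2).trans ?_
    simp only [add_apply, smul_apply, sum_apply, ContinuousLinearMap.comp_apply, smul_eq_mul,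
      hYb, h3]
  rw [h4, hYb, ← sum_coord_eq_trace b]
  simp only [VectorField.lieBracket, map_sub, Finset.sum_sub_distrib, ← hb]
  rw [← Finset.sum_mul]
  field_simp
  ring

end Determinants

/-! ### The macroscopic Laplacian -/

section Macro

variable {k : ℕ} {M : Type*} [TopologicalSpace M] [ChartedSpace (Model k) M]
    [IsManifold 𝓘(ℝ, Model k) ∞ M] {S : CorankOneStructure k M}

/-- A form of top degree in the chart at `q`. -/
def chartVol (q : M) (τ : TopForm k M) (x : Model k) : Model k [⋀^Fin (k + 1)]→ₗ[ℝ] ℝ :=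
  (τ ((chart k q).symm x)).compLinearMap (dChartSymm q x).toLinearMap

theorem chartVol_apply_chartVField (q : M) (τ : TopForm k M) (Y : Fin (k + 1) → VField k M)
    {x : Model k} (hx : x ∈ (chart k q).target) :
    chartVol q τ x (fun i => chartVField q (Y i) x) =
      τ ((chart k q).symm x) (fun i => Y i ((chart k q).symm x)) :=
  congrArg (τ ((chart k q).symm x)) (funext fun _ => dChartSymm_dChart q hx _)

theorem chartVol_self (q : M) (τ : TopForm k M) (v : Fin (k + 1) → Model k) :
    chartVol q τ (chart k q q) v = τ q v := by
  have h := chartVol_apply_chartVField q τ (fun i _ => v i) (mem_chart_target q)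
  have e : ∀ i, chartVField q (fun p => (v i : Tan k p)) (chart k q q) = v i := fun i =>
    chartVField_self q _
  simp only [e] at h
  rw [h]
  have h : ∀ p, p = q → τ p v = τ q v := by rintro p rfl; rfl
  exact h _ (chart_symm_self q)

/-- The standard basis of the model space. -/
def stdBasis (k : ℕ) : Module.Basis (Fin (k + 1)) ℝ (Model k) :=
  (EuclideanSpace.basisFun (Fin (k + 1)) ℝ).toBasis

/-- The density of a form of top degree in the chart at `q`. -/
def chartDensity (q : M) (τ : TopForm k M) (x : Model k) : ℝ := chartVol q τ x (stdBasis k)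

theorem chartVol_eq (q : M) (τ : TopForm k M) (x : Model k) (v : Fin (k + 1) → Model k) :
    chartVol q τ x v = chartDensity q τ x * (stdBasis k).det v :=
  congrArg (fun f => f v) ((chartVol q τ x).eq_smul_basis_det (stdBasis k))

theorem contDiffOn_chartDensity {τ : TopForm k M} (hτ : IsVolumeForm τ) (q : M) :
    ContDiffOn ℝ ∞ (chartDensity q τ) (chart k q).target := by
  have h1 : ∀ i, SmoothVFieldOn (ofChartVField q fun _ : Model k => stdBasis k i)
      (chart k q).source := fun i => by
    have := smoothVFieldOn_ofChartVField (k := k) q (Ω := univ)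
      (contDiffOn_const (c := stdBasis k i))
    rwa [preimage_univ, inter_univ] at this
  have h2 := contDiffOn_chartFun q (hτ.smooth _ (isOpen_extChartAt_source q) _ h1)
  refine (h2.mono fun x hx => ⟨hx, chart_symm_map q hx⟩).congr fun x hx => ?_
  have h3 := chartVol_apply_chartVField q τ
    (fun i => ofChartVField q fun _ : Model k => stdBasis k i) hx
  rw [Function.comp_apply, ← h3, chartDensity]
  exact congrArg _ (funext fun i => (chartVField_ofChartVField q (fun _ => stdBasis k i) hx).symm)

theorem chartDensity_ne_zero {τ : TopForm k M} (hτ : IsVolumeForm τ) (q : M) :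
    chartDensity q τ (chart k q q) ≠ 0 := by
  rw [chartDensity, chartVol_self]
  exact ((τ q).map_basis_ne_zero_iff (stdBasis k)).2 (hτ.ne_zero q)

/-- Expanding the updated columns in the standard basis leaves only the diagonal entries of DG. -/
theorem divergence_eq {τ : TopForm k M} (hτ : IsVolumeForm τ) (G : VField k M) (q : M) :
    divergence τ G q =
      fderiv ℝ (chartDensity q τ) (chart k q q) (chartVField q G (chart k q q)) /
        chartDensity q τ (chart k q q) +
      LinearMap.trace ℝ (Model k) (fderiv ℝ (chartVField q G) (chart k q q)).toLinearMap := by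
  have hw := chartDensity_ne_zero hτ q
  have hbasis : (fun i => EuclideanSpace.basisFun (Fin (k + 1)) ℝ i) = stdBasis k :=
    (EuclideanSpace.basisFun (Fin (k + 1)) ℝ).coe_toBasis.symm
  have h1 : divergence τ G q =
      (fderiv ℝ (chartDensity q τ) (chart k q q) (chartVField q G (chart k q q)) +
        ∑ i, chartVol q τ (chart k q q) (Function.update (stdBasis k) i
          (fderiv ℝ (chartVField q G) (chart k q q) (stdBasis k i)))) /
      chartDensity q τ (chart k q q) := by
    rw [chartDensity, chartVol_self, ← hbasis]
    rfl
  rw [h1]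
  simp only [alternatingMap_update_basis]
  rw [← Finset.sum_mul, sum_coord_eq_trace, ← chartDensity, add_div, mul_div_cancel_right₀ _ hw]

end Macro

/-! ### Comparison of the two Laplacians -/

section Comparison

variable {k : ℕ} {M : Type*} [TopologicalSpace M] [ChartedSpace (Model k) M]
    [IsManifold 𝓘(ℝ, Model k) ∞ M] {S : CorankOneStructure k M} {η : (p : M) → Cotan k p}

/-- A frame of `D` that extends the chosen orthonormal basis of `D_q`, with a section of the
complement on which `η` is `1`. -/
structure IsAdaptedFrame (η : (p : M) → Cotan k p) (V : S.Complement) (q : M) (U : Set M)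
    (X : Fin k → VField k M) (X₀ : VField k M) : Prop where
  isOpen : IsOpen U
  mem : q ∈ U
  frame : IsFrameOn S U X
  eq_onb : ∀ i, X i q = S.onb q i
  smooth : SmoothVFieldOn X₀ U
  span : ∀ p ∈ U, V.V p = Submodule.span ℝ {X₀ p}
  eta : ∀ p ∈ U, η p (X₀ p) = 1

theorem eta_ne_zero_of_span (hη : S.IsNormalizedContactForm η) (V : S.Complement) {p : M}
    {v : Tan k p} (hv : V.V p = Submodule.span ℝ {v}) : η p v ≠ 0 := by
  intro h
  apply eta_ne_zero hη p
  have h1 : S.D p = ⊤ := by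
    rw [← (V.isCompl p).sup_eq_top, hv, left_eq_sup, Submodule.span_singleton_le_iff_mem]
    exact (hη.ker p v).2 h
  ext w
  exact (hη.ker p w).1 (h1 ▸ Submodule.mem_top)

/-- η has no zero on a local generator of `V`, as otherwise `D` would be the whole tangent space;
dividing by its value normalizes the generator. -/
theorem exists_isAdaptedFrame (hη : S.IsNormalizedContactForm η) (V : S.Complement) (q : M) :
    ∃ U X X₀, IsAdaptedFrame η V q U X X₀ := by
  obtain ⟨U, X, hU, hq, hX, hXq⟩ := exists_frame S q
  obtain ⟨U₀, hU₀, hq₀, X₀, hX₀, hV⟩ := V.smooth q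
  have hne : ∀ p ∈ U₀, η p (X₀ p) ≠ 0 := fun p hp => eta_ne_zero_of_span hη V (hV p hp)
  refine ⟨U ∩ U₀, X, fun p => (η p (X₀ p))⁻¹ • X₀ p, hU.inter hU₀, ⟨hq, hq₀⟩,
    ⟨fun i => ContMDiffOn.mono (hX.smooth i) inter_subset_left, fun p hp => hX.mem p hp.1,
      fun p hp => hX.onb p hp.1⟩, hXq, ?_, ?_, ?_⟩
  · refine smoothVFieldOn_smul ?_ (ContMDiffOn.mono hX₀ inter_subset_right)
    exact ((hη.smooth U₀ hU₀ X₀ hX₀).inv₀ hne).mono inter_subset_right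
  · intro p hp
    rw [hV p hp.2, Submodule.span_singleton_smul_eq (IsUnit.mk0 _ (inv_ne_zero (hne p hp.2)))]
  · intro p hp
    rw [map_smul, smul_eq_mul, inv_mul_cancel₀ (hne p hp.2)]

/-- The frame `X_1, …, X_k, X₀`. -/
def fullFrame (X : Fin k → VField k M) (X₀ : VField k M) : Fin (k + 1) → VField k M :=
  Fin.snoc (α := fun _ => VField k M) X X₀

theorem fullFrame_castSucc (X : Fin k → VField k M) (X₀ : VField k M) (i : Fin k) :
    fullFrame X X₀ i.castSucc = X i :=
  Fin.snoc_castSucc (α := fun _ => VField k M) _ _ _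

theorem fullFrame_last (X : Fin k → VField k M) (X₀ : VField k M) :
    fullFrame X X₀ (Fin.last k) = X₀ :=
  Fin.snoc_last (α := fun _ => VField k M) _ _

theorem fullFrame_apply (X : Fin k → VField k M) (X₀ : VField k M) (p : M) :
    (fun i => fullFrame X X₀ i p) =
      Fin.snoc (α := fun _ => Tan k p) (fun i => X i p) (X₀ p) := by
  refine funext fun i => Fin.lastCases ?_ (fun j => ?_) i
  · rw [Fin.snoc_last, fullFrame_last]
  · rw [Fin.snoc_castSucc, fullFrame_castSucc]

/-- The function `τ(X_1, …, X_k, X₀)`. -/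
def frameDensity (τ : TopForm k M) (X : Fin k → VField k M) (X₀ : VField k M) (p : M) : ℝ :=
  τ p fun i => fullFrame X X₀ i p

variable {V : S.Complement} {q : M} {U : Set M} {X : Fin k → VField k M} {X₀ : VField k M}

namespace IsAdaptedFrame

theorem smooth_fullFrame (h : IsAdaptedFrame η V q U X X₀) (i : Fin (k + 1)) :
    SmoothVFieldOn (fullFrame X X₀ i) U := by
  refine Fin.lastCases ?_ (fun j => ?_) i
  · rw [fullFrame_last]
    exact h.smooth
  · rw [fullFrame_castSucc]
    exact h.frame.smooth j

theorem smooth_frameDensity (h : IsAdaptedFrame η V q U X X₀) {τ : TopForm k M}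
    (hτ : IsVolumeForm τ) : ContMDiffOn 𝓘(ℝ, Model k) 𝓘(ℝ, ℝ) ∞ (frameDensity τ X X₀) U :=
  hτ.smooth U h.isOpen _ h.smooth_fullFrame

theorem mem_nhds (h : IsAdaptedFrame η V q U X X₀) :
    (chart k q).target ∩ (chart k q).symm ⁻¹' U ∈ 𝓝 (chart k q q) :=
  (isOpen_chart_preimage q h.isOpen).mem_nhds
    ⟨mem_chart_target q, by rw [mem_preimage, chart_symm_self]; exact h.mem⟩

theorem differentiableAt (h : IsAdaptedFrame η V q U X X₀) (i : Fin (k + 1)) :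
    DifferentiableAt ℝ (chartVField q (fullFrame X X₀ i)) (chart k q q) :=
  (h.smooth_fullFrame i).differentiableAt_chart h.isOpen h.mem

/-- It identifies the dual basis of the adapted frame: the lifts of the X_j together with η. -/
theorem exists_basis (h : IsAdaptedFrame η V q U X X₀) (hη : S.IsNormalizedContactForm η) :
    ∃ b : Module.Basis (Fin (k + 1)) ℝ (Model k),
      (∀ i, b i = chartVField q (fullFrame X X₀ i) (chart k q q)) ∧
      (∀ j w, b.coord (Fin.castSucc j) w = V.lift q (S.onb q j) w) ∧
      ∀ w, b.coord (Fin.last k) w = η q w := by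
  have hx : X₀ q ∉ S.D q := not_mem_D_of_eta hη (h.eta q h.mem)
  have hl := linearIndependent_snoc (h.frame.onb q h.mem) hx
  have hd : Fintype.card (Fin (k + 1)) = Module.finrank ℝ (Tan k q) := by
    rw [Fintype.card_fin]
    exact (finrank_euclideanSpace_fin (𝕜 := ℝ) (n := k + 1)).symm
  obtain ⟨b, hb⟩ : ∃ b : Module.Basis (Fin (k + 1)) ℝ (Model k),
      ∀ i, b i = fullFrame X X₀ i q := by
    have h1 := coe_basisOfLinearIndependentOfCardEqFinrank hl hd
    exact ⟨basisOfLinearIndependentOfCardEqFinrank hl hd, fun i =>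
      (congrFun h1 i).trans (congrFun (fullFrame_apply X X₀ q).symm i)⟩
  have hbc : ∀ i : Fin k, b i.castSucc = (S.onb q i : Tan k q) := fun i => by
    rw [hb, fullFrame_castSucc]
    exact h.eq_onb i
  have hbl : b (Fin.last k) = X₀ q := by rw [hb, fullFrame_last]
  refine ⟨b, fun i => (hb i).trans (chartVField_self q _).symm, fun j w => ?_, fun w => ?_⟩
  · have e : b.coord (Fin.castSucc j) = (V.lift q (S.onb q j) : Model k →L[ℝ] ℝ).toLinearMap := by
      refine b.ext fun i => ?_
      rw [Module.Basis.coord_apply, Module.Basis.repr_self]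
      refine Fin.lastCases ?_ (fun i => ?_) i
      · rw [Finsupp.single_eq_of_ne (Fin.castSucc_lt_last j).ne]
        have h1 : V.lift q (S.onb q j) (X₀ q) = 0 := by
          rw [lift_apply, (Submodule.projectionOnto_apply_eq_zero_iff (V.isCompl q)).2, map_zero]
          rw [h.span q h.mem]
          exact Submodule.mem_span_singleton_self _
        exact h1.symm.trans (congrArg (V.lift q (S.onb q j) : Model k →L[ℝ] ℝ) hbl.symm)
      · have h1 : V.lift q (S.onb q j) (S.onb q i : Tan k q) = if j = i then 1 else 0 :=
          (lift_apply_mem V q _ _).trans ((onb_spec q).1 j i)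
        refine Eq.trans ?_
          (h1.symm.trans (congrArg (V.lift q (S.onb q j) : Model k →L[ℝ] ℝ) (hbc i).symm))
        rw [Finsupp.single_apply]
        exact if_congr (by rw [Fin.castSucc_inj, eq_comm]) rfl rfl
    exact congrArg (fun L => L w) e
  · have e : b.coord (Fin.last k) = (η q : Model k →L[ℝ] ℝ).toLinearMap := by
      refine b.ext fun i => ?_
      rw [Module.Basis.coord_apply, Module.Basis.repr_self]
      refine Fin.lastCases ?_ (fun i => ?_) i
      · rw [Finsupp.single_eq_same]
        exact (h.eta q h.mem).symm.trans (congrArg (η q : Model k →L[ℝ] ℝ) hbl.symm)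
      · rw [Finsupp.single_eq_of_ne (Fin.castSucc_lt_last i).ne']
        exact ((hη.ker q _).1 (S.onb q i).2).symm.trans
          (congrArg (η q : Model k →L[ℝ] ℝ) (hbc i).symm)
    exact congrArg (fun L => L w) e

/-- The functions η(X_i) = 0 and η(X_0) = 1 are constant, so only the bracket term of Cartan's
formula remains. -/
theorem eta_lieBracket (h : IsAdaptedFrame η V q U X X₀) (hη : S.IsNormalizedContactForm η)
    (i : Fin k) :
    η q (VectorField.lieBracket ℝ (chartVField q (X i)) (chartVField q X₀) (chart k q q) :
      Model k) = dOneForm η q (X₀ q) (S.onb q i : Tan k q) := by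
  have hi : DifferentiableAt ℝ (chartVField q (X i)) (chart k q q) :=
    SmoothVFieldOn.differentiableAt_chart (h.frame.smooth i) h.isOpen h.mem
  have h0 : DifferentiableAt ℝ (chartVField q X₀) (chart k q q) :=
    SmoothVFieldOn.differentiableAt_chart h.smooth h.isOpen h.mem
  have h1 := dOneForm_eq hη.smooth hi h0
  have e1 : (fun x => chartForm q η x (chartVField q X₀ x)) =ᶠ[𝓝 (chart k q q)] fun _ => 1 := by
    filter_upwards [h.mem_nhds] with x hx
    rw [chartForm_apply_chartVField q η _ hx.1]
    exact h.eta _ hx.2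
  have e2 : (fun x => chartForm q η x (chartVField q (X i) x)) =ᶠ[𝓝 (chart k q q)]
      fun _ => 0 := by
    filter_upwards [h.mem_nhds] with x hx
    rw [chartForm_apply_chartVField q η _ hx.1]
    exact (hη.ker _ _).1 (h.frame.mem _ hx.2 i)
  rw [e1.fderiv_eq, e2.fderiv_eq, fderiv_fun_const, fderiv_fun_const,
    mlieBracket_eq_chart, h.eq_onb i, dOneForm_swap] at h1
  have h3 : ∀ v : Model k, (0 : Model k → Model k →L[ℝ] ℝ) (chart k q q) v = 0 := fun v => rfl
  have h4 := h3 (X₀ q)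
  have h5 := h3 (S.onb q i : Tan k q)
  linarith

/-- The logarithmic derivative of `τ(X_1, …, X_k, X₀)` along `X_i`. -/
theorem fderiv_frameDensity (h : IsAdaptedFrame η V q U X X₀) (hη : S.IsNormalizedContactForm η)
    {τ : TopForm k M} (hτ : IsVolumeForm τ) (i : Fin k) :
    fderiv ℝ (frameDensity τ X X₀ ∘ (chart k q).symm) (chart k q q) (S.onb q i : Tan k q) /
        frameDensity τ X X₀ q =
      fderiv ℝ (chartDensity q τ) (chart k q q) (S.onb q i : Tan k q) /
          chartDensity q τ (chart k q q) +
        LinearMap.trace ℝ (Model k)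
          (fderiv ℝ (chartVField q (X i)) (chart k q q)).toLinearMap +
        ∑ j, V.lift q (S.onb q j) (VectorField.lieBracket ℝ (chartVField q (X i))
          (chartVField q (X j)) (chart k q q) : Model k) +
        dOneForm η q (X₀ q) (S.onb q i : Tan k q) := by
  obtain ⟨b, hb, hbc, hbl⟩ := h.exists_basis hη
  have hw := ((contDiffOn_chartDensity hτ q).contDiffAt
    ((isOpen_chart_target q).mem_nhds (mem_chart_target q))).differentiableAt (by simp)
  have key := fderiv_density (stdBasis k) b h.differentiableAt hb hw (chartDensity_ne_zero hτ q)
    (chartVField q (X i))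
  have e : ∀ x ∈ (chart k q).target, (frameDensity τ X X₀ ∘ (chart k q).symm) x =
      chartDensity q τ x * (stdBasis k).det fun j => chartVField q (fullFrame X X₀ j) x :=
    fun x hx => (chartVol_apply_chartVField q τ (fullFrame X X₀) hx).symm.trans
      (chartVol_eq q τ x _)
  have e1 : (frameDensity τ X X₀ ∘ (chart k q).symm) =ᶠ[𝓝 (chart k q q)] fun x =>
      chartDensity q τ x * (stdBasis k).det fun j => chartVField q (fullFrame X X₀ j) x := by
    filter_upwards [(isOpen_chart_target q).mem_nhds (mem_chart_target q)] with x hx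
    exact e x hx
  have e2 : frameDensity τ X X₀ q = chartDensity q τ (chart k q q) *
      (stdBasis k).det fun j => chartVField q (fullFrame X X₀ j) (chart k q q) := by
    rw [← e _ (mem_chart_target q), Function.comp_apply, chart_symm_self]
  have e3 : chartVField q (X i) (chart k q q) = (S.onb q i : Tan k q) :=
    (chartVField_self q (X i)).trans (h.eq_onb i)
  rw [e1.fderiv_eq, e2]
  rw [e3] at key
  refine key.trans ?_
  rw [Fin.sum_univ_castSucc, hbl, fullFrame_last, h.eta_lieBracket hη i, ← add_assoc]
  simp only [hbc, fullFrame_castSucc]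

theorem chartVField_grad (h : IsAdaptedFrame η V q U X X₀)
    (φ : CorankOneStructure.SmoothFun k M) :
    chartVField q (S.grad φ) =ᶠ[𝓝 (chart k q q)]
      fun x => ∑ i, chartDeriv q (X i) φ x • chartVField q (X i) x := by
  filter_upwards [h.mem_nhds] with x hx
  have h1 : S.grad φ ((chart k q).symm x) = ∑ i, (mvfderiv 𝓘(ℝ, Model k) φ ((chart k q).symm x)
      (X i ((chart k q).symm x))) • X i ((chart k q).symm x) := by
    have h2 := congrArg Subtype.val (IsONB.sharp_eq S (h.frame.onb _ hx.2)
      (mvfderiv 𝓘(ℝ, Model k) φ ((chart k q).symm x)))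
    rw [Submodule.coe_sum] at h2
    exact h2
  have h3 : ∀ i, mvfderiv 𝓘(ℝ, Model k) φ ((chart k q).symm x) (X i ((chart k q).symm x)) =
      chartDeriv q (X i) φ x := fun i => by
    rw [mvfderiv_apply_eq q (chart_symm_map q hx.1) (φ.contMDiff.mdifferentiable (by simp) _),
      (chart k q).right_inv hx.1]
    rfl
  rw [chartVField, h1, map_sum]
  refine Finset.sum_congr rfl fun i _ => ?_
  rw [map_smul, h3]
  rfl

theorem differentiableAt_chartDeriv (h : IsAdaptedFrame η V q U X X₀)
    (φ : CorankOneStructure.SmoothFun k M) (i : Fin k) :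
    DifferentiableAt ℝ (chartDeriv q (X i) φ) (chart k q q) := by
  have h1 : DifferentiableAt ℝ (fderiv ℝ (φ ∘ (chart k q).symm)) (chart k q q) :=
    (((contDiffOn_smoothFun φ q).contDiffAt ((isOpen_chart_target q).mem_nhds
      (mem_chart_target q))).fderiv_right (m := 1) (by norm_cast)).differentiableAt (by simp)
  exact h1.clm_apply
    (SmoothVFieldOn.differentiableAt_chart (h.frame.smooth i) h.isOpen h.mem)

/-- The gradient is ∑ (X_iφ) X_i near q. By the product rule its divergence is the sum of X_iφ times
the divergence of X_i and of X_i(X_iφ). -/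
theorem macroLaplacian_eq (h : IsAdaptedFrame η V q U X X₀) {τ : TopForm k M}
    (hτ : IsVolumeForm τ) (φ : CorankOneStructure.SmoothFun k M) :
    S.macroLaplacian τ φ q =
      ∑ i, (chartDeriv q (X i) φ (chart k q q) *
        (fderiv ℝ (chartDensity q τ) (chart k q q) (S.onb q i : Tan k q) /
            chartDensity q τ (chart k q q) +
          LinearMap.trace ℝ (Model k)
            (fderiv ℝ (chartVField q (X i)) (chart k q q)).toLinearMap) +
        fderiv ℝ (chartDeriv q (X i) φ) (chart k q q) (chartVField q (X i) (chart k q q))) := by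
  have e3 : ∀ i, chartVField q (X i) (chart k q q) = (S.onb q i : Tan k q) := fun i =>
    (chartVField_self q (X i)).trans (h.eq_onb i)
  have hg := h.chartVField_grad φ
  have hd : ∀ i, DifferentiableAt ℝ (chartVField q (X i)) (chart k q q) := fun i =>
    SmoothVFieldOn.differentiableAt_chart (h.frame.smooth i) h.isOpen h.mem
  have hG : fderiv ℝ (chartVField q (S.grad φ)) (chart k q q) =
      ∑ i, (chartDeriv q (X i) φ (chart k q q) • fderiv ℝ (chartVField q (X i)) (chart k q q) +
        (fderiv ℝ (chartDeriv q (X i) φ) (chart k q q)).smulRight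
          (chartVField q (X i) (chart k q q))) := by
    rw [hg.fderiv_eq]
    exact (HasFDerivAt.fun_sum fun i _ =>
      (h.differentiableAt_chartDeriv φ i).hasFDerivAt.smul (hd i).hasFDerivAt).fderiv
  rw [CorankOneStructure.macroLaplacian, divergence_eq hτ, hG, hg.eq_of_nhds]
  have htr : LinearMap.trace ℝ (Model k) (∑ i, (chartDeriv q (X i) φ (chart k q q) •
        fderiv ℝ (chartVField q (X i)) (chart k q q) +
        (fderiv ℝ (chartDeriv q (X i) φ) (chart k q q)).smulRight
          (chartVField q (X i) (chart k q q)))).toLinearMap =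
      ∑ i, (chartDeriv q (X i) φ (chart k q q) * LinearMap.trace ℝ (Model k)
        (fderiv ℝ (chartVField q (X i)) (chart k q q)).toLinearMap +
        fderiv ℝ (chartDeriv q (X i) φ) (chart k q q) (chartVField q (X i) (chart k q q))) := by
    rw [ContinuousLinearMap.toLinearMap_sum, map_sum]
    refine Finset.sum_congr rfl fun i _ => ?_
    rw [ContinuousLinearMap.toLinearMap_add, ContinuousLinearMap.toLinearMap_smul, map_add,
      map_smul, smul_eq_mul]
    congr 1
    exact LinearMap.trace_smulRight _ _
  rw [htr, map_sum, Finset.sum_div, ← Finset.sum_add_distrib]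
  refine Finset.sum_congr rfl fun i _ => ?_
  rw [map_smul, smul_eq_mul, ← e3 i]
  ring

/-- The second-order terms coincide, and the horizontal bracket components in the divergence cancel
those of the microscopic Laplacian. Only the density of τ in the frame and the dη-term survive. -/
theorem macroLaplacian_sub_microValue (h : IsAdaptedFrame η V q U X X₀)
    (hη : S.IsNormalizedContactForm η) {τ : TopForm k M} (hτ : IsVolumeForm τ)
    (φ : CorankOneStructure.SmoothFun k M) :
    S.macroLaplacian τ φ q - microValue V q X φ =
      ∑ i, fderiv ℝ (φ ∘ (chart k q).symm) (chart k q q) (S.onb q i : Tan k q) *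
        (fderiv ℝ (frameDensity τ X X₀ ∘ (chart k q).symm) (chart k q q) (S.onb q i : Tan k q) /
          frameDensity τ X X₀ q - dOneForm η q (X₀ q) (S.onb q i : Tan k q)) := by
  rw [h.macroLaplacian_eq hτ, microValue, ← Finset.sum_sub_distrib]
  refine Finset.sum_congr rfl fun i _ => ?_
  have e3 : chartDeriv q (X i) φ (chart k q q) =
      fderiv ℝ (φ ∘ (chart k q).symm) (chart k q q) (S.onb q i : Tan k q) :=
    congrArg (fderiv ℝ (φ ∘ (chart k q).symm) (chart k q q))
      ((chartVField_self q (X i)).trans (h.eq_onb i))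
  have e4 : ∑ j, V.lift q (S.onb q j) (VectorField.lieBracket ℝ (chartVField q (X j))
        (chartVField q (X i)) (chart k q q) : Model k) =
      -∑ j, V.lift q (S.onb q j) (VectorField.lieBracket ℝ (chartVField q (X i))
        (chartVField q (X j)) (chart k q q) : Model k) := by
    rw [← Finset.sum_neg_distrib]
    refine Finset.sum_congr rfl fun j _ => ?_
    rw [VectorField.lieBracket_swap]
    exact map_neg (V.lift q (S.onb q j)) _
  rw [h.fderiv_frameDensity hη hτ i, e4, e3]
  ring

end IsAdaptedFrame

end Comparison

/-! ### Equality of the two Laplacians -/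

section Equality

variable {k : ℕ} {M : Type*} [TopologicalSpace M] [ChartedSpace (Model k) M]
    [IsManifold 𝓘(ℝ, Model k) ∞ M] {S : CorankOneStructure k M} {η : (p : M) → Cotan k p}

theorem exists_smoothFun_fderiv_eq [T2Space M] (q : M) (l : Model k →L[ℝ] ℝ) :
    ∃ φ : CorankOneStructure.SmoothFun k M,
      fderiv ℝ (φ ∘ (chart k q).symm) (chart k q q) = l := by
  obtain ⟨f⟩ : Nonempty (SmoothBumpFunction 𝓘(ℝ, Model k) q) := inferInstance
  have hg : ContMDiffOn 𝓘(ℝ, Model k) 𝓘(ℝ, ℝ) ∞ (fun p => l (chart k q p))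
      (chartAt (Model k) q).source := by
    have := contMDiffOn_of_chartFun (k := k) q (Ω := univ) (l.contDiff.contDiffOn (n := ∞))
    rwa [preimage_univ, inter_univ, extChartAt_source] at this
  refine ⟨⟨fun p => f p • l (chart k q p), f.contMDiff_smul hg⟩, ?_⟩
  have h1 : Tendsto (chart k q).symm (𝓝 (chart k q q)) (𝓝 q) := by
    have h2 : ContinuousAt (chart k q).symm (chart k q q) :=
      (continuousOn_extChartAt_symm q).continuousAt
        ((isOpen_chart_target q).mem_nhds (mem_chart_target q))
    have h3 := h2.tendsto
    rwa [chart_symm_self] at h3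
  have h2 : ((fun p => f p • l (chart k q p)) ∘ (chart k q).symm) =ᶠ[𝓝 (chart k q q)] l := by
    filter_upwards [h1.eventually f.eventuallyEq_one,
      (isOpen_chart_target q).mem_nhds (mem_chart_target q)] with x hx hx2
    rw [Function.comp_apply, hx, (chart k q).right_inv hx2, Pi.one_apply, one_smul]
  exact h2.fderiv_eq.trans l.fderiv

variable {V : S.Complement} {q : M} {U : Set M} {X : Fin k → VField k M} {X₀ : VField k M}

theorem IsAdaptedFrame.forall_macro_eq_iff [T2Space M] (h : IsAdaptedFrame η V q U X X₀)
    (hη : S.IsNormalizedContactForm η) {τ : TopForm k M} (hτ : IsVolumeForm τ) :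
    (∀ φ, S.macroLaplacian τ φ q = microValue V q X φ) ↔
      ∀ i, fderiv ℝ (frameDensity τ X X₀ ∘ (chart k q).symm) (chart k q q)
        (S.onb q i : Tan k q) / frameDensity τ X X₀ q =
        dOneForm η q (X₀ q) (S.onb q i : Tan k q) := by
  constructor
  · intro H i
    -- A function whose differential at q is dual to X_i isolates the i-th coefficient.
    obtain ⟨φ, hφ⟩ := exists_smoothFun_fderiv_eq q (V.lift q (S.onb q i) : Model k →L[ℝ] ℝ)
    have h1 := h.macroLaplacian_sub_microValue hη hτ φ
    have h2 : ∀ j, (V.lift q (S.onb q i) : Model k →L[ℝ] ℝ) (S.onb q j : Tan k q) =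
        if i = j then 1 else 0 := fun j => (lift_apply_mem V q _ _).trans ((onb_spec q).1 i j)
    rw [H φ, sub_self, hφ] at h1
    have h3 := h1.trans (Finset.sum_congr rfl fun j _ => congrArg (· * _) (h2 j))
    simp only [ite_mul, one_mul, zero_mul, Finset.sum_ite_eq, Finset.mem_univ, if_true] at h3
    exact sub_eq_zero.1 h3.symm
  · intro H φ
    rw [← sub_eq_zero, h.macroLaplacian_sub_microValue hη hτ φ]
    exact Finset.sum_eq_zero fun i _ => by rw [H i, sub_self, mul_zero]

theorem isMicroLaplacian_macro_iff [T2Space M] [NeZero k] (hη : S.IsNormalizedContactForm η)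
    (V : S.Complement) {τ : TopForm k M} (hτ : IsVolumeForm τ) :
    V.IsMicroLaplacian (S.macroLaplacian τ) ↔ ∀ q U X X₀, IsAdaptedFrame η V q U X X₀ →
      ∀ i, fderiv ℝ (frameDensity τ X X₀ ∘ (chart k q).symm) (chart k q q)
        (S.onb q i : Tan k q) / frameDensity τ X X₀ q =
        dOneForm η q (X₀ q) (S.onb q i : Tan k q) := by
  rw [isMicroLaplacian_iff]
  constructor
  · intro H q U X X₀ h
    exact (h.forall_macro_eq_iff hη hτ).1 (H q U X h.isOpen h.mem h.frame h.eq_onb)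
  · intro H q U X hU hq hX hXq φ
    obtain ⟨U', X', X₀, h⟩ := exists_isAdaptedFrame hη V q
    -- The given frame need not be the one in the adapted frame; both compute the same limit, so
    -- their values agree.
    obtain ⟨L, hL, -⟩ := existsUnique_isMicroLaplacian V
    rw [isMicroLaplacian_iff] at hL
    rw [← hL q U X hU hq hX hXq φ, hL q U' X' h.isOpen h.mem h.frame h.eq_onb φ]
    exact (h.forall_macro_eq_iff hη hτ).2 (H q U' X' X₀ h) φ

namespace IsAdaptedFrame

theorem frameDensity_sq (h : IsAdaptedFrame η V q U X X₀) (hη : S.IsNormalizedContactForm η)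
    {P : TopForm k M} (hP : S.IsPoppVolume P) {p : M} (hp : p ∈ U) :
    frameDensity P X X₀ p ^ 2 = 1 := by
  have h1 := hP.abs_eq_one p _ (X₀ p) (h.frame.onb p hp)
    (by rw [quotNormSq_eq hη, h.eta p hp, one_pow])
  rw [frameDensity, fullFrame_apply, ← sq_abs]
  exact (congrArg (· ^ 2) h1).trans (one_pow 2)

theorem differentiableAt_frameDensity (h : IsAdaptedFrame η V q U X X₀) {τ : TopForm k M}
    (hτ : IsVolumeForm τ) :
    DifferentiableAt ℝ (frameDensity τ X X₀ ∘ (chart k q).symm) (chart k q q) :=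
  ((contDiffOn_chartFun q (h.smooth_frameDensity hτ)).contDiffAt h.mem_nhds).differentiableAt
    (by simp)

theorem frameDensity_ne_zero (h : IsAdaptedFrame η V q U X X₀)
    (hη : S.IsNormalizedContactForm η) {P : TopForm k M} (hP : S.IsPoppVolume P) {p : M}
    (hp : p ∈ U) : frameDensity P X X₀ p ≠ 0 := by
  intro h0
  have h1 := h.frameDensity_sq hη hP hp
  rw [h0] at h1
  norm_num at h1

/-- The density of Popp's volume in an adapted frame has square 1, so its derivative vanishes. -/
theorem fderiv_frameDensity_popp (h : IsAdaptedFrame η V q U X X₀)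
    (hη : S.IsNormalizedContactForm η) {P : TopForm k M} (hP : S.IsPoppVolume P) :
    fderiv ℝ (frameDensity P X X₀ ∘ (chart k q).symm) (chart k q q) = 0 := by
  set W := frameDensity P X X₀ ∘ (chart k q).symm with hW
  have h1 : (fun x => W x ^ 2) =ᶠ[𝓝 (chart k q q)] fun _ => 1 := by
    filter_upwards [h.mem_nhds] with x hx
    exact h.frameDensity_sq hη hP hx.2
  have h2 := ((h.differentiableAt_frameDensity hP.isVolumeForm).hasFDerivAt.pow 2).fderiv
  have h3 : fderiv ℝ (fun x => W x ^ 2) (chart k q q) = 0 := by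
    rw [h1.fderiv_eq, fderiv_fun_const]
    rfl
  have h4 : W (chart k q q) ≠ 0 := by
    rw [hW, Function.comp_apply, chart_symm_self]
    exact h.frameDensity_ne_zero hη hP h.mem
  have h5 := h2.symm.trans h3
  exact (smul_eq_zero.1 h5).resolve_left (smul_ne_zero two_ne_zero (pow_ne_zero _ h4))

end IsAdaptedFrame

/-! ### The Reeb complement -/

theorem IsReebField.eq_of_apply (hη : S.IsNormalizedContactForm η) {Z : VField k M}
    (hZ : IsReebField η Z) {z : Tan k q} (h1 : ∀ w : Tan k q, dOneForm η q z w = 0)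
    (h2 : η q z = 1) : z = Z q := by
  have hq : q ∈ (chart k q).source := mem_extChartAt_source (I := 𝓘(ℝ, Model k)) q
  rw [(isReebField_iff_eq hη q hq z).1 ⟨h1, h2⟩, (isReebField_iff_eq hη q hq (Z q)).1 (hZ q)]

/-- The complement spanned by the Reeb field. -/
def reebComplement (hη : S.IsNormalizedContactForm η) {Z : VField k M} (hZ : IsReebField η Z) :
    S.Complement where
  V q := Submodule.span ℝ {Z q}
  isCompl q := by
    constructor
    · rw [Submodule.disjoint_def]
      intro v hv hv2
      obtain ⟨c, rfl⟩ := Submodule.mem_span_singleton.1 hv2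
      rw [hη.ker, map_smul, (hZ q).2, smul_eq_mul, mul_one] at hv
      rw [hv, zero_smul]
    · rw [codisjoint_iff, eq_top_iff]
      intro w _
      have h1 : w - η q w • Z q ∈ S.D q := by
        rw [hη.ker, map_sub, map_smul, (hZ q).2, smul_eq_mul, mul_one, sub_self]
      have h2 := Submodule.add_mem_sup h1
        (Submodule.smul_mem _ (η q w) (Submodule.mem_span_singleton_self (R := ℝ) (Z q)))
      rwa [sub_add_cancel] at h2
  smooth q := ⟨(chart k q).source, isOpen_extChartAt_source q,
    mem_extChartAt_source (I := 𝓘(ℝ, Model k)) q, Z, hZ.smooth hη q, fun _ _ => rfl⟩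

theorem IsAdaptedFrame.eq_reeb {hη : S.IsNormalizedContactForm η} {Z : VField k M}
    {hZ : IsReebField η Z} (h : IsAdaptedFrame η (reebComplement hη hZ) q U X X₀) :
    X₀ q = Z q := by
  have h1 : X₀ q ∈ Submodule.span ℝ {Z q} := by
    have h2 := h.span q h.mem
    change Submodule.span ℝ {Z q} = _ at h2
    rw [h2]
    exact Submodule.mem_span_singleton_self _
  obtain ⟨c, hc⟩ := Submodule.mem_span_singleton.1 h1
  have h3 := h.eta q h.mem
  rw [← hc, map_smul, (hZ q).2, smul_eq_mul, mul_one] at h3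
  rw [← hc, h3, one_smul]

/-- dη(X_0, ·) vanishes on `D` by assumption and on X_0 because it is alternating, and these span
the tangent space. -/
theorem IsAdaptedFrame.eq_reeb_of_dOneForm (h : IsAdaptedFrame η V q U X X₀)
    (hη : S.IsNormalizedContactForm η) {Z : VField k M} (hZ : IsReebField η Z)
    (h0 : ∀ i, dOneForm η q (X₀ q) (S.onb q i : Tan k q) = 0) : X₀ q = Z q := by
  refine hZ.eq_of_apply hη (fun w => ?_) (h.eta q h.mem)
  have h1 : w - η q w • X₀ q ∈ S.D q := by
    rw [hη.ker, map_sub, map_smul, h.eta q h.mem, smul_eq_mul, mul_one, sub_self]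
  have h2 := congrArg Subtype.val (IsONB.expand S (onb_spec q) ⟨_, h1⟩)
  rw [Submodule.coe_sum] at h2
  have h3 : w = (∑ i, S.g q (S.onb q i) ⟨_, h1⟩ • (S.onb q i : Tan k q)) + η q w • X₀ q :=
    eq_add_of_sub_eq h2
  rw [h3, map_add, map_sum, map_smul, dOneForm_self, smul_zero, add_zero]
  exact Finset.sum_eq_zero fun i _ => by rw [map_smul, h0 i, smul_zero]

theorem isMicroLaplacian_popp_iff [T2Space M] [NeZero k] (hη : S.IsNormalizedContactForm η)
    {Z : VField k M} (hZ : IsReebField η Z) {P : TopForm k M} (hP : S.IsPoppVolume P)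
    (V : S.Complement) :
    V.IsMicroLaplacian (S.macroLaplacian P) ↔ V = reebComplement hη hZ := by
  rw [isMicroLaplacian_macro_iff hη V hP.isVolumeForm]
  constructor
  · intro H
    refine CorankOneStructure.Complement.ext (funext fun q => ?_)
    obtain ⟨U, X, X₀, h⟩ := exists_isAdaptedFrame hη V q
    have h1 : ∀ i, dOneForm η q (X₀ q) (S.onb q i : Tan k q) = 0 := fun i => by
      rw [← H q U X X₀ h i, h.fderiv_frameDensity_popp hη hP]
      exact zero_div _
    rw [h.span q h.mem, h.eq_reeb_of_dOneForm hη hZ h1]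
    rfl
  · rintro rfl q U X X₀ h i
    rw [h.fderiv_frameDensity_popp hη hP, h.eq_reeb, (hZ q).1]
    exact zero_div _

/-! ### Functions with vanishing horizontal derivative -/

theorem fderiv_chart_self_eq_mvfderiv (q : M) {f : M → ℝ}
    (hf : MDifferentiableAt 𝓘(ℝ, Model k) 𝓘(ℝ, ℝ) f q) (v : Tan k q) :
    fderiv ℝ (f ∘ (chart k q).symm) (chart k q q) v = mvfderiv 𝓘(ℝ, Model k) f q v := by
  rw [mvfderiv_apply_eq q (mem_extChartAt_source (I := 𝓘(ℝ, Model k)) q) hf]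
  exact congrArg (fderiv ℝ (f ∘ (chart k q).symm) (chart k q q))
    (congrArg (fun L : Model k →L[ℝ] Model k => L v) (dChart_self q)).symm

/-- If VF and WF vanish near q for a function F and horizontal fields V and W, then [V, W]F = V(WF)
− W(VF) vanishes at q, and by `step_two` horizontal vectors and such brackets span. -/
theorem mvfderiv_eq_zero_of_horizontal (S : CorankOneStructure k M)
    (f : CorankOneStructure.SmoothFun k M)
    (h : ∀ q, ∀ v ∈ S.D q, mvfderiv 𝓘(ℝ, Model k) f q v = 0) (q : M) :
    mvfderiv 𝓘(ℝ, Model k) f q = 0 := by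
  have hmd : ∀ p, MDifferentiableAt 𝓘(ℝ, Model k) 𝓘(ℝ, ℝ) f p := fun p =>
    f.contMDiff.mdifferentiable (by simp) p
  have hb : ∀ V W : VField k M, IsSectionNear S.D q V → IsSectionNear S.D q W →
      mvfderiv 𝓘(ℝ, Model k) f q (VectorField.mlieBracket 𝓘(ℝ, Model k) V W q) = 0 := by
    intro V W hV hW
    have key : ∀ V : VField k M, IsSectionNear S.D q V →
        DifferentiableAt ℝ (chartVField q V) (chart k q q) ∧
        ∀ v : Model k, fderiv ℝ (fun x => fderiv ℝ (f ∘ (chart k q).symm) x (chartVField q V x))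
          (chart k q q) v = 0 := by
      rintro V ⟨U, hU, hq, hs, hm⟩
      refine ⟨hs.differentiableAt_chart hU hq, fun v => ?_⟩
      have : (fun x => fderiv ℝ (f ∘ (chart k q).symm) x (chartVField q V x))
          =ᶠ[𝓝 (chart k q q)] fun _ => 0 := by
        filter_upwards [(isOpen_chart_preimage q hU).mem_nhds
          ⟨mem_chart_target q, by rwa [mem_preimage, chart_symm_self]⟩] with x hx
        have h1 := mvfderiv_apply_eq q (chart_symm_map q hx.1) (hmd _) (V ((chart k q).symm x))
        rw [h _ _ (hm _ hx.2), (chart k q).right_inv hx.1] at h1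
        exact h1.symm
      rw [this.fderiv_eq, fderiv_fun_const]
      rfl
    have hc : ContDiffAt ℝ 2 (f ∘ (chart k q).symm) (chart k q q) :=
      ((contDiffOn_smoothFun f q).contDiffAt ((isOpen_chart_target q).mem_nhds
        (mem_chart_target q))).of_le (by norm_cast)
    rw [← fderiv_chart_self_eq_mvfderiv q (hmd q), mlieBracket_eq_chart]
    refine (VectorField.fderiv_apply_lieBracket hc (by simp) (key W hW).1 (key V hV).1).trans ?_
    rw [(key W hW).2, (key V hV).2, sub_zero]
  have htop : (⊤ : Submodule ℝ (Tan k q)) ≤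
      LinearMap.ker (mvfderiv 𝓘(ℝ, Model k) f q).toLinearMap := by
    rw [← S.step_two q, sup_le_iff, Submodule.span_le]
    refine ⟨fun v hv => h q v hv, ?_⟩
    rintro _ ⟨V, W, hV, hW, rfl⟩
    exact hb V W hV hW
  ext v
  exact htop (Submodule.mem_top (x := v))

theorem exists_eq_const_of_horizontal [ConnectedSpace M] (S : CorankOneStructure k M)
    (f : CorankOneStructure.SmoothFun k M)
    (h : ∀ q, ∀ v ∈ S.D q, mvfderiv 𝓘(ℝ, Model k) f q v = 0) : ∃ c, ∀ q, f q = c := by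
  have h0 := mvfderiv_eq_zero_of_horizontal S f h
  have hloc : IsLocallyConstant f := by
    rw [IsLocallyConstant.iff_eventually_eq]
    intro q
    obtain ⟨r, hr, hball⟩ := Metric.isOpen_iff.1 (isOpen_chart_target (k := k) q) _
      (mem_chart_target q)
    have hd : EqOn (fderiv ℝ (f ∘ (chart k q).symm)) 0 (Metric.ball (chart k q q) r) := by
      intro x hx
      have hxt := hball hx
      ext v
      have h1 := mvfderiv_apply_eq q (chart_symm_map q hxt)
        (f.contMDiff.mdifferentiable (by simp) _) (dChartSymm q x v)
      rw [h0, dChart_dChartSymm q hxt, (chart k q).right_inv hxt] at h1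
      exact h1.symm
    have hconst := fun x hx => Metric.isOpen_ball.is_const_of_fderiv_eq_zero
      (convex_ball (chart k q q) r).isPreconnected
      (((contDiffOn_smoothFun f q).differentiableOn (by simp)).mono hball) hd (x := x) hx
      (Metric.mem_ball_self hr)
    filter_upwards [(isOpen_extChartAt_source (I := 𝓘(ℝ, Model k)) q).mem_nhds
      (mem_extChartAt_source (I := 𝓘(ℝ, Model k)) q),
      (continuousAt_extChartAt (I := 𝓘(ℝ, Model k)) q).eventually
        (Metric.ball_mem_nhds _ hr)] with p hp hp2
    have h2 := hconst _ hp2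
    rwa [Function.comp_apply, Function.comp_apply, chart_symm_self, (chart k q).left_inv hp] at h2
  obtain ⟨q₀⟩ := (inferInstance : Nonempty M)
  exact ⟨f q₀, fun q => hloc.apply_eq_of_preconnectedSpace q q₀⟩

/-! ### Volumes with the same Laplacian -/

/-- The quotient of two forms of top degree. -/
def volRatio (τ P : TopForm k M) (p : M) : ℝ :=
  τ p (fun i => (stdBasis k i : Model k)) / P p (fun i => (stdBasis k i : Model k))

theorem eq_volRatio_smul {τ P : TopForm k M} (hP : IsVolumeForm P) (p : M) :
    τ p = volRatio τ P p • P p := by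
  let e : Module.Basis (Fin (k + 1)) ℝ (Tan k p) := stdBasis k
  have h0 : P p e ≠ 0 := ((P p).map_basis_ne_zero_iff e).2 (hP.ne_zero p)
  refine Module.Basis.ext_alternating e fun v hv => ?_
  let σ : Equiv.Perm (Fin (k + 1)) := Equiv.ofBijective v (Finite.injective_iff_bijective.1 hv)
  have h1 : (fun i => e (v i)) = e ∘ σ := rfl
  rw [h1, AlternatingMap.map_perm, AlternatingMap.map_perm]
  congr 1
  exact (div_mul_cancel₀ (τ p e) h0).symm

theorem isMicroLaplacian_reeb_iff [T2Space M] [ConnectedSpace M] [NeZero k]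
    (hη : S.IsNormalizedContactForm η) {Z : VField k M} (hZ : IsReebField η Z)
    {P : TopForm k M} (hP : S.IsPoppVolume P) {τ : TopForm k M} (hτ : IsVolumeForm τ) :
    (reebComplement hη hZ).IsMicroLaplacian (S.macroLaplacian τ) ↔
      ∃ c : ℝ, c ≠ 0 ∧ ∀ q, τ q = c • P q := by
  have hPv := hP.isVolumeForm
  rw [isMicroLaplacian_macro_iff hη _ hτ]
  have hfd : ∀ (X : Fin k → VField k M) (X₀ : VField k M) (p : M), frameDensity τ X X₀ p =
      volRatio τ P p * frameDensity P X X₀ p := fun X X₀ p =>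
    congrArg (fun f => f fun i => fullFrame X X₀ i p) (eq_volRatio_smul (τ := τ) hPv p)
  -- The density of P squares to 1, so it is its own inverse. This expresses the ratio by smooth
  -- functions.
  have hf : ∀ {q U X X₀}, IsAdaptedFrame η (reebComplement hη hZ) q U X X₀ → ∀ p ∈ U,
      volRatio τ P p = frameDensity τ X X₀ p * frameDensity P X X₀ p := by
    intro q U X X₀ h p hp
    have h1 := h.frameDensity_sq hη hP hp
    rw [hfd]
    linear_combination (-volRatio τ P p) * h1
  constructor
  · intro H
    have hsm : ContMDiff 𝓘(ℝ, Model k) 𝓘(ℝ, ℝ) ∞ (volRatio τ P) := by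
      intro q
      obtain ⟨U, X, X₀, h⟩ := exists_isAdaptedFrame hη (reebComplement hη hZ) q
      have h1 := (h.smooth_frameDensity hτ).mul (h.smooth_frameDensity hPv)
      refine ((h1 q h.mem).contMDiffAt (h.isOpen.mem_nhds h.mem)).congr_of_eventuallyEq ?_
      filter_upwards [h.isOpen.mem_nhds h.mem] with p hp
      exact hf h p hp
    obtain ⟨c, hc⟩ := exists_eq_const_of_horizontal S ⟨volRatio τ P, hsm⟩ fun q v hv => by
      obtain ⟨U, X, X₀, h⟩ := exists_isAdaptedFrame hη (reebComplement hη hZ) q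
      change mvfderiv 𝓘(ℝ, Model k) (volRatio τ P) q v = 0
      rw [← fderiv_chart_self_eq_mvfderiv q (hsm.mdifferentiable (by simp) q)]
      have h1 : (volRatio τ P ∘ (chart k q).symm) =ᶠ[𝓝 (chart k q q)]
          fun x => (frameDensity τ X X₀ ∘ (chart k q).symm) x *
            (frameDensity P X X₀ ∘ (chart k q).symm) x := by
        filter_upwards [h.mem_nhds] with x hx
        exact hf h _ hx.2
      have h2 : frameDensity τ X X₀ q ≠ 0 := by
        intro h0
        refine vol_snoc_ne_zero (h.frame.onb q h.mem) (not_mem_D_of_eta hη (h.eta q h.mem))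
          (hτ.ne_zero q) ?_
        rwa [frameDensity, fullFrame_apply] at h0
      have h3 : ∀ i, fderiv ℝ (frameDensity τ X X₀ ∘ (chart k q).symm) (chart k q q)
          (S.onb q i : Tan k q) = 0 := fun i => by
        -- Here X_0 is the Reeb vector at q, so the right-hand side is zero.
        have h4 := H q U X X₀ h i
        rw [h.eq_reeb, (hZ q).1] at h4
        exact (div_eq_zero_iff.1 h4).resolve_right h2
      have h5 : fderiv ℝ (volRatio τ P ∘ (chart k q).symm) (chart k q q) =
          (frameDensity P X X₀ ∘ (chart k q).symm) (chart k q q) •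
            fderiv ℝ (frameDensity τ X X₀ ∘ (chart k q).symm) (chart k q q) := by
        rw [h1.fderiv_eq, fderiv_fun_mul (h.differentiableAt_frameDensity hτ)
          (h.differentiableAt_frameDensity hPv), h.fderiv_frameDensity_popp hη hP, smul_zero,
          zero_add]
      have h6 := congrArg Subtype.val (IsONB.expand S (onb_spec q) ⟨v, hv⟩)
      rw [Submodule.coe_sum] at h6
      have h7 : v = ∑ i, S.g q (S.onb q i) ⟨v, hv⟩ • (S.onb q i : Tan k q) := h6
      refine (congrArg (fun L : Model k →L[ℝ] ℝ => L v) h5).trans ?_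
      refine (congrArg (fun x : ℝ => _ * x) ?_).trans (mul_zero _)
      refine (congrArg (fderiv ℝ (frameDensity τ X X₀ ∘ (chart k q).symm) (chart k q q)) h7).trans ?_
      refine (map_sum _ _ _).trans (Finset.sum_eq_zero fun i _ => ?_)
      exact (map_smul _ _ _).trans (by rw [h3 i, smul_zero])
    have hc' : ∀ q, τ q = c • P q := fun q =>
      (eq_volRatio_smul hPv q).trans (congrArg (fun r : ℝ => r • P q) (hc q))
    refine ⟨c, ?_, hc'⟩
    rintro rfl
    obtain ⟨q⟩ := (inferInstance : Nonempty M)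
    exact hτ.ne_zero q ((hc' q).trans (zero_smul _ _))
  · rintro ⟨c, -, hc⟩ q U X X₀ h i
    have h1 : (frameDensity τ X X₀ ∘ (chart k q).symm) =
        fun x => c * (frameDensity P X X₀ ∘ (chart k q).symm) x := funext fun x =>
      congrArg (fun f => f fun i => fullFrame X X₀ i ((chart k q).symm x)) (hc _)
    rw [h1, fderiv_const_mul (h.differentiableAt_frameDensity hPv),
      h.fderiv_frameDensity_popp hη hP, smul_zero, h.eq_reeb, (hZ q).1]
    exact zero_div _

/-- In rank 0 the sum defining ‖J‖² is empty and cannot equal 1. -/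
theorem rank_ne_zero [Nonempty M] (hη : S.IsNormalizedContactForm η) : k ≠ 0 := by
  rintro rfl
  obtain ⟨q⟩ := (inferInstance : Nonempty M)
  have h := hη.norm_eq_one q _ (onb_spec q)
  simp at h

end Equality

end SubRiem

end

open SubRiem in
theorem corollaryc (d : ℕ) (M : Type*) [TopologicalSpace M] [T2Space M]
    [SecondCountableTopology M] [ConnectedSpace M] [ChartedSpace (Model (2 * d)) M]
    [IsManifold 𝓘(ℝ, Model (2 * d)) ∞ M]
    (orientable : ∃ vol₀ : TopForm (2 * d) M, IsVolumeForm vol₀)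
    (S : CorankOneStructure (2 * d) M)
    (η : (q : M) → Cotan (2 * d) q) (hη : S.IsNormalizedContactForm η) :
    (∃! Z : VField (2 * d) M, IsReebField η Z) ∧
    (∃ P : TopForm (2 * d) M, S.IsPoppVolume P) ∧
    (∀ V : S.Complement, ∃! L : CorankOneStructure.SmoothFun (2 * d) M → M → ℝ,
      V.IsMicroLaplacian L) ∧
    ∀ Z : VField (2 * d) M, IsReebField η Z → ∀ P : TopForm (2 * d) M, S.IsPoppVolume P →
      ∃ VZ : S.Complement, (∀ q, VZ.V q = Submodule.span ℝ {Z q}) ∧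
        (∀ V : S.Complement, V.IsMicroLaplacian (S.macroLaplacian P) ↔ V = VZ) ∧
        (∀ vol : TopForm (2 * d) M, IsVolumeForm vol →
          (VZ.IsMicroLaplacian (S.macroLaplacian vol) ↔
            ∃ c : ℝ, c ≠ 0 ∧ ∀ q, vol q = c • P q)) := by
  have hk : NeZero (2 * d) := ⟨rank_ne_zero hη⟩
  obtain ⟨vol₀, hvol₀⟩ := orientable
  refine ⟨existsUnique_reeb hη, exists_isPoppVolume hη hvol₀,
    fun V => existsUnique_isMicroLaplacian V, fun Z hZ P hP =>
      ⟨reebComplement hη hZ, fun _ => rfl, isMicroLaplacian_popp_iff hη hZ hP,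
        fun τ hτ => isMicroLaplacian_reeb_iff hη hZ hP hτ⟩⟩
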